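/- Fix $m>3/2$. On $\mathbb R^2$ let $b(x_\perp)=(1+x_1^2)^{1/2}(1+x_2^2)^{1/2}$, let $L^2(m)$ be the space of measurable $\omega:\mathbb R^2\to\mathbb R$ (modulo equality almost everywhere) with $\|\omega\|_{L^2(m)}^2=\int_{\mathbb R^2} b^{2m}|\omega|^2\,dx_\perp<\infty$, and for $\lambda\in[0,1)$ let $$\mathcal G_\lambda(x_\perp)=\frac{\sqrt{1-\lambda^2}}{4\pi}\,e^{-\frac14\left((1+\lambda)x_1^2+(1-\lambda)x_2^2\right)} .$$ Let $\mathbf u^s(x)=(\gamma_1x_1,\gamma_2x_2,\gamma_3x_3)$ with $\gamma_1=-\frac12(1+\lambda)$, $\gamma_2=-\frac12(1-\lambda)$, $\gamma_3=1$. A stationary solution is a vector field $\mathbf\Omega$ on $\mathbb R^3$ that satisfies, in the sense of distributions, $$(\mathbf U\cdot\nabla)\mathbf\Omega-(\mathbf\Omega\cdot\nabla)\mathbf U+(\mathbf u^s\cdot\nabla)\mathbf\Omega-(\mathbf\Omega\cdot\nabla)\mathbf u^s=\Delta\mathbf\Omega,\qquad \nabla\cdot\mathbf\Omega=0,$$ where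 $\mathbf U(x)=-\frac1{4\pi}\int_{\mathbb R^3}\frac{(x-y)\times\mathbf\Omega(y)}{|x-y|^3}\,dy$. There exist functions $R_1,K_1:[0,1)\to(0,\infty)$, with $R_1$ continuous, such that for every $\lambda\in[0,1)$ and every $\rho\in\mathbb R$ with $|\rho|\le R_1(\lambda)$ there is a stationary solution of the form $$\mathbf\Omega^B=(0,0,\Omega^B(x_\perp;\rho,\lambda)),\quad \Omega^B(\cdot;\rho,\lambda)\in L^2(m),\qquad \int_{\mathbb R^2}\Omega^B(x_\perp;\rho,\lambda)\,dx_\perp=\rho,$$ which satisfies $$\|\Omega^B(\cdot;\rho,\lambda)-\rho\,\mathcal G_\lambda\|_{L^2(m)}\le K_1(\lambda)\,\rho^2,$$ and there is no other stationary solution of the form $(0,0,\Omega(x_\perp))$ with $\Omega\in L^2(m)$, $\int_{\mathbb R^2}\Omega\,dx_\perp=\rho$ and $\|\Omega-\rho\,\mathcal G_\lambda\|_{L^2(m)}\le 2R_1(\lambda)$. Moreover, the map $(\rho,\lambda)\mapsto\Omega^B(\cdot;\rho,\lambda)$ is $C^\infty$, with values in $L^2(m)$, on the set $\{(\rho,\lambda):0\le\lambda<1,\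 |\rho|\le R_1(\lambda)\}$. -/

import Mathlib

open MeasureTheory Set
open scoped ContDiff

noncomputable section

namespace BurgersVortex

/-- The horizontal plane `ℝ²`, with the Euclidean norm and Lebesgue measure. -/
abbrev Plane := EuclideanSpace ℝ (Fin 2)

/-- The space `ℝ³`, with the Euclidean norm and Lebesgue measure. -/
abbrev Space := EuclideanSpace ℝ (Fin 3)

/-! ### The vorticity equation in a strain -/

/-- The strain rates `(γ₁, γ₂, γ₃) = (-(1 + lam)/2, -(1 - lam)/2, 1)`. -/
def strainRate (lam : ℝ) : Fin 3 → ℝ :=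
  ![-(1 + lam) / 2, -(1 - lam) / 2, 1]

/-- The straining flow `u^s(x) = (γ₁ x₁, γ₂ x₂, γ₃ x₃)`. -/
def strain (γ : Fin 3 → ℝ) (x : Space) : Space :=
  WithLp.toLp 2 (fun i => γ i * x i)

/-- The integrand `(x - y) × Ω(y) / |x - y|³` of the three-dimensional Biot-Savart law. -/
def biotSavartIntegrand (Ω : Space → Space) (x y : Space) : Space :=
  (‖x - y‖ ^ 3)⁻¹ • WithLp.toLp 2 (crossProduct (WithLp.ofLp (x - y)) (WithLp.ofLp (Ω y)))

/-- The velocity field `U(x) = -(1/4π) ∫ (x - y) × Ω(y) / |x - y|³ dy` generated by `Ω`. -/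
def biotSavart (Ω : Space → Space) (x : Space) : Space :=
  (-(1 / (4 * Real.pi))) • ∫ y, biotSavartIntegrand Ω x y

/-- The partial derivative `∂ⱼ φ` of a scalar function on `ℝ³`. -/
def partialDeriv (j : Fin 3) (φ : Space → ℝ) (x : Space) : ℝ :=
  fderiv ℝ φ x (EuclideanSpace.single j 1)

/-- The Laplacian `∑ⱼ ∂ⱼ ∂ⱼ φ` of a scalar function on `ℝ³`. -/
def laplace (φ : Space → ℝ) (x : Space) : ℝ :=
  ∑ j : Fin 3, partialDeriv j (partialDeriv j φ) x

/-- `Ω` is a stationary solution, in the sense of distributions on `ℝ³`, of the vorticity equation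
`(U·∇)Ω - (Ω·∇)U + (u^s·∇)Ω - (Ω·∇)u^s = ΔΩ`, `∇·Ω = 0`,
where `u^s` is the strain with rates `γ` and `U` is the velocity field given by the Biot-Savart law.
All the fields being divergence free, the left-hand side of the `i`-th equation is
`∑ⱼ ∂ⱼ (Vⱼ Ωᵢ - Ωⱼ Vᵢ)` with `V = U + u^s`; this is what is tested against `φ ∈ C_c^∞`.
The first three fields say that the terms of the equation make sense. -/
structure IsStationarySolution (γ : Fin 3 → ℝ) (Ω : Space → Space) : Prop where
  locallyIntegrable : LocallyIntegrable Ω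
  integrable_biotSavart : ∀ᵐ x : Space, Integrable (biotSavartIntegrand Ω x)
  locallyIntegrable_mul : ∀ i j : Fin 3,
    LocallyIntegrable (fun x : Space => biotSavart Ω x j * Ω x i)
  divergence_free : ∀ φ : Space → ℝ, ContDiff ℝ ∞ φ → HasCompactSupport φ →
    ∫ x : Space, ∑ j : Fin 3, Ω x j * partialDeriv j φ x = 0
  equation : ∀ φ : Space → ℝ, ContDiff ℝ ∞ φ → HasCompactSupport φ → ∀ i : Fin 3,
    ∫ x : Space,
      ((∑ j : Fin 3,
          ((biotSavart Ω x j + strain γ x j) * Ω x i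
            - Ω x j * (biotSavart Ω x i + strain γ x i)) * partialDeriv j φ x)
        + Ω x i * laplace φ x) = 0

/-- The vector field `(0, 0, w(x₁, x₂))` on `ℝ³`. -/
def verticalField (w : Plane → ℝ) (x : Space) : Space :=
  !₂[0, 0, w !₂[x 0, x 1]]

/-! ### The weighted space `L²(m)` and the Gaussian vortex -/

/-- The weight `b(x) = (1 + x₁²)^{1/2} (1 + x₂²)^{1/2}`. -/
def weight (x : Plane) : ℝ :=
  Real.sqrt (1 + x 0 ^ 2) * Real.sqrt (1 + x 1 ^ 2)

/-- The measure `b(x)^{2m} dx` on the plane. -/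
def weightedMeasure (m : ℝ) : Measure Plane :=
  (volume : Measure Plane).withDensity (fun x => ENNReal.ofReal (weight x ^ (2 * m)))

/-- The space `L²(m)`, with the norm `‖w‖² = ∫ b(x)^{2m} |w(x)|² dx`. -/
abbrev WeightedL2 (m : ℝ) := Lp ℝ 2 (weightedMeasure m)

/-- The norm of `L²(m)`, with values in `[0, ∞]`. -/
def weightedNorm (m : ℝ) (w : Plane → ℝ) : ENNReal :=
  eLpNorm w 2 (weightedMeasure m)

/-- `𝒢_lam(x) = √(1 - lam²) / (4π) · exp (-((1 + lam) x₁² + (1 - lam) x₂²) / 4)`. -/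
def gaussianVortex (lam : ℝ) (x : Plane) : ℝ :=
  Real.sqrt (1 - lam ^ 2) / (4 * Real.pi) *
    Real.exp (-(1 / 4) * ((1 + lam) * x 0 ^ 2 + (1 - lam) * x 1 ^ 2))

/-- `(0, 0, w(x₁, x₂))` is a stationary solution of the vorticity equation in the strain of
asymmetry `lam`, and it has total circulation `ρ`. -/
structure IsVortex (ρ lam : ℝ) (w : Plane → ℝ) : Prop where
  stationary : IsStationarySolution (strainRate lam) (verticalField w)
  integrable : Integrable w
  circulation : ∫ x : Plane, w x = ρ

end BurgersVortex

end

/-! Let `αⱼ = rate lam j` and `L h = Δh + Σⱼ αⱼ ∂ⱼ(xⱼ h)`. For a columnar field `(0, 0, w)` the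
divergence condition and the two horizontal components of the vorticity equation only involve
vertical derivatives of test functions against functions of `x_⊥`, and these integrate to zero. The
vertical component becomes the planar equation `L w = div (u w)`, with `u` the planar Biot-Savart
velocity of `w` (`biotSavart_verticalField`, `isStationarySolution_iff`).

The operator `L` is solved explicitly. In Fourier variables `L h = div f` is a linear ordinary
differential equation along the characteristics `exp (-A t) ξ`, with `A` the diagonal matrix of the
`αⱼ`, and these tend to the frequency zero. Hence `h` is its mass times the Gaussian vortex plus
`L⁻¹ div f`, where `L⁻¹ div = -∫₀^∞ exp (t L) div dt` has a Mehler-type kernel (`Solves.ae_eq`,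
`FT_invDiv`). A vortex of circulation `ρ` is therefore exactly a fixed point of `w = ρ G + T(w, w) /
2` with `T(a, b) = L⁻¹ div (u_a b + u_b a)` (`isVortex_coe_iff`).

Existence, the quadratic estimate and local uniqueness follow from Banach's theorem once `T` is
bounded on `L²(m)`. The velocity lies in `L^q` for `q > 2`, the flux in a weighted `L^r` with `r`
slightly above `1`, and Young's inequality for the kernel returns to weighted `L²`
(`expNorm_invDiv_flux_le`). The condition `m > 3/2` gives first moments.

Smoothness in the asymmetry is the delicate point: `L_lam - L_mu = (lam - mu) div (shear ·)`
multiplies by `x`, which is unbounded on `L²(m)`. All bounds are therefore proved in the weights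
`b^m exp (ε |x|)` with constants uniform in `0 ≤ ε ≤ 1`, and the fixed point is found in a ball of
the norm with `ε = 1`. The operator `Q = L⁻¹ div shear` maps the weight `ε'` to any smaller `ε`. The
identities `X_lam = X_mu - (lam - mu) Q_mu X_lam` for `X = G, T, Q` allow differentiation along this
scale with loss. The families built from `G`, the solution, `Q`, `T` and the resolvent of the
linearised problem are closed under both partial derivatives (`Gen.exists_deriv`), so an induction
gives every order of smoothness. -/

noncomputable section

namespace BurgersVortex

open Filter Topology Asymptotics

/-! ### Smoothness along a scale of seminorms, with loss -/

/-! ### Landau calculus in a family of seminorms in which operators may lose. -/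

section Scale

variable {V : Type*} [AddCommGroup V] [Module ℝ V]

/-- A family of vectors is `O(φ)` in every seminorm of the scale. -/
def ScaleBig (N : ℝ → Seminorm ℝ V) (l : Filter (ℝ × ℝ)) (φ : ℝ × ℝ → ℝ) (f : ℝ × ℝ → V) : Prop :=
  ∀ ε ∈ Ico (0 : ℝ) 1, (fun p => N ε (f p)) =O[l] φ

/-- A family of vectors is `o(φ)` in every seminorm of the scale. -/
def ScaleSmall (N : ℝ → Seminorm ℝ V) (l : Filter (ℝ × ℝ)) (φ : ℝ × ℝ → ℝ)
    (f : ℝ × ℝ → V) : Prop :=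
  ∀ ε ∈ Ico (0 : ℝ) 1, (fun p => N ε (f p)) =o[l] φ

/-- A family of maps that is locally bounded, with a loss in the scale. -/
def ScaleBdd (N : ℝ → Seminorm ℝ V) (l : Filter (ℝ × ℝ)) (A : ℝ × ℝ → V → V) : Prop :=
  ∀ ε ∈ Ico (0 : ℝ) 1, ∃ ε' ∈ Ico (0 : ℝ) 1, ∃ C : ℝ, ∀ᶠ p in l, ∀ h, N ε (A p h) ≤ C * N ε' h

/-- A family of two-variable maps that is locally bounded along the scale. -/
def ScaleBdd₂ (N : ℝ → Seminorm ℝ V) (l : Filter (ℝ × ℝ)) (B : ℝ × ℝ → V → V → V) : Prop :=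
  ∀ ε ∈ Ico (0 : ℝ) 1, ∃ C : ℝ, ∀ᶠ p in l, ∀ a b, N ε (B p a b) ≤ C * N ε a * N ε b

variable {N : ℝ → Seminorm ℝ V} {l : Filter (ℝ × ℝ)} {φ ψ : ℝ × ℝ → ℝ} {f g : ℝ × ℝ → V}

theorem ScaleSmall.big (h : ScaleSmall N l φ f) : ScaleBig N l φ f := fun ε hε => (h ε hε).isBigO

theorem ScaleBig.add (hf : ScaleBig N l φ f) (hg : ScaleBig N l φ g) :
    ScaleBig N l φ (fun p => f p + g p) := fun ε hε =>
  IsBigO.trans (IsBigO.of_norm_le fun p => by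
    rw [Real.norm_of_nonneg (apply_nonneg _ _)]
    exact map_add_le_add _ _ _) ((hf ε hε).add (hg ε hε))

theorem ScaleSmall.add (hf : ScaleSmall N l φ f) (hg : ScaleSmall N l φ g) :
    ScaleSmall N l φ (fun p => f p + g p) := fun ε hε =>
  IsBigO.trans_isLittleO (IsBigO.of_norm_le fun p => by
    rw [Real.norm_of_nonneg (apply_nonneg _ _)]
    exact map_add_le_add _ _ _) ((hf ε hε).add (hg ε hε))

theorem ScaleBig.neg (hf : ScaleBig N l φ f) : ScaleBig N l φ (fun p => -f p) := fun ε hε => by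
  simpa using hf ε hε

theorem ScaleSmall.neg (hf : ScaleSmall N l φ f) : ScaleSmall N l φ (fun p => -f p) :=
  fun ε hε => by simpa using hf ε hε

theorem ScaleBig.sub (hf : ScaleBig N l φ f) (hg : ScaleBig N l φ g) :
    ScaleBig N l φ (fun p => f p - g p) := by
  simpa [sub_eq_add_neg] using hf.add hg.neg

theorem ScaleSmall.sub (hf : ScaleSmall N l φ f) (hg : ScaleSmall N l φ g) :
    ScaleSmall N l φ (fun p => f p - g p) := by
  simpa [sub_eq_add_neg] using hf.add hg.neg

theorem ScaleBig.const (v : V) : ScaleBig N l (fun _ => 1) (fun _ => v) := fun _ _ =>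
  isBigO_const_const _ one_ne_zero _

theorem ScaleBig.smul {c : ℝ × ℝ → ℝ} (hc : c =O[l] φ) (hf : ScaleBig N l ψ f) :
    ScaleBig N l (fun p => φ p * ψ p) (fun p => c p • f p) := fun ε hε => by
  simpa [map_smul_eq_mul] using hc.norm_left.mul (hf ε hε)

theorem ScaleBig.bdd {A : ℝ × ℝ → V → V} (hA : ScaleBdd N l A) (hf : ScaleBig N l φ f) :
    ScaleBig N l φ (fun p => A p (f p)) := fun ε hε => by
  obtain ⟨ε', hε', C, hC⟩ := hA ε hε
  refine IsBigO.trans (IsBigO.of_bound C ?_) (hf ε' hε')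
  filter_upwards [hC] with p hp
  rw [Real.norm_of_nonneg (apply_nonneg _ _), Real.norm_of_nonneg (apply_nonneg _ _)]
  exact hp _

theorem ScaleSmall.bdd {A : ℝ × ℝ → V → V} (hA : ScaleBdd N l A) (hf : ScaleSmall N l φ f) :
    ScaleSmall N l φ (fun p => A p (f p)) := fun ε hε => by
  obtain ⟨ε', hε', C, hC⟩ := hA ε hε
  refine IsBigO.trans_isLittleO (IsBigO.of_bound C ?_) (hf ε' hε')
  filter_upwards [hC] with p hp
  rw [Real.norm_of_nonneg (apply_nonneg _ _), Real.norm_of_nonneg (apply_nonneg _ _)]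
  exact hp _

theorem ScaleBdd₂.isBigO {B : ℝ × ℝ → V → V → V} (hB : ScaleBdd₂ N l B) {ε : ℝ}
    (hε : ε ∈ Ico (0 : ℝ) 1) (f g : ℝ × ℝ → V) :
    (fun p => N ε (B p (f p) (g p))) =O[l] fun p => N ε (f p) * N ε (g p) := by
  obtain ⟨C, hC⟩ := hB ε hε
  refine IsBigO.of_bound C ?_
  filter_upwards [hC] with p hp
  rw [Real.norm_of_nonneg (apply_nonneg _ _),
    Real.norm_of_nonneg (mul_nonneg (apply_nonneg _ _) (apply_nonneg _ _)), ← mul_assoc]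
  exact hp _ _

theorem ScaleBig.bdd₂ {B : ℝ × ℝ → V → V → V} (hB : ScaleBdd₂ N l B) (hf : ScaleBig N l φ f)
    (hg : ScaleBig N l ψ g) : ScaleBig N l (fun p => φ p * ψ p) (fun p => B p (f p) (g p)) :=
  fun ε hε => (hB.isBigO hε f g).trans ((hf ε hε).mul (hg ε hε))

theorem ScaleSmall.bdd₂_right {B : ℝ × ℝ → V → V → V} (hB : ScaleBdd₂ N l B)
    (hf : ScaleBig N l (fun _ => 1) f) (hg : ScaleSmall N l ψ g) :
    ScaleSmall N l ψ (fun p => B p (f p) (g p)) :=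
  fun ε hε => (hB.isBigO hε f g).trans_isLittleO (by
    simpa using (hf ε hε).mul_isLittleO (hg ε hε))

theorem ScaleSmall.smul_const (c : ℝ) (hf : ScaleSmall N l φ f) :
    ScaleSmall N l φ (fun p => c • f p) := fun ε hε => by
  simpa [map_smul_eq_mul] using (hf ε hε).const_mul_left ‖c‖

theorem ScaleBig.mono (hf : ScaleBig N l φ f) (h : φ =O[l] ψ) : ScaleBig N l ψ f :=
  fun ε hε => (hf ε hε).trans h

theorem ScaleBig.small (hf : ScaleBig N l φ f) (h : φ =o[l] ψ) : ScaleSmall N l ψ f :=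
  fun ε hε => (hf ε hε).trans_isLittleO h

/-- `f` is differentiable at `q` within `D` along the scale, with partial derivatives `a`, `b`. -/
def ScaleDeriv (N : ℝ → Seminorm ℝ V) (D : Set (ℝ × ℝ)) (f : ℝ × ℝ → V) (q : ℝ × ℝ)
    (a b : V) : Prop :=
  ScaleSmall N (𝓝[D] q) (fun p => ‖p - q‖)
    (fun p => f p - f q - (p.1 - q.1) • a - (p.2 - q.2) • b)

variable {D : Set (ℝ × ℝ)} {q : ℝ × ℝ} {a b : V}

theorem fst_sub_isBigO : (fun p : ℝ × ℝ => p.1 - q.1) =O[l] fun p => ‖p - q‖ :=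
  IsBigO.of_norm_le fun p => by
    simpa using norm_fst_le (p - q)

theorem snd_sub_isBigO : (fun p : ℝ × ℝ => p.2 - q.2) =O[l] fun p => ‖p - q‖ :=
  IsBigO.of_norm_le fun p => by
    simpa using norm_snd_le (p - q)

theorem norm_sub_isBigO_one : (fun p : ℝ × ℝ => ‖p - q‖) =o[𝓝[D] q] fun _ => (1 : ℝ) := by
  rw [isLittleO_one_iff]
  have : Tendsto (fun p : ℝ × ℝ => ‖p - q‖) (𝓝 q) (𝓝 ‖q - q‖) :=
    (continuous_id.sub continuous_const).norm.tendsto q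
  simpa using this.mono_left nhdsWithin_le_nhds

theorem norm_sub_sq_isLittleO :
    (fun p : ℝ × ℝ => ‖p - q‖ * ‖p - q‖) =o[𝓝[D] q] fun p => ‖p - q‖ := by
  simpa using (norm_sub_isBigO_one (D := D) (q := q)).mul_isBigO
    (isBigO_refl (fun p : ℝ × ℝ => ‖p - q‖) (𝓝[D] q))

theorem ScaleBig.fst_smul (hf : ScaleBig N (𝓝[D] q) (fun _ => 1) f) :
    ScaleBig N (𝓝[D] q) (fun p => ‖p - q‖) (fun p => (p.1 - q.1) • f p) := by
  simpa only [mul_one] using hf.smul (fst_sub_isBigO (l := 𝓝[D] q) (q := q))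

theorem ScaleBig.snd_smul (hf : ScaleBig N (𝓝[D] q) (fun _ => 1) f) :
    ScaleBig N (𝓝[D] q) (fun p => ‖p - q‖) (fun p => (p.2 - q.2) • f p) := by
  simpa only [mul_one] using hf.smul (snd_sub_isBigO (l := 𝓝[D] q) (q := q))

theorem ScaleBig.snd_smul_small (hf : ScaleBig N (𝓝[D] q) (fun p => ‖p - q‖) f) :
    ScaleSmall N (𝓝[D] q) (fun p => ‖p - q‖) (fun p => (p.2 - q.2) • f p) :=
  (hf.smul (snd_sub_isBigO (l := 𝓝[D] q) (q := q))).small norm_sub_sq_isLittleO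

theorem ScaleBig.bdd₂_left {B : ℝ × ℝ → V → V → V} (hB : ScaleBdd₂ N l B) (hf : ScaleBig N l φ f)
    (hg : ScaleBig N l (fun _ => 1) g) : ScaleBig N l φ (fun p => B p (f p) (g p)) := by
  simpa only [mul_one] using hf.bdd₂ hB hg

theorem ScaleBig.bdd₂_right {B : ℝ × ℝ → V → V → V} (hB : ScaleBdd₂ N l B)
    (hf : ScaleBig N l (fun _ => 1) f) (hg : ScaleBig N l φ g) :
    ScaleBig N l φ (fun p => B p (f p) (g p)) := by
  simpa only [one_mul] using hf.bdd₂ hB hg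

theorem ScaleBig.congr_mem (hf : ScaleBig N (𝓝[D] q) φ f) (h : ∀ p ∈ D, g p = f p) :
    ScaleBig N (𝓝[D] q) φ g := fun ε hε => by
  refine (hf ε hε).congr' ?_ EventuallyEq.rfl
  filter_upwards [self_mem_nhdsWithin] with p hp
  rw [h p hp]

theorem ScaleDeriv.big (h : ScaleDeriv N D f q a b) :
    ScaleBig N (𝓝[D] q) (fun p => ‖p - q‖) (fun p => f p - f q) := by
  refine ((ScaleSmall.big h).add ((ScaleBig.const (N := N) a).fst_smul.add
    (ScaleBig.const (N := N) b).snd_smul)).congr_mem fun p _ => ?_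
  abel

/-- A Lipschitz bound at `q` gives a local bound; no continuity hypothesis on the family is ever
needed separately. -/
theorem ScaleBig.of_sub (h : ScaleBig N (𝓝[D] q) (fun p => ‖p - q‖) (fun p => f p - f q)) :
    ScaleBig N (𝓝[D] q) (fun _ => 1) f := by
  have := (h.mono norm_sub_isBigO_one.isBigO).add (ScaleBig.const (f q))
  simpa using this

theorem ScaleDeriv.of_small {r : ℝ × ℝ → V}
    (hr : ScaleSmall N (𝓝[D] q) (fun p => ‖p - q‖) r)
    (h : ∀ p ∈ D, f p - f q = (p.1 - q.1) • a + (p.2 - q.2) • b + r p) :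
    ScaleDeriv N D f q a b := fun ε hε => by
  refine (hr ε hε).congr' ?_ EventuallyEq.rfl
  filter_upwards [self_mem_nhdsWithin] with p hp
  rw [h p hp]; congr 1; abel

end Scale

/-! ### The abstract quadratic equation with parameters, and smoothness of its solution. -/

/-- The fixed-point problem `w = ρ G + T(w, w) / 2` with parameters `(ρ, lam)`, in which changing
`lam` costs the operator `Q`, which loses in the scale of seminorms `N`. The solution is `sol`, and
`res` is the resolvent of the linearised problem. -/
structure ScaleProblem (V : Type*) [AddCommGroup V] [Module ℝ V] where
  N : ℝ → Seminorm ℝ V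
  D : Set (ℝ × ℝ)
  G : ℝ → V
  T : ℝ → V →ₗ[ℝ] V →ₗ[ℝ] V
  Q : ℝ → V →ₗ[ℝ] V
  res : ℝ × ℝ → V →ₗ[ℝ] V
  sol : ℝ × ℝ → V
  T_bdd : ∀ q ∈ D, ScaleBdd₂ N (𝓝[D] q) (fun p a b => T p.2 a b)
  Q_bdd : ∀ q ∈ D, ScaleBdd N (𝓝[D] q) (fun p h => Q p.2 h)
  res_bdd : ∀ p ∈ D, ∀ ε ∈ Ico (0 : ℝ) 1, ∀ h, N ε (res p h) ≤ 2 * N ε h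
  sol_bdd : ∀ q ∈ D, ScaleBig N (𝓝[D] q) (fun _ => 1) sol
  T_sol : ∀ q ∈ D, ∀ᶠ p in 𝓝[D] q, ∀ ε ∈ Ico (0 : ℝ) 1, ∀ h,
    N ε (T q.2 (sol p) h) ≤ 1 / 2 * N ε h
  T_symm : ∀ p ∈ D, ∀ a b, T p.2 a b = T p.2 b a
  G_sub : ∀ p ∈ D, ∀ q ∈ D, G p.2 = G q.2 - (p.2 - q.2) • Q q.2 (G p.2)
  T_sub : ∀ p ∈ D, ∀ q ∈ D, ∀ a b,
    T p.2 a b = T q.2 a b - (p.2 - q.2) • Q q.2 (T p.2 a b)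
  Q_sub : ∀ p ∈ D, ∀ q ∈ D, ∀ h, Q p.2 h = Q q.2 h - (p.2 - q.2) • Q q.2 (Q p.2 h)
  res_eq : ∀ p ∈ D, ∀ g, res p g = g + T p.2 (sol p) (res p g)
  res_unique : ∀ p ∈ D, ∀ g h, h = g + T p.2 (sol p) h → h = res p g
  sol_eq : ∀ p ∈ D, sol p = p.1 • G p.2 + (1 / 2 : ℝ) • T p.2 (sol p) (sol p)

namespace ScaleProblem

variable {V : Type*} [AddCommGroup V] [Module ℝ V] (S : ScaleProblem V)

/-- The families generated by the data of the problem. -/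
inductive Gen : (ℝ × ℝ → V) → Prop
  | G : Gen (fun p => S.G p.2)
  | sol : Gen S.sol
  | Q {f : ℝ × ℝ → V} : Gen f → Gen (fun p => S.Q p.2 (f p))
  | T {f g : ℝ × ℝ → V} : Gen f → Gen g → Gen (fun p => S.T p.2 (f p) (g p))
  | res {f : ℝ × ℝ → V} : Gen f → Gen (fun p => S.res p (f p))
  | sub {f g : ℝ × ℝ → V} : Gen f → Gen g → Gen (fun p => f p - g p)

variable {S}

theorem Gen.zero : Gen S (fun _ => 0) := by
  simpa using (Gen.sol (S := S)).sub Gen.sol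

theorem Gen.neg {f : ℝ × ℝ → V} (hf : Gen S f) : Gen S (fun p => -f p) := by
  simpa using Gen.zero.sub hf

theorem Gen.add {f g : ℝ × ℝ → V} (hf : Gen S f) (hg : Gen S g) : Gen S (fun p => f p + g p) := by
  simpa using hf.sub hg.neg

variable (S)

/-- The base point belongs to `D`, so a bound valid eventually within `D` holds at `q` itself.
Remainders are arranged so that mostly operators frozen at `q` act on them. -/
theorem Q_bdd_const {q : ℝ × ℝ} (hq : q ∈ S.D) :
    ScaleBdd S.N (𝓝[S.D] q) (fun _ h => S.Q q.2 h) := fun ε hε => by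
  obtain ⟨ε', hε', C, hC⟩ := S.Q_bdd q hq ε hε
  exact ⟨ε', hε', C, Eventually.of_forall fun _ => hC.self_of_nhdsWithin hq⟩

theorem T_bdd_const {q : ℝ × ℝ} (hq : q ∈ S.D) :
    ScaleBdd₂ S.N (𝓝[S.D] q) (fun _ a b => S.T q.2 a b) := fun ε hε => by
  obtain ⟨C, hC⟩ := S.T_bdd q hq ε hε
  exact ⟨C, Eventually.of_forall fun _ => hC.self_of_nhdsWithin hq⟩

theorem res_bdd_const {q : ℝ × ℝ} (hq : q ∈ S.D) :
    ScaleBdd S.N (𝓝[S.D] q) (fun _ h => S.res q h) := fun ε hε =>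
  ⟨ε, hε, 2, Eventually.of_forall fun _ => S.res_bdd q hq ε hε⟩

theorem res_bdd_moving {q : ℝ × ℝ} :
    ScaleBdd S.N (𝓝[S.D] q) (fun p h => S.res p h) := fun ε hε =>
  ⟨ε, hε, 2, by filter_upwards [self_mem_nhdsWithin] with p hp using S.res_bdd p hp ε hε⟩

section Deriv

variable {q : ℝ × ℝ} (hq : q ∈ S.D) {f g : ℝ × ℝ → V} {fa fb ga gb : V}
include hq

/-- The pattern of all derivative lemmas below: the resolvent-type identity yields a Lipschitz
bound, and inserting that bound into the identity once more leaves a remainder of second order. -/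
theorem scaleDeriv_G : ScaleDeriv S.N S.D (fun p => S.G p.2) q 0 (-S.Q q.2 (S.G q.2)) := by
  -- `G_sub` is used with `p` and `q` exchanged: the vector `G q.2` is then fixed, and only the
  -- moving operator `Q p.2` needs a local bound.
  have h1 : ScaleBig S.N (𝓝[S.D] q) (fun p => ‖p - q‖) (fun p => S.G p.2 - S.G q.2) := by
    refine ((ScaleBig.const (N := S.N) (S.G q.2)).bdd (S.Q_bdd q hq)).snd_smul.neg.congr_mem
      fun p hp => ?_
    conv_lhs => rw [S.G_sub q hq p hp]
    module
  refine ScaleDeriv.of_small (h1.bdd (S.Q_bdd_const hq)).snd_smul_small.neg fun p hp => ?_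
  nth_rw 1 [S.G_sub p hp q hq]
  simp only [map_sub]; module

/-- The identity `Q_p = Q_q - (p₂ - q₂) Q_q Q_p` makes `-Q²` the derivative of `Q` in the asymmetry;
the rest is the chain rule. Compositions of `Q` cost nothing in the end, because the loss always
stays inside `[0, 1)`. -/
theorem scaleDeriv_Q (hf : ScaleDeriv S.N S.D f q fa fb) :
    ScaleDeriv S.N S.D (fun p => S.Q p.2 (f p)) q (S.Q q.2 fa)
      (S.Q q.2 fb - S.Q q.2 (S.Q q.2 (f q))) := by
  have hfb := hf.big
  have key : ∀ p ∈ S.D, S.Q p.2 (f p) - S.Q q.2 (f q) = S.Q q.2 (f p - f q)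
      - (p.2 - q.2) • S.Q q.2 (S.Q p.2 (f p)) := fun p hp => by
    nth_rw 1 [S.Q_sub p hp q hq (f p)]
    simp only [map_sub]; module
  have h1 : ScaleBig S.N (𝓝[S.D] q) (fun p => ‖p - q‖)
      (fun p => S.Q p.2 (f p) - S.Q q.2 (f q)) :=
    ((hfb.bdd (S.Q_bdd_const hq)).sub (((ScaleBig.of_sub hfb).bdd (S.Q_bdd q hq)).bdd
      (S.Q_bdd_const hq)).snd_smul).congr_mem key
  refine ScaleDeriv.of_small ((ScaleSmall.bdd (S.Q_bdd_const hq) hf).sub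
    (h1.bdd (S.Q_bdd_const hq)).snd_smul_small) fun p hp => ?_
  refine (key p hp).trans ?_
  simp only [map_sub, map_smul]; module

/-- The product rule, with the additional term `-Q T` from the dependence of `T` itself on the
asymmetry. The product of the two increments is quadratic in `‖p - q‖` and goes into the remainder.
-/
theorem scaleDeriv_T (hf : ScaleDeriv S.N S.D f q fa fb) (hg : ScaleDeriv S.N S.D g q ga gb) :
    ScaleDeriv S.N S.D (fun p => S.T p.2 (f p) (g p)) q (S.T q.2 fa (g q) + S.T q.2 (f q) ga)
      (S.T q.2 fb (g q) + S.T q.2 (f q) gb - S.Q q.2 (S.T q.2 (f q) (g q))) := by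
  have hf1 := ScaleBig.of_sub hf.big
  have hg1 := ScaleBig.of_sub hg.big
  have key : ∀ p ∈ S.D, S.T p.2 (f p) (g p) - S.T q.2 (f q) (g q) =
      S.T q.2 (f p - f q) (g p) + S.T q.2 (f q) (g p - g q)
        - (p.2 - q.2) • S.Q q.2 (S.T p.2 (f p) (g p)) := fun p hp => by
    nth_rw 1 [S.T_sub p hp q hq (f p) (g p)]
    simp only [map_sub, LinearMap.sub_apply]; abel
  have h1 : ScaleBig S.N (𝓝[S.D] q) (fun p => ‖p - q‖)
      (fun p => S.T p.2 (f p) (g p) - S.T q.2 (f q) (g q)) :=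
    (((hf.big.bdd₂_left (S.T_bdd_const hq) hg1).add
      ((ScaleBig.const (f q)).bdd₂_right (S.T_bdd_const hq) hg.big)).sub
      ((hf1.bdd₂_left (S.T_bdd q hq) hg1).bdd (S.Q_bdd_const hq)).snd_smul).congr_mem key
  -- The small argument must stand on the right, so `g q` is put on the left and the symmetry of `T`
  -- restores the order below.
  have hfg := ScaleSmall.bdd₂_right (S.T_bdd_const hq) (ScaleBig.const (g q)) hf
  have hfg' := ScaleSmall.bdd₂_right (S.T_bdd_const hq) (ScaleBig.const (f q)) hg
  refine ScaleDeriv.of_small (((hfg.add hfg').add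
    ((hf.big.bdd₂ (S.T_bdd_const hq) hg.big).small norm_sub_sq_isLittleO)).sub
    (h1.bdd (S.Q_bdd_const hq)).snd_smul_small) fun p hp => ?_
  refine (key p hp).trans ?_
  simp only [S.T_symm q hq (g q)]
  simp only [map_sub, map_smul, LinearMap.sub_apply, LinearMap.smul_apply]
  module

/-- Moves the fixed-point equation from the asymmetry `p.2` to `q.2`. The corrections of `G` and of
`T` add up, by the equation itself, to one single `Q` applied to `sol p`. -/
theorem sol_eq_of_mem {p : ℝ × ℝ} (hp : p ∈ S.D) :
    S.sol p = p.1 • S.G q.2 + (1 / 2 : ℝ) • S.T q.2 (S.sol p) (S.sol p)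
      - (p.2 - q.2) • S.Q q.2 (S.sol p) := by
  have e := S.sol_eq p hp
  have h1 := S.G_sub p hp q hq
  have h2 := S.T_sub p hp q hq (S.sol p) (S.sol p)
  have h3 : S.Q q.2 (S.sol p) = p.1 • S.Q q.2 (S.G p.2)
      + (1 / 2 : ℝ) • S.Q q.2 (S.T p.2 (S.sol p) (S.sol p)) := by
    conv_lhs => rw [e]
    simp only [map_add, map_smul]
  rw [h3]
  conv_lhs => rw [e, h1, h2]
  module

/-- In the difference of the two equations, both written at `q.2`, the quadratic part is half of `T
(sol p) + T (sol q)` applied to the increment. By `T_sol` this is at most half of the increment in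
every seminorm and is absorbed, which produces the factor `2`. -/
theorem sol_lipschitz :
    ScaleBig S.N (𝓝[S.D] q) (fun p => ‖p - q‖) (fun p => S.sol p - S.sol q) := by
  have hB := ((ScaleBig.const (N := S.N) (S.G q.2)).fst_smul (D := S.D) (q := q)).sub
    ((S.sol_bdd q hq).bdd (S.Q_bdd_const hq)).snd_smul
  intro ε hε
  refine IsBigO.trans (IsBigO.of_bound 2 ?_) (hB ε hε)
  have hTq := (S.T_sol q hq).self_of_nhdsWithin hq
  filter_upwards [S.T_sol q hq, self_mem_nhdsWithin] with p hTp hp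
  rw [Real.norm_of_nonneg (apply_nonneg _ _), Real.norm_of_nonneg (apply_nonneg _ _)]
  have e : S.sol p - S.sol q = ((p.1 - q.1) • S.G q.2 - (p.2 - q.2) • S.Q q.2 (S.sol p))
      + ((1 / 2 : ℝ) • S.T q.2 (S.sol p) (S.sol p - S.sol q)
        + (1 / 2 : ℝ) • S.T q.2 (S.sol q) (S.sol p - S.sol q)) := by
    conv_lhs => rw [S.sol_eq_of_mem hq hp, S.sol_eq q hq]
    simp only [map_sub, S.T_symm q hq (S.sol q) (S.sol p)]
    module
  have h1 := hTp ε hε (S.sol p - S.sol q)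
  have h2 := hTq ε hε (S.sol p - S.sol q)
  have h3 := (congrArg (S.N ε) e).le.trans
    ((map_add_le_add _ _ _).trans (add_le_add le_rfl (map_add_le_add _ _ _)))
  simp only [map_smul_eq_mul] at h3
  norm_num at h3 h1 h2
  linarith

/-- The increment solves the problem linearised at `sol q` exactly, with half of `T (increment,
increment)` in the source. Inverting with `res q` and using `sol_lipschitz` identifies the linear
part. -/
theorem scaleDeriv_sol : ScaleDeriv S.N S.D S.sol q (S.res q (S.G q.2))
    (-S.res q (S.Q q.2 (S.sol q))) := by
  have hL := S.sol_lipschitz hq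
  have key : ∀ p ∈ S.D, S.sol p - S.sol q = S.res q ((p.1 - q.1) • S.G q.2
      - (p.2 - q.2) • S.Q q.2 (S.sol p)
      + (1 / 2 : ℝ) • S.T q.2 (S.sol p - S.sol q) (S.sol p - S.sol q)) := fun p hp => by
    refine S.res_unique q hq _ _ ?_
    conv_lhs => rw [S.sol_eq_of_mem hq hp, S.sol_eq q hq]
    simp only [map_sub, LinearMap.sub_apply, S.T_symm q hq (S.sol q) (S.sol p)]
    module
  refine ScaleDeriv.of_small (((hL.bdd (S.Q_bdd_const hq)).snd_smul_small.neg.bdd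
    (S.res_bdd_const hq)).add (((hL.bdd₂ (S.T_bdd_const hq) hL).small
      norm_sub_sq_isLittleO).bdd (S.res_bdd_const hq) |>.smul_const (1 / 2 : ℝ))) fun p hp => ?_
  refine (key p hp).trans ?_
  simp only [map_sub, map_smul, map_add, map_neg]
  module

/-- With `h = res p (g p)`, the term `T p.2 (sol p) h` equals `h - g p`, so freezing `T` at `q.2`
costs `Q (h - g p)`. The increment of `h` is then `res q` of known increments: those of `g`, of the
solution, and of the asymmetry. -/
theorem scaleDeriv_res (hg : ScaleDeriv S.N S.D g q ga gb) :
    ScaleDeriv S.N S.D (fun p => S.res p (g p)) q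
      (S.res q (ga + S.T q.2 (S.res q (S.G q.2)) (S.res q (g q))))
      (S.res q (gb + S.T q.2 (-S.res q (S.Q q.2 (S.sol q))) (S.res q (g q))
        - S.Q q.2 (S.res q (g q) - g q))) := by
  have hw := S.scaleDeriv_sol hq
  set wa := S.res q (S.G q.2)
  set wb := -S.res q (S.Q q.2 (S.sol q))
  have hg1 := ScaleBig.of_sub hg.big
  have hh1 : ScaleBig S.N (𝓝[S.D] q) (fun _ => 1) (fun p => S.res p (g p)) :=
    hg1.bdd S.res_bdd_moving
  have key : ∀ p ∈ S.D, S.res p (g p) - S.res q (g q) = S.res q ((g p - g q)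
      + S.T q.2 (S.sol p - S.sol q) (S.res p (g p))
      - (p.2 - q.2) • S.Q q.2 (S.res p (g p) - g p)) := fun p hp => by
    refine S.res_unique q hq _ _ ?_
    have e := S.res_eq p hp (g p)
    have e2 : S.res p (g p) - g p = S.T p.2 (S.sol p) (S.res p (g p)) := by
      conv_lhs => rw [e]
      abel
    have e3 := S.res_eq q hq (g q)
    rw [e2]
    conv_lhs => rw [e, e3, S.T_sub p hp q hq]
    simp only [map_sub, LinearMap.sub_apply]
    module
  have h1 : ScaleBig S.N (𝓝[S.D] q) (fun p => ‖p - q‖)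
      (fun p => S.res p (g p) - S.res q (g q)) :=
    (((hg.big.add (hw.big.bdd₂_left (S.T_bdd_const hq) hh1)).sub
      ((hh1.sub hg1).bdd (S.Q_bdd_const hq)).snd_smul).bdd (S.res_bdd_const hq)).congr_mem key
  have hs := ScaleSmall.bdd₂_right (S.T_bdd_const hq) (ScaleBig.const (S.res q (g q))) hw
  refine ScaleDeriv.of_small (((((show ScaleSmall _ _ _ _ from hg).add hs).add
    ((hw.big.bdd₂ (S.T_bdd_const hq) h1).small norm_sub_sq_isLittleO)).sub
    ((h1.sub hg.big).bdd (S.Q_bdd_const hq)).snd_smul_small).bdd (S.res_bdd_const hq))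
      fun p hp => ?_
  refine (key p hp).trans ?_
  simp only [S.T_symm q hq (S.res q (g q))]
  simp only [map_sub, map_smul, map_add, LinearMap.sub_apply, LinearMap.smul_apply]
  module

end Deriv

theorem _root_.BurgersVortex.ScaleDeriv.sub {N : ℝ → Seminorm ℝ V} {D : Set (ℝ × ℝ)} {q : ℝ × ℝ}
    {f g : ℝ × ℝ → V} {fa fb ga gb : V} (hf : ScaleDeriv N D f q fa fb)
    (hg : ScaleDeriv N D g q ga gb) :
    ScaleDeriv N D (fun p => f p - g p) q (fa - ga) (fb - gb) := by
  refine ScaleDeriv.of_small (ScaleSmall.sub hf hg) fun p _ => ?_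
  module

variable {S} in
-- The derivative of each constructor is again an expression in the constructors. This closure
-- replaces any implicit function theorem, which is not available because of the loss in `Q`.
theorem Gen.exists_deriv {f : ℝ × ℝ → V} (hf : Gen S f) :
    ∃ fa fb, Gen S fa ∧ Gen S fb ∧ ∀ q ∈ S.D, ScaleDeriv S.N S.D f q (fa q) (fb q) := by
  induction hf with
  | G => exact ⟨_, _, Gen.zero, (Gen.Q Gen.G).neg, fun q hq => S.scaleDeriv_G hq⟩
  | sol => exact ⟨_, _, Gen.res Gen.G, (Gen.res (Gen.Q Gen.sol)).neg,
      fun q hq => S.scaleDeriv_sol hq⟩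
  | Q hf ih =>
    obtain ⟨fa, fb, ha, hb, h⟩ := ih
    exact ⟨_, _, Gen.Q ha, (Gen.Q hb).sub (Gen.Q (Gen.Q hf)), fun q hq => S.scaleDeriv_Q hq (h q hq)⟩
  | T hf hg ihf ihg =>
    obtain ⟨fa, fb, ha, hb, h⟩ := ihf
    obtain ⟨ga, gb, hga, hgb, h'⟩ := ihg
    exact ⟨_, _, (Gen.T ha hg).add (Gen.T hf hga),
      ((Gen.T hb hg).add (Gen.T hf hgb)).sub (Gen.Q (Gen.T hf hg)),
      fun q hq => S.scaleDeriv_T hq (h q hq) (h' q hq)⟩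
  | res hg ih =>
    obtain ⟨ga, gb, hga, hgb, h⟩ := ih
    exact ⟨_, _, Gen.res (hga.add (Gen.T (Gen.res Gen.G) (Gen.res hg))),
      Gen.res ((hgb.add (Gen.T (Gen.res (Gen.Q Gen.sol)).neg (Gen.res hg))).sub
        (Gen.Q ((Gen.res hg).sub hg))), fun q hq => S.scaleDeriv_res hq (h q hq)⟩
  | sub _ _ ihf ihg =>
    obtain ⟨fa, fb, ha, hb, h⟩ := ihf
    obtain ⟨ga, gb, hga, hgb, h'⟩ := ihg
    exact ⟨_, _, ha.sub hga, hb.sub hgb, fun q hq => ScaleDeriv.sub (h q hq) (h' q hq)⟩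

variable {S} in
-- Only the weakest seminorm `N 0` is visible in `X`; the induction on the order uses the whole
-- scale through `Gen.exists_deriv`.
theorem Gen.contDiffOn {X : Type*} [NormedAddCommGroup X] [NormedSpace ℝ X] (ι : V →ₗ[ℝ] X)
    (hι : ∀ h, ‖ι h‖ ≤ S.N 0 h) (n : ℕ) {f : ℝ × ℝ → V} (hf : Gen S f) :
    ContDiffOn ℝ n (fun p => ι (f p)) S.D := by
  have deriv : ∀ {f fa fb : ℝ × ℝ → V},
      (∀ q ∈ S.D, ScaleDeriv S.N S.D f q (fa q) (fb q)) → ∀ q ∈ S.D,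
      HasFDerivWithinAt (fun p => ι (f p))
        ((ContinuousLinearMap.fst ℝ ℝ ℝ).smulRight (ι (fa q))
          + (ContinuousLinearMap.snd ℝ ℝ ℝ).smulRight (ι (fb q))) S.D q := by
    intro f fa fb h q hq
    rw [hasFDerivWithinAt_iff_isLittleO]
    have := (h q hq) 0 (by simp)
    refine (IsBigO.of_norm_le fun p => ?_).trans_isLittleO (isLittleO_norm_right.1 this)
    refine le_trans (le_of_eq ?_) (hι _)
    simp only [map_sub, map_smul, _root_.add_apply, ContinuousLinearMap.smulRight_apply,
      ContinuousLinearMap.coe_fst', ContinuousLinearMap.coe_snd']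
    congr 1; module
  induction n generalizing f with
  | zero =>
    obtain ⟨fa, fb, -, -, h⟩ := hf.exists_deriv
    exact contDiffOn_zero.2 fun q hq => (deriv h q hq).continuousWithinAt
  | succ n ih =>
    obtain ⟨fa, fb, ha, hb, h⟩ := hf.exists_deriv
    rw [show ((n + 1 : ℕ) : WithTop ℕ∞) = (n : WithTop ℕ∞) + 1 by norm_cast,
      contDiffOn_succ_iff_hasFDerivWithinAt (by simp)]
    intro q hq
    -- The derivative is exhibited on all of `D`, boundary points included, so unique
    -- differentiability of `D` plays no role.
    refine ⟨S.D, by rw [insert_eq_of_mem hq]; exact self_mem_nhdsWithin, by simp, _,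
      fun p hp => deriv h p hp, ?_⟩
    exact ((ContinuousLinearMap.smulRightL ℝ (ℝ × ℝ) X
      (ContinuousLinearMap.fst ℝ ℝ ℝ)).contDiff.comp_contDiffOn (ih ha)).add
      ((ContinuousLinearMap.smulRightL ℝ (ℝ × ℝ) X
        (ContinuousLinearMap.snd ℝ ℝ ℝ)).contDiff.comp_contDiffOn (ih hb))

/-- The solution is a smooth function of the parameters. -/
theorem contDiffOn_sol {X : Type*} [NormedAddCommGroup X] [NormedSpace ℝ X] (ι : V →ₗ[ℝ] X)
    (hι : ∀ h, ‖ι h‖ ≤ S.N 0 h) : ContDiffOn ℝ ∞ (fun p => ι (S.sol p)) S.D :=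
  contDiffOn_infty.2 fun n => Gen.sol.contDiffOn ι hι n

end ScaleProblem

end BurgersVortex

end


/-! ### Hölder, Young and Minkowski inequalities, with exponents written as `p = 1 / θ`. -/

noncomputable section

namespace BurgersVortex

open ENNReal

/-! ### Norms of nonnegative functions -/

section LNorm

variable {α β : Type*} [MeasurableSpace α] [MeasurableSpace β] {μ : Measure α} {ν : Measure β}

/-- The `L^p` norm of a nonnegative function, with `p = 1 / θ`. -/
def lnorm (θ : ℝ) (μ : Measure α) (f : α → ℝ≥0∞) : ℝ≥0∞ := (∫⁻ x, f x ^ (1 / θ) ∂μ) ^ θ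

theorem lnorm_mono {θ : ℝ} (hθ : 0 < θ) {f g : α → ℝ≥0∞} (h : ∀ᵐ x ∂μ, f x ≤ g x) :
    lnorm θ μ f ≤ lnorm θ μ g := by
  unfold lnorm
  refine rpow_le_rpow (lintegral_mono_ae ?_) hθ.le
  filter_upwards [h] with x hx using rpow_le_rpow hx (by positivity)

theorem lnorm_congr {θ : ℝ} {f g : α → ℝ≥0∞} (h : f =ᵐ[μ] g) :
    lnorm θ μ f = lnorm θ μ g := by
  unfold lnorm
  congr 1
  refine lintegral_congr_ae ?_
  filter_upwards [h] with x hx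
  rw [hx]

theorem lnorm_const_mul {θ : ℝ} (hθ : 0 < θ) (c : ℝ≥0∞) (hc : c ≠ ⊤) (f : α → ℝ≥0∞) :
    lnorm θ μ (fun x => c * f x) = c * lnorm θ μ f := by
  have h0 : (0 : ℝ) ≤ 1 / θ := by positivity
  simp only [lnorm, mul_rpow_of_nonneg _ _ h0]
  rw [lintegral_const_mul' _ _ (rpow_ne_top_of_nonneg h0 hc), mul_rpow_of_nonneg _ _ hθ.le,
    ← rpow_mul, one_div_mul_cancel hθ.ne', rpow_one]

theorem lnorm_add_le {θ : ℝ} (hθ : 0 < θ) (hθ1 : θ ≤ 1) {f g : α → ℝ≥0∞} (hf : AEMeasurable f μ)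
    (hg : AEMeasurable g μ) : lnorm θ μ (fun x => f x + g x) ≤ lnorm θ μ f + lnorm θ μ g := by
  have := lintegral_Lp_add_le (p := 1 / θ) hf hg (by rw [le_div_iff₀ hθ]; linarith)
  simpa [lnorm] using this

theorem lnorm_one (f : α → ℝ≥0∞) : lnorm 1 μ f = ∫⁻ x, f x ∂μ := by simp [lnorm]

/-- Hölder's inequality. -/
theorem lnorm_mul_le {θ θ' : ℝ} (hθ : 0 < θ) (hθ' : 0 < θ') {f g : α → ℝ≥0∞}
    (hf : AEMeasurable f μ) (hg : AEMeasurable g μ) :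
    lnorm (θ + θ') μ (fun x => f x * g x) ≤ lnorm θ μ f * lnorm θ' μ g := by
  have hs : 0 < θ + θ' := by positivity
  have := lintegral_mul_norm_pow_le (hf.pow_const (1 / θ)) (hg.pow_const (1 / θ'))
    (p := θ / (θ + θ')) (q := θ' / (θ + θ')) (by positivity) (by positivity) (by field_simp)
  unfold lnorm
  refine (rpow_le_rpow (le_trans (le_of_eq (lintegral_congr fun x => ?_)) this) hs.le).trans ?_
  · rw [mul_rpow_of_nonneg _ _ (by positivity), ← rpow_mul, ← rpow_mul]
    congr 2 <;> field_simp
  · rw [mul_rpow_of_nonneg _ _ hs.le, ← rpow_mul, ← rpow_mul, div_mul_cancel₀ _ hs.ne',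
      div_mul_cancel₀ _ hs.ne']

/-- Young's inequality for an integral operator. -/
theorem lnorm_kernel_le [SFinite μ] [SFinite ν] {θa θr θs : ℝ} (hs : 0 < θs) (has : θs ≤ θa)
    (hrs : θs ≤ θr) (h : θa + θr = 1 + θs) {k : α → β → ℝ≥0∞}
    (hk : Measurable (Function.uncurry k)) {g : β → ℝ≥0∞} (hg : AEMeasurable g ν) {A B : ℝ≥0∞}
    (hA : ∀ z, ∫⁻ x, k x z ^ (1 / θa) ∂μ ≤ A) (hB : ∀ x, ∫⁻ z, k x z ^ (1 / θa) ∂ν ≤ B) :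
    lnorm θs μ (fun x => ∫⁻ z, k x z * g z ∂ν) ≤ A ^ θs * B ^ (θa - θs) * lnorm θr ν g := by
  have ha : 0 < θa := hs.trans_le has
  have hr : 0 < θr := hs.trans_le hrs
  have hkx : ∀ x, Measurable (k x) := fun x => hk.comp measurable_prodMk_left
  have hka : Measurable (Function.uncurry fun x z => k x z ^ (1 / θa)) := hk.pow_const _
  have hgr : AEMeasurable (fun z => g z ^ (1 / θr)) ν := hg.pow_const _
  set I : ℝ≥0∞ := ∫⁻ z, g z ^ (1 / θr) ∂ν with hI
  have point : ∀ x, ∫⁻ z, k x z * g z ∂ν ≤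
      (∫⁻ z, k x z ^ (1 / θa) * g z ^ (1 / θr) ∂ν) ^ θs * (B ^ (θa - θs) * I ^ (θr - θs)) := by
    intro x
    have hkxa : AEMeasurable (fun z => k x z ^ (1 / θa)) ν := ((hkx x).pow_const _).aemeasurable
    -- Hölder with the three factors `k^(1/θa) g^(1/θr)`, `k^(1/θa)`, `g^(1/θr)` and the weights
    -- `θs`, `θa - θs`, `θr - θs`, whose sum is `1` by the relation between the exponents.
    have := lintegral_prod_norm_pow_le (μ := ν) (Finset.univ : Finset (Fin 3))
      (f := ![fun z => k x z ^ (1 / θa) * g z ^ (1 / θr), fun z => k x z ^ (1 / θa),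
        fun z => g z ^ (1 / θr)]) (p := ![θs, θa - θs, θr - θs])
      (by
        intro i _
        fin_cases i
        · exact hkxa.mul hgr
        · exact hkxa
        · exact hgr)
      (by simp [Fin.sum_univ_three]; linarith)
      (by intro i _; fin_cases i <;> simp <;> linarith)
    simp only [Fin.prod_univ_three, Matrix.cons_val_zero, Matrix.cons_val_one,
      Matrix.cons_val_two, Matrix.tail_cons, Matrix.head_cons] at this
    calc ∫⁻ z, k x z * g z ∂ν
        = ∫⁻ z, (k x z ^ (1 / θa) * g z ^ (1 / θr)) ^ θs * (k x z ^ (1 / θa)) ^ (θa - θs)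
            * (g z ^ (1 / θr)) ^ (θr - θs) ∂ν := by
          refine lintegral_congr fun z => ?_
          rw [mul_rpow_of_nonneg _ _ hs.le]
          have e1 : (k x z ^ (1 / θa)) ^ θs * (k x z ^ (1 / θa)) ^ (θa - θs) = k x z := by
            rw [← rpow_add_of_nonneg _ _ hs.le (by linarith), ← rpow_mul,
              add_sub_cancel, one_div_mul_cancel ha.ne', rpow_one]
          have e2 : (g z ^ (1 / θr)) ^ θs * (g z ^ (1 / θr)) ^ (θr - θs) = g z := by
            rw [← rpow_add_of_nonneg _ _ hs.le (by linarith), ← rpow_mul,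
              add_sub_cancel, one_div_mul_cancel hr.ne', rpow_one]
          nth_rw 1 [← e1, ← e2]
          ring
      _ ≤ _ := this
      _ ≤ _ := by
        rw [mul_assoc]
        gcongr
        exact hB x
  have hKI : ∫⁻ x, ∫⁻ z, k x z ^ (1 / θa) * g z ^ (1 / θr) ∂ν ∂μ ≤ A * I := by
    rw [lintegral_lintegral_swap]
    · calc ∫⁻ z, ∫⁻ x, k x z ^ (1 / θa) * g z ^ (1 / θr) ∂μ ∂ν
          = ∫⁻ z, (∫⁻ x, k x z ^ (1 / θa) ∂μ) * g z ^ (1 / θr) ∂ν := by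
            refine lintegral_congr fun z => ?_
            exact lintegral_mul_const _ (hka.comp measurable_prodMk_right)
        _ ≤ ∫⁻ z, A * g z ^ (1 / θr) ∂ν := by gcongr; exact hA _
        _ = A * I := lintegral_const_mul'' _ hgr
    · exact hka.aemeasurable.mul (hgr.comp_quasiMeasurePreserving
        Measure.quasiMeasurePreserving_snd)
  have hmeas : AEMeasurable (fun x => ∫⁻ z, k x z ^ (1 / θa) * g z ^ (1 / θr) ∂ν) μ :=
    (hka.aemeasurable.mul (hgr.comp_quasiMeasurePreserving
        Measure.quasiMeasurePreserving_snd)).lintegral_prod_right'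
  calc lnorm θs μ (fun x => ∫⁻ z, k x z * g z ∂ν)
      ≤ (∫⁻ x, (∫⁻ z, k x z ^ (1 / θa) * g z ^ (1 / θr) ∂ν)
          * (B ^ (θa - θs) * I ^ (θr - θs)) ^ (1 / θs) ∂μ) ^ θs := by
        refine rpow_le_rpow (lintegral_mono fun x => ?_) hs.le
        refine (rpow_le_rpow (point x) (by positivity)).trans (le_of_eq ?_)
        rw [mul_rpow_of_nonneg _ _ (by positivity), ← rpow_mul, mul_one_div_cancel hs.ne', rpow_one]
    _ = (∫⁻ x, (∫⁻ z, k x z ^ (1 / θa) * g z ^ (1 / θr) ∂ν) ∂μ) ^ θs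
          * (B ^ (θa - θs) * I ^ (θr - θs)) := by
        rw [lintegral_mul_const'' _ hmeas, mul_rpow_of_nonneg _ _ hs.le,
          ← rpow_mul _ _ θs, one_div_mul_cancel hs.ne', rpow_one]
    _ ≤ (A * I) ^ θs * (B ^ (θa - θs) * I ^ (θr - θs)) := by gcongr
    _ = A ^ θs * B ^ (θa - θs) * (I ^ θs * I ^ (θr - θs)) := by
        rw [mul_rpow_of_nonneg _ _ hs.le]; ring
    _ = _ := by
        rw [← rpow_add_of_nonneg _ _ hs.le (by linarith), add_sub_cancel]
        rfl

/-- Minkowski's integral inequality in `L²`. -/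
theorem lnorm_lintegral_le [SFinite μ] [SFinite ν] {F : β → α → ℝ≥0∞}
    (hF : AEMeasurable (Function.uncurry F) (ν.prod μ)) :
    lnorm (1 / 2) μ (fun x => ∫⁻ t, F t x ∂ν) ≤ ∫⁻ t, lnorm (1 / 2) μ (F t) ∂ν := by
  obtain ⟨G, hG, hFG⟩ := hF
  have hae : ∀ᵐ t ∂ν, F t =ᵐ[μ] fun x => G (t, x) := Measure.ae_ae_of_ae_prod hFG
  have hae' : ∀ᵐ x ∂μ, (fun t => F t x) =ᵐ[ν] fun t => G (t, x) := by
    have : Function.uncurry F ∘ Prod.swap =ᵐ[μ.prod ν] G ∘ Prod.swap :=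
      Measure.measurePreserving_swap.quasiMeasurePreserving.ae_eq_comp hFG
    exact Measure.ae_ae_of_ae_prod this
  rw [lnorm_congr (g := fun x => ∫⁻ t, G (t, x) ∂ν)
    (by filter_upwards [hae'] with x hx using lintegral_congr_ae hx),
    lintegral_congr_ae (g := fun t => lnorm (1 / 2) μ fun x => G (t, x))
    (by filter_upwards [hae] with t ht using lnorm_congr ht)]
  have hGx : ∀ x, Measurable fun t => G (t, x) := fun x => hG.comp measurable_prodMk_right
  have hGt : ∀ t, Measurable fun x => G (t, x) := fun t => hG.comp measurable_prodMk_left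
  set n : β → ℝ≥0∞ := fun t => lnorm (1 / 2) μ fun x => G (t, x) with hn
  have hnm : Measurable n := by
    have : Measurable fun p : β × α => G p ^ (1 / (1 / 2 : ℝ)) := hG.pow_const _
    exact this.lintegral_prod_right'.pow_const _
  -- The square of the inner integral is a double integral over `t` and `s`; after Tonelli,
  -- Cauchy-Schwarz in `x` bounds the integrand by `n t * n s`.
  have key : ∫⁻ x, (∫⁻ t, G (t, x) ∂ν) ^ (1 / (1 / 2 : ℝ)) ∂μ ≤ (∫⁻ t, n t ∂ν) ^ (2 : ℝ) := by
    have e2 : (1 / (1 / 2 : ℝ)) = 2 := by norm_num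
    calc ∫⁻ x, (∫⁻ t, G (t, x) ∂ν) ^ (1 / (1 / 2 : ℝ)) ∂μ
        = ∫⁻ x, ∫⁻ t, ∫⁻ s, G (t, x) * G (s, x) ∂ν ∂ν ∂μ := by
          refine lintegral_congr fun x => ?_
          rw [e2, rpow_two, sq, ← lintegral_mul_const _ (hGx x)]
          exact lintegral_congr fun t => (lintegral_const_mul _ (hGx x)).symm
      _ = ∫⁻ t, ∫⁻ s, ∫⁻ x, G (t, x) * G (s, x) ∂μ ∂ν ∂ν := by
          have h3 : Measurable fun p : α × β × β => G (p.2.1, p.1) * G (p.2.2, p.1) :=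
            (hG.comp (measurable_snd.fst.prodMk measurable_fst)).mul
              (hG.comp (measurable_snd.snd.prodMk measurable_fst))
          rw [lintegral_lintegral_swap]
          · refine lintegral_congr fun t => ?_
            rw [lintegral_lintegral_swap]
            exact (h3.comp (measurable_fst.prodMk
              (measurable_const.prodMk measurable_snd))).aemeasurable
          · have : Measurable fun p : (α × β) × β => G (p.1.2, p.1.1) * G (p.2, p.1.1) :=
              h3.comp (measurable_fst.fst.prodMk (measurable_fst.snd.prodMk measurable_snd))
            exact this.lintegral_prod_right'.aemeasurable
      _ ≤ ∫⁻ t, ∫⁻ s, n t * n s ∂ν ∂ν := by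
          gcongr with t s
          have := lnorm_mul_le (θ := 1 / 2) (θ' := 1 / 2) (μ := μ) (by norm_num) (by norm_num)
            (hGt t).aemeasurable (hGt s).aemeasurable
          rwa [add_halves, lnorm_one] at this
      _ = (∫⁻ t, n t ∂ν) ^ (2 : ℝ) := by
          rw [rpow_two, sq, ← lintegral_mul_const _ hnm]
          exact lintegral_congr fun t => lintegral_const_mul _ hnm
  calc lnorm (1 / 2) μ (fun x => ∫⁻ t, G (t, x) ∂ν) ≤ ((∫⁻ t, n t ∂ν) ^ (2 : ℝ)) ^ (1 / 2 : ℝ) :=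
        rpow_le_rpow key (by norm_num)
    _ = _ := by rw [← rpow_mul]; norm_num

end LNorm

end BurgersVortex

end


/-! ### The plane, the exponential weights, and pointwise Gaussian bounds for the kernel. -/

noncomputable section

namespace BurgersVortex

open ENNReal

/-! ### Integrals over the plane -/

/-- The coordinates of a point of the plane. -/
def planeEquiv : Plane ≃ᵐ ℝ × ℝ :=
  (MeasurableEquiv.toLp 2 (Fin 2 → ℝ)).symm.trans MeasurableEquiv.finTwoArrow

theorem measurePreserving_planeEquiv : MeasurePreserving planeEquiv :=
  (volume_preserving_finTwoArrow ℝ).comp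
    (EuclideanSpace.volume_preserving_symm_measurableEquiv_toLp (Fin 2))

theorem lintegral_plane (F : Plane → ℝ≥0∞) :
    ∫⁻ x, F x = ∫⁻ p : ℝ × ℝ, F !₂[p.1, p.2] :=
  (measurePreserving_planeEquiv.symm.lintegral_comp_emb
    planeEquiv.symm.measurableEmbedding F).symm

theorem lintegral_plane_mul {f g : ℝ → ℝ≥0∞} (hf : AEMeasurable f) (hg : AEMeasurable g) :
    ∫⁻ x : Plane, f (x 0) * g (x 1) = (∫⁻ s, f s) * ∫⁻ s, g s := by
  rw [lintegral_plane, ← lintegral_prod_mul hf hg]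
  rfl

theorem integral_plane {E : Type*} [NormedAddCommGroup E] [NormedSpace ℝ E] (F : Plane → E) :
    ∫ x, F x = ∫ p : ℝ × ℝ, F !₂[p.1, p.2] :=
  (measurePreserving_planeEquiv.symm.integral_comp
    planeEquiv.symm.measurableEmbedding F).symm

theorem integrable_plane_iff {E : Type*} [NormedAddCommGroup E] {F : Plane → E} :
    Integrable F ↔ Integrable (fun p : ℝ × ℝ => F !₂[p.1, p.2]) :=
  (measurePreserving_planeEquiv.symm.integrable_comp_emb planeEquiv.symm.measurableEmbedding).symm

theorem integral_plane_mul {𝕜 : Type*} [RCLike 𝕜] (f g : ℝ → 𝕜) :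
    ∫ x : Plane, f (x 0) * g (x 1) = (∫ s, f s) * ∫ s, g s := by
  rw [integral_plane, ← integral_prod_mul]
  rfl

theorem integrable_plane_mul {𝕜 : Type*} [RCLike 𝕜] {f g : ℝ → 𝕜} (hf : Integrable f)
    (hg : Integrable g) : Integrable fun x : Plane => f (x 0) * g (x 1) :=
  integrable_plane_iff.2 (hf.mul_prod hg)

theorem norm_sq_plane (x : Plane) : ‖x‖ ^ 2 = x 0 ^ 2 + x 1 ^ 2 := by
  simp [EuclideanSpace.norm_sq_eq, Fin.sum_univ_two]

theorem abs_le_norm (x : Plane) (j : Fin 2) : |x j| ≤ ‖x‖ := by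
  simpa using PiLp.norm_apply_le x j

theorem lintegral_gaussian_line {b d : ℝ} (hb : 0 < b) (hd : 0 < d) (c : ℝ) :
    ∫⁻ z : ℝ, ENNReal.ofReal (Real.exp (-b * (c - d * z) ^ 2)) =
      ENNReal.ofReal (d⁻¹ * √(Real.pi / b)) := by
  have hi : Integrable fun z : ℝ => Real.exp (-b * z ^ 2) := integrable_exp_neg_mul_sq hb
  have hi2 : Integrable fun z : ℝ => Real.exp (-b * (c - d * z) ^ 2) :=
    (hi.comp_sub_left c).comp_mul_left' hd.ne'
  rw [← ofReal_integral_eq_lintegral_ofReal hi2 (Filter.Eventually.of_forall fun _ => by positivity)]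
  congr 1
  rw [Measure.integral_comp_mul_left (fun z => Real.exp (-b * (c - z) ^ 2)),
    integral_sub_left_eq_self (fun z => Real.exp (-b * z ^ 2)), integral_gaussian, smul_eq_mul,
    abs_of_pos (inv_pos.2 hd)]

theorem lintegral_gaussian_plane {b d e : ℝ} (hb : 0 < b) (hd : 0 < d) (he : 0 < e) (x : Plane) :
    ∫⁻ z : Plane, ENNReal.ofReal (Real.exp (-b * ((x 0 - d * z 0) ^ 2 + (x 1 - e * z 1) ^ 2))) =
      ENNReal.ofReal ((d * e)⁻¹ * (Real.pi / b)) := by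
  have h1 : ∀ c d : ℝ, Measurable fun z : ℝ => ENNReal.ofReal (Real.exp (-b * (c - d * z) ^ 2)) :=
    fun c d => by fun_prop
  calc _ = ∫⁻ z : Plane, ENNReal.ofReal (Real.exp (-b * (x 0 - d * z 0) ^ 2))
        * ENNReal.ofReal (Real.exp (-b * (x 1 - e * z 1) ^ 2)) := by
        refine lintegral_congr fun z => ?_
        rw [← ofReal_mul (by positivity), ← Real.exp_add]
        ring_nf
    _ = _ := by
        rw [lintegral_plane_mul (f := fun s => ENNReal.ofReal (Real.exp (-b * (x 0 - d * s) ^ 2)))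
          (g := fun s => ENNReal.ofReal (Real.exp (-b * (x 1 - e * s) ^ 2)))
          (h1 _ _).aemeasurable (h1 _ _).aemeasurable, lintegral_gaussian_line hb hd,
          lintegral_gaussian_line hb he, ← ofReal_mul (by positivity)]
        congr 1
        rw [mul_mul_mul_comm, Real.mul_self_sqrt (by positivity), mul_inv]

/-! ### Weights -/

theorem weight_pos (x : Plane) : 0 < weight x := by unfold weight; positivity

theorem one_le_sqrt_one_add_sq (s : ℝ) : 1 ≤ √(1 + s ^ 2) :=
  Real.one_le_sqrt.2 (by nlinarith [sq_nonneg s])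

theorem one_le_weight (x : Plane) : 1 ≤ weight x :=
  one_le_mul_of_one_le_of_one_le (one_le_sqrt_one_add_sq _) (one_le_sqrt_one_add_sq _)

theorem sqrt_one_add_sq_add_le (s t : ℝ) :
    √(1 + (s + t) ^ 2) ≤ √2 * (√(1 + s ^ 2) * √(1 + t ^ 2)) := by
  rw [← Real.sqrt_mul (by positivity), ← Real.sqrt_mul (by positivity)]
  refine Real.sqrt_le_sqrt ?_
  nlinarith [sq_nonneg (s - t), sq_nonneg (s * t)]

/-- Each coordinate contributes `√2`, from `1 + (s + t)² ≤ 2 (1 + s²)(1 + t²)`. This lets a weight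
be shared between a kernel and its argument. -/
theorem weight_add_le (x y : Plane) : weight (x + y) ≤ 2 * (weight x * weight y) := by
  unfold weight
  have h0 := sqrt_one_add_sq_add_le (x 0) (y 0)
  have h1 := sqrt_one_add_sq_add_le (x 1) (y 1)
  calc _ ≤ (√2 * (√(1 + x 0 ^ 2) * √(1 + y 0 ^ 2))) * (√2 * (√(1 + x 1 ^ 2) * √(1 + y 1 ^ 2))) :=
        mul_le_mul h0 h1 (by positivity) (by positivity)
    _ = (√2 * √2) * ((√(1 + x 0 ^ 2) * √(1 + x 1 ^ 2)) * (√(1 + y 0 ^ 2) * √(1 + y 1 ^ 2))) := by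
        ring
    _ = _ := by rw [Real.mul_self_sqrt (by norm_num)]

theorem norm_le_weight (x : Plane) : ‖x‖ ≤ weight x := by
  unfold weight
  rw [← Real.sqrt_mul (by positivity)]
  refine Real.le_sqrt_of_sq_le ?_
  rw [norm_sq_plane]
  nlinarith [mul_nonneg (sq_nonneg (x 0)) (sq_nonneg (x 1))]

theorem weight_le_exp (x : Plane) : weight x ≤ Real.exp (2 * ‖x‖) := by
  have h : ∀ j, √(1 + x j ^ 2) ≤ Real.exp ‖x‖ := fun j => by
    have h1 := abs_le_norm x j
    have h2 := Real.add_one_le_exp ‖x‖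
    refine le_trans (Real.sqrt_le_iff.2 ⟨by positivity, ?_⟩) h2
    have := sq_abs (x j)
    nlinarith [norm_nonneg x, abs_nonneg (x j)]
  calc weight x ≤ Real.exp ‖x‖ * Real.exp ‖x‖ := mul_le_mul (h 0) (h 1) (by positivity)
        (by positivity)
    _ = _ := by rw [← Real.exp_add]; ring_nf

@[fun_prop] theorem continuous_weight : Continuous weight := by unfold weight; fun_prop

/-- The weight `b(x)^m exp (ε |x|)`. -/
def expWeight (m ε : ℝ) (x : Plane) : ℝ := weight x ^ m * Real.exp (ε * ‖x‖)

theorem expWeight_pos (m ε : ℝ) (x : Plane) : 0 < expWeight m ε x :=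
  mul_pos (Real.rpow_pos_of_pos (weight_pos x) _) (Real.exp_pos _)

@[fun_prop] theorem continuous_expWeight (m ε : ℝ) : Continuous (expWeight m ε) := by
  unfold expWeight
  exact (continuous_weight.rpow_const fun x => Or.inl (weight_pos x).ne').mul (by fun_prop)

theorem expWeight_mono (m : ℝ) {ε ε' : ℝ} (h : ε ≤ ε') (x : Plane) :
    expWeight m ε x ≤ expWeight m ε' x := by
  unfold expWeight
  have := Real.rpow_nonneg (weight_pos x).le m
  gcongr

/-- The constant is independent of `ε`; this is the origin of the uniformity in the weight of all
later bounds. -/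
theorem expWeight_add_le {m ε : ℝ} (hm : 0 ≤ m) (hε : 0 ≤ ε) (x y : Plane) :
    expWeight m ε (x + y) ≤ 2 ^ m * (expWeight m ε x * expWeight m ε y) := by
  unfold expWeight
  have h1 := Real.rpow_le_rpow (weight_pos _).le (weight_add_le x y) hm
  rw [Real.mul_rpow (by norm_num) (mul_pos (weight_pos x) (weight_pos y)).le,
    Real.mul_rpow (weight_pos x).le (weight_pos y).le] at h1
  have h2 : Real.exp (ε * ‖x + y‖) ≤ Real.exp (ε * ‖x‖) * Real.exp (ε * ‖y‖) := by
    rw [← Real.exp_add, ← mul_add]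
    gcongr
    exact norm_add_le x y
  calc _ ≤ (2 ^ m * (weight x ^ m * weight y ^ m)) * (Real.exp (ε * ‖x‖) * Real.exp (ε * ‖y‖)) :=
        mul_le_mul h1 h2 (by positivity) ((Real.rpow_nonneg (weight_pos _).le _).trans h1)
    _ = _ := by ring

theorem one_le_expWeight {m ε : ℝ} (hm : 0 ≤ m) (hε : 0 ≤ ε) (x : Plane) : 1 ≤ expWeight m ε x :=
  one_le_mul_of_one_le_of_one_le (Real.one_le_rpow (one_le_weight x) hm)
    (Real.one_le_exp (by positivity))

theorem expWeight_le_of_abs_le {m ε : ℝ} (hm : 0 ≤ m) (hε : 0 ≤ ε) {x y : Plane}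
    (h : ∀ j, |x j| ≤ |y j|) : expWeight m ε x ≤ expWeight m ε y := by
  have hsq : ∀ j, x j ^ 2 ≤ y j ^ 2 := fun j => sq_le_sq.2 (h j)
  have hn : ‖x‖ ≤ ‖y‖ := by
    refine (sq_le_sq₀ (norm_nonneg _) (norm_nonneg _)).1 ?_
    rw [norm_sq_plane, norm_sq_plane]
    exact add_le_add (hsq 0) (hsq 1)
  have hw : weight x ≤ weight y := mul_le_mul (Real.sqrt_le_sqrt (by linarith [hsq 0]))
    (Real.sqrt_le_sqrt (by linarith [hsq 1])) (by positivity) (by positivity)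
  unfold expWeight
  have := weight_pos x
  have := Real.rpow_nonneg (weight_pos y).le m
  gcongr

/-- Since `weight y ≤ exp (2 ‖y‖)`, the exponent is at most `(2m + 1) ‖y‖ - c ‖y‖²`, and the bound
is the maximum of this parabola. -/
theorem expWeight_mul_exp_le {m c : ℝ} (hm : 0 ≤ m) (hc : 0 < c) (y : Plane) :
    expWeight m 1 y * Real.exp (-c * ‖y‖ ^ 2) ≤ Real.exp ((2 * m + 1) ^ 2 / (4 * c)) := by
  unfold expWeight
  have h1 : weight y ^ m ≤ Real.exp (2 * m * ‖y‖) := by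
    calc weight y ^ m ≤ Real.exp (2 * ‖y‖) ^ m :=
          Real.rpow_le_rpow (weight_pos y).le (weight_le_exp y) hm
      _ = _ := by rw [← Real.exp_mul]; ring_nf
  calc _ ≤ Real.exp (2 * m * ‖y‖) * Real.exp (1 * ‖y‖) * Real.exp (-c * ‖y‖ ^ 2) := by gcongr
    _ = Real.exp (2 * m * ‖y‖ + 1 * ‖y‖ + -c * ‖y‖ ^ 2) := by rw [Real.exp_add, Real.exp_add]
    _ ≤ _ := by
        gcongr
        rw [le_div_iff₀ (by positivity)]
        nlinarith [sq_nonneg (2 * c * ‖y‖ - (2 * m + 1))]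

/-! ### The kernel of the Fokker-Planck semigroup -/

/-- The rates `((1 + lam) / 2, (1 - lam) / 2)` of contraction. -/
def rate (lam : ℝ) : Fin 2 → ℝ := ![(1 + lam) / 2, (1 - lam) / 2]

/-- `(1 - exp (-2 a t)) / (2 a)`. -/
def spread (a t : ℝ) : ℝ := (1 - Real.exp (-2 * a * t)) / (2 * a)

/-- The heat kernel at time `s`. -/
def heat (s x : ℝ) : ℝ := (√(4 * Real.pi * s))⁻¹ * Real.exp (-x ^ 2 / (4 * s))

/-- The linear flow `z ↦ exp (-A t) z`. -/
def drift (lam t : ℝ) (z : Plane) : Plane :=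
  WithLp.toLp 2 fun j => Real.exp (-rate lam j * t) * z j

@[simp] theorem drift_apply (lam t : ℝ) (z : Plane) (j : Fin 2) :
    drift lam t z j = Real.exp (-rate lam j * t) * z j := rfl

/-- The partial derivative `∂ⱼ` of the anisotropic heat kernel. -/
def heatDeriv (lam : ℝ) (j : Fin 2) (t : ℝ) (y : Plane) : ℝ :=
  -(y j / (2 * spread (rate lam j) t)) *
    (heat (spread (rate lam 0) t) (y 0) * heat (spread (rate lam 1) t) (y 1))

/-- The kernel of `exp (-αⱼ t) ∂ⱼ exp (t L)`. -/
def mehler (lam : ℝ) (j : Fin 2) (t : ℝ) (x z : Plane) : ℝ :=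
  Real.exp (-rate lam j * t) * heatDeriv lam j t (x - drift lam t z)

/-- The operator `L⁻¹ div`. -/
def invDiv (lam : ℝ) (f : Plane → Fin 2 → ℝ) (x : Plane) : ℝ :=
  -∫ p : ℝ × Plane, ∑ j, mehler lam j p.1 x p.2 * f p.2 j
    ∂((volume.restrict (Ioi (0 : ℝ))).prod volume)

theorem spread_pos {a t : ℝ} (ha : 0 < a) (ht : 0 < t) : 0 < spread a t := by
  unfold spread
  have : Real.exp (-2 * a * t) < 1 := Real.exp_lt_one_iff.2 (by nlinarith [mul_pos ha ht])
  exact div_pos (by linarith) (by positivity)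

/-- Convexity of the exponential between `-2t` and `0`. Together with `spread_le` it compares both
variances with the single scale `spread 1 t`. -/
theorem spread_one_le {a : ℝ} (ha : 0 < a) (ha1 : a ≤ 1) (t : ℝ) :
    spread 1 t ≤ spread a t := by
  unfold spread
  rw [div_le_div_iff₀ (by positivity) (by positivity)]
  have hc := strictConvexOn_exp.convexOn.2 (mem_univ (-2 * 1 * t)) (mem_univ 0) ha.le
    (show (0 : ℝ) ≤ 1 - a by linarith) (by ring)
  simp only [smul_eq_mul, mul_zero, add_zero, Real.exp_zero, mul_one] at hc
  rw [show a * (-2 * t) = -2 * a * t by ring] at hc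
  rw [show (-2 * 1 * t) = -2 * t by ring]
  nlinarith

theorem spread_le {a t : ℝ} (ha : 0 < a) (ha1 : a ≤ 1) (ht : 0 < t) :
    spread a t ≤ spread 1 t / a := by
  unfold spread
  have h : Real.exp (-2 * 1 * t) ≤ Real.exp (-2 * a * t) := Real.exp_le_exp.2 (by nlinarith)
  have e : (1 - Real.exp (-2 * 1 * t)) / (2 * 1) / a = (1 - Real.exp (-2 * 1 * t)) / (2 * a) := by
    field_simp
  rw [e]
  gcongr

theorem spread_one_le_half (t : ℝ) : spread 1 t ≤ 1 / 2 := by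
  unfold spread
  have := Real.exp_pos (-2 * 1 * t)
  rw [div_le_div_iff₀ (by norm_num) (by norm_num)]
  linarith

/-- From `exp (2t) ≥ 1 + 2t`. The lower bound behaves like `t` near zero and controls the negative
powers of `spread` there. -/
theorem le_spread_one {t : ℝ} (ht : 0 < t) : t / (1 + 2 * t) ≤ spread 1 t := by
  unfold spread
  have h1 : Real.exp (-2 * 1 * t) ≤ 1 / (1 + 2 * t) := by
    rw [show -2 * 1 * t = -(2 * t) by ring, Real.exp_neg, ← one_div]
    exact one_div_le_one_div_of_le (by positivity) (by linarith [Real.add_one_le_exp (2 * t)])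
  have h2 : t / (1 + 2 * t) = (1 - 1 / (1 + 2 * t)) / (2 * 1) := by field_simp; ring
  rw [h2]
  gcongr

/-- With `u = y² / (8 s)` the square of the left-hand side is `(2 / s) u exp (-2u)`, and `u ≤ exp
(2u)`. -/
theorem mul_exp_neg_sq_le {s : ℝ} (hs : 0 < s) (y : ℝ) :
    |y| / (2 * s) * Real.exp (-y ^ 2 / (8 * s)) ≤ √2 * (√s)⁻¹ := by
  have h1 : (|y| / (2 * s)) ^ 2 * Real.exp (-y ^ 2 / (8 * s)) ^ 2 ≤ 2 * s⁻¹ := by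
    have h2 := Real.add_one_le_exp (y ^ 2 / (8 * s))
    have h3 : 0 ≤ y ^ 2 / (8 * s) := by positivity
    have h4 : Real.exp (-y ^ 2 / (8 * s)) = (Real.exp (y ^ 2 / (8 * s)))⁻¹ := by
      rw [← Real.exp_neg]; ring_nf
    have h5 : (|y| / (2 * s)) ^ 2 = 2 * s⁻¹ * (y ^ 2 / (8 * s)) := by
      rw [div_pow, sq_abs]; field_simp; ring
    have h6 := Real.exp_pos (y ^ 2 / (8 * s))
    rw [h4, h5, mul_assoc]
    refine mul_le_of_le_one_right (by positivity) ?_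
    rw [inv_pow, ← div_eq_mul_inv, div_le_one (by positivity)]
    nlinarith
  have h7 : (√2 * (√s)⁻¹) ^ 2 = 2 * s⁻¹ := by
    rw [mul_pow, inv_pow, Real.sq_sqrt (by norm_num), Real.sq_sqrt hs.le]
  refine (sq_le_sq₀ (by positivity) (by positivity)).1 ?_
  rw [mul_pow, h7]
  exact h1

theorem heat_nonneg (s x : ℝ) : 0 ≤ heat s x := by unfold heat; positivity

/-- The Gaussian that bounds the derivative of the heat kernel. -/
def majorant (c t : ℝ) (y : Plane) : ℝ :=
  spread 1 t ^ (-(3 / 2) : ℝ) * Real.exp (-(c / spread 1 t) * ‖y‖ ^ 2)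

/-- Each Gaussian `exp (-yᵢ² / 4s)` is split into two equal factors: one pays for the factor `|yⱼ| /
2s`, the other is kept, and `s ≤ τ / δ` turns it into a Gaussian of rate `δ / 8` on the scale `τ`.
Two normalisations and the derivative give the power `-3/2`. -/
theorem abs_heatDeriv_le {δ lam t : ℝ} (hδ : 0 < δ) (hr : ∀ j, rate lam j ∈ Icc δ 1) (ht : 0 < t)
    (j : Fin 2) (y : Plane) : |heatDeriv lam j t y| ≤ √2 * majorant (δ / 8) t y := by
  set τ := spread 1 t with hτd
  have hτ : 0 < τ := spread_pos one_pos ht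
  have hpos : ∀ i, 0 < rate lam i := fun i => hδ.trans_le (hr i).1
  have hs : ∀ i, 0 < spread (rate lam i) t := fun i => spread_pos (hpos i) ht
  have hs1 : ∀ i, τ ≤ spread (rate lam i) t := fun i => spread_one_le (hpos i) (hr i).2 t
  have hs2 : ∀ i, spread (rate lam i) t ≤ τ / δ := fun i =>
    (spread_le (hpos i) (hr i).2 ht).trans (by gcongr; exact (hr i).1)
  have hheat : ∀ i, heat (spread (rate lam i) t) (y i) ≤
      (√τ)⁻¹ * Real.exp (-(y i) ^ 2 / (8 * spread (rate lam i) t))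
        * Real.exp (-(y i) ^ 2 / (8 * spread (rate lam i) t)) := fun i => by
    unfold heat
    rw [mul_assoc (√τ)⁻¹, ← Real.exp_add]
    have e : -(y i) ^ 2 / (8 * spread (rate lam i) t) + -(y i) ^ 2 / (8 * spread (rate lam i) t)
        = -(y i) ^ 2 / (4 * spread (rate lam i) t) := by
      have := hs i
      field_simp; ring
    rw [e]
    gcongr
    nlinarith [Real.pi_gt_three, hs1 i, hs i]
  have hexp : ∀ i, Real.exp (-(y i) ^ 2 / (8 * spread (rate lam i) t)) ≤
      Real.exp (-(δ / 8 / τ) * y i ^ 2) := fun i => by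
    gcongr
    rw [neg_div, neg_mul, neg_le_neg_iff, div_div, mul_comm (8 : ℝ) τ, ← div_div,
      div_mul_eq_mul_div, le_div_iff₀ (by have := hs i; positivity)]
    have h1 := hs2 i
    rw [le_div_iff₀ hδ] at h1
    have : δ / τ * y i ^ 2 / 8 * (8 * spread (rate lam i) t)
      = y i ^ 2 * ((spread (rate lam i) t * δ) / τ) := by field_simp
    rw [this]
    exact mul_le_of_le_one_right (sq_nonneg _) ((div_le_one hτ).2 h1)
  have hexp1 : ∀ i, Real.exp (-(y i) ^ 2 / (8 * spread (rate lam i) t)) ≤ 1 := fun i =>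
    Real.exp_le_one_iff.2 (by rw [neg_div]; have := hs i; exact neg_nonpos.2 (by positivity))
  have hj := mul_exp_neg_sq_le (hs j) (y j)
  have hinv : (√(spread (rate lam j) t))⁻¹ ≤ (√τ)⁻¹ := by
    have := hs1 j
    gcongr
  set E : Fin 2 → ℝ := fun i => Real.exp (-(y i) ^ 2 / (8 * spread (rate lam i) t)) with hE
  set F : Fin 2 → ℝ := fun i => Real.exp (-(δ / 8 / τ) * y i ^ 2) with hF
  have hE0 : ∀ i, 0 < E i := fun i => Real.exp_pos _
  have hτ32 : τ ^ (-(3 / 2) : ℝ) = (√τ)⁻¹ * ((√τ)⁻¹ * (√τ)⁻¹) := by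
    rw [← mul_inv, ← mul_inv, Real.mul_self_sqrt hτ.le, Real.sqrt_eq_rpow,
      show (3 / 2 : ℝ) = 1 / 2 + 1 by norm_num, Real.rpow_neg hτ.le, Real.rpow_add hτ, Real.rpow_one]
  have hFF : Real.exp (-(δ / 8 / τ) * ‖y‖ ^ 2) = F 0 * F 1 := by
    rw [hF, ← Real.exp_add, norm_sq_plane]; ring_nf
  have hEj : |y j| / (2 * spread (rate lam j) t) * (E 0 * E 1 * (E 0 * E 1))
      ≤ √2 * (√τ)⁻¹ * (F 0 * F 1) := by
    have hprod : E 0 * E 1 ≤ E j := by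
      fin_cases j
      · exact mul_le_of_le_one_right (hE0 0).le (hexp1 1)
      · exact mul_le_of_le_one_left (hE0 1).le (hexp1 0)
    calc _ = |y j| / (2 * spread (rate lam j) t) * (E 0 * E 1) * (E 0 * E 1) := by ring
      _ ≤ |y j| / (2 * spread (rate lam j) t) * E j * (F 0 * F 1) := by
          have := hs j
          gcongr
          · exact hexp 0
          · exact hexp 1
      _ ≤ √2 * (√τ)⁻¹ * (F 0 * F 1) := by
          refine mul_le_mul_of_nonneg_right (hj.trans ?_) (by positivity)
          gcongr
  unfold heatDeriv majorant
  rw [abs_mul, abs_neg, abs_div, abs_of_pos (show 0 < 2 * spread (rate lam j) t by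
    have := hs j; positivity), abs_of_nonneg (mul_nonneg (heat_nonneg _ _) (heat_nonneg _ _)),
    ← hτd, hτ32, hFF]
  calc _ ≤ |y j| / (2 * spread (rate lam j) t)
        * (((√τ)⁻¹ * E 0 * E 0) * ((√τ)⁻¹ * E 1 * E 1)) := by
        have := hs j
        exact mul_le_mul_of_nonneg_left (mul_le_mul (hheat 0) (hheat 1) (heat_nonneg _ _)
          (by positivity)) (by positivity)
    _ = ((√τ)⁻¹ * (√τ)⁻¹) * (|y j| / (2 * spread (rate lam j) t) * (E 0 * E 1 * (E 0 * E 1))) := by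
        ring
    _ ≤ ((√τ)⁻¹ * (√τ)⁻¹) * (√2 * (√τ)⁻¹ * (F 0 * F 1)) := by gcongr
    _ = _ := by ring

theorem abs_drift_le {lam t : ℝ} (hr : ∀ j, 0 ≤ rate lam j) (ht : 0 ≤ t) (z : Plane) (j : Fin 2) :
    |drift lam t z j| ≤ |z j| := by
  rw [drift_apply, abs_mul, abs_of_pos (Real.exp_pos _)]
  exact mul_le_of_le_one_left (abs_nonneg _)
    (Real.exp_le_one_iff.2 (by nlinarith [mul_nonneg (hr j) ht]))

theorem majorant_nonneg (c : ℝ) {t : ℝ} (ht : 0 < t) (y : Plane) : 0 ≤ majorant c t y :=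
  mul_nonneg (Real.rpow_nonneg (spread_pos one_pos ht).le _) (Real.exp_pos _).le

/-- The weighted kernel is bounded by a Gaussian, uniformly in the weight. -/
theorem expWeight_mul_mehler_le {m δ : ℝ} (hm : 0 ≤ m) (hδ : 0 < δ) :
    ∃ C : ℝ, 0 < C ∧ ∀ ε ∈ Icc (0 : ℝ) 1, ∀ lam, (∀ j, rate lam j ∈ Icc δ 1) → ∀ t, 0 < t →
      ∀ (j : Fin 2) (x z : Plane), expWeight m ε x * |mehler lam j t x z| ≤
        C * (Real.exp (-δ * t) * majorant (δ / 16) t (x - drift lam t z)) * expWeight m ε z := by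
  refine ⟨2 ^ m * (√2 * Real.exp ((2 * m + 1) ^ 2 / (4 * (δ / 8)))), by positivity, ?_⟩
  intro ε hε lam hr t ht j x z
  have hτ := spread_pos one_pos ht
  set y := x - drift lam t z with hy
  -- The displacement `y` is charged with the largest weight `ε = 1`, for a constant independent of
  -- `ε`; the drift contracts, so its weight is at most that of `z`.
  have h1 : expWeight m ε x ≤ 2 ^ m * (expWeight m 1 y * expWeight m ε z) := by
    calc expWeight m ε x = expWeight m ε (y + drift lam t z) := by rw [hy, sub_add_cancel]
      _ ≤ 2 ^ m * (expWeight m ε y * expWeight m ε (drift lam t z)) :=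
          expWeight_add_le hm hε.1 _ _
      _ ≤ _ := by
          have := expWeight_pos m 1 y
          have := expWeight_pos m ε (drift lam t z)
          gcongr
          · exact expWeight_mono m hε.2 y
          · exact expWeight_le_of_abs_le hm hε.1
              (abs_drift_le (fun j => hδ.le.trans (hr j).1) ht.le z)
  have h2 : |mehler lam j t x z| ≤ Real.exp (-δ * t) * (√2 * majorant (δ / 8) t y) := by
    unfold mehler
    rw [abs_mul, abs_of_pos (Real.exp_pos _)]
    refine mul_le_mul (Real.exp_le_exp.2 ?_) (abs_heatDeriv_le hδ hr ht j y) (abs_nonneg _)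
      (by positivity)
    nlinarith [(hr j).1]
  have h3 : expWeight m 1 y * majorant (δ / 8) t y ≤
      Real.exp ((2 * m + 1) ^ 2 / (4 * (δ / 8))) * majorant (δ / 16) t y := by
    have e1 : Real.exp (-(δ / 8 / spread 1 t) * ‖y‖ ^ 2) ≤
        Real.exp (-(δ / 8) * ‖y‖ ^ 2) * Real.exp (-(δ / 16 / spread 1 t) * ‖y‖ ^ 2) := by
      rw [← Real.exp_add, ← add_mul]
      gcongr
      -- Because `spread 1 t ≤ 1/2` at all times, half of the Gaussian is at least as narrow as `exp
      -- (-(δ/8) ‖y‖²)` and absorbs the weight of `y`.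
      have h4 : δ / 8 ≤ δ / 16 / spread 1 t := by
        rw [le_div_iff₀ hτ]
        nlinarith [spread_one_le_half t]
      have h5 : δ / 8 / spread 1 t = δ / 16 / spread 1 t + δ / 16 / spread 1 t := by
        field_simp; norm_num
      linarith
    have e2 := expWeight_mul_exp_le hm (show 0 < δ / 8 by positivity) y
    have h6 : 0 ≤ spread 1 t ^ (-(3 / 2) : ℝ) := Real.rpow_nonneg hτ.le _
    unfold majorant
    calc _ ≤ expWeight m 1 y * (spread 1 t ^ (-(3 / 2) : ℝ) * (Real.exp (-(δ / 8) * ‖y‖ ^ 2)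
            * Real.exp (-(δ / 16 / spread 1 t) * ‖y‖ ^ 2))) := by
          have := expWeight_pos m 1 y
          gcongr
      _ = (expWeight m 1 y * Real.exp (-(δ / 8) * ‖y‖ ^ 2)) * (spread 1 t ^ (-(3 / 2) : ℝ)
            * Real.exp (-(δ / 16 / spread 1 t) * ‖y‖ ^ 2)) := by ring
      _ ≤ _ := by gcongr
  have hz := expWeight_pos m ε z
  have hy1 := expWeight_pos m 1 y
  calc _ ≤ (2 ^ m * (expWeight m 1 y * expWeight m ε z)) *
        (Real.exp (-δ * t) * (√2 * majorant (δ / 8) t y)) :=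
        mul_le_mul h1 h2 (abs_nonneg _) (by positivity)
    _ = 2 ^ m * √2 * Real.exp (-δ * t) * expWeight m ε z *
        (expWeight m 1 y * majorant (δ / 8) t y) := by ring
    _ ≤ 2 ^ m * √2 * Real.exp (-δ * t) * expWeight m ε z *
        (Real.exp ((2 * m + 1) ^ 2 / (4 * (δ / 8))) * majorant (δ / 16) t y) := by gcongr
    _ = _ := by ring

end BurgersVortex

end


/-! ### Integral bounds for `invDiv`: in `L¹`, and from weighted `L^r` to weighted `L²`. -/

noncomputable section

namespace BurgersVortex

open ENNReal

@[fun_prop] theorem continuous_drift (lam : ℝ) :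
    Continuous fun p : ℝ × Plane => drift lam p.1 p.2 := by
  unfold drift
  fun_prop

@[fun_prop] theorem continuous_spread (a : ℝ) : Continuous (spread a) := by
  unfold spread
  fun_prop

theorem measurable_majorant (c lam : ℝ) :
    Measurable fun p : ℝ × Plane × Plane => majorant c p.1 (p.2.1 - drift lam p.1 p.2.2) := by
  have h1 : Measurable fun p : ℝ × Plane × Plane => spread 1 p.1 :=
    (continuous_spread 1).measurable.comp measurable_fst
  have h2 : Continuous fun p : ℝ × Plane × Plane => p.2.1 - drift lam p.1 p.2.2 :=
    continuous_snd.fst.sub ((continuous_drift lam).comp (continuous_fst.prodMk continuous_snd.snd))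
  unfold majorant
  exact (h1.pow_const _).mul (Real.measurable_exp.comp
    ((measurable_const.div h1).neg.mul (h2.norm.measurable.pow_const 2)))

theorem measurable_heat {α : Type*} [MeasurableSpace α] {s x : α → ℝ} (hs : Measurable s)
    (hx : Measurable x) : Measurable fun p => heat (s p) (x p) := by
  unfold heat
  fun_prop

theorem measurable_mehler (lam : ℝ) (j : Fin 2) :
    Measurable fun p : (ℝ × Plane) × Plane => mehler lam j p.1.1 p.2 p.1.2 := by
  have h1 : ∀ a, Measurable fun p : (ℝ × Plane) × Plane => spread a p.1.1 := fun a =>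
    (continuous_spread a).measurable.comp measurable_fst.fst
  have h2 : ∀ i : Fin 2, Measurable fun p : (ℝ × Plane) × Plane =>
      (p.2 - drift lam p.1.1 p.1.2) i := fun i => by
    simp only [PiLp.sub_apply, drift_apply]
    fun_prop
  unfold mehler heatDeriv
  refine Measurable.mul (by fun_prop) (Measurable.mul ?_ ?_)
  · exact ((h2 j).div ((h1 _).const_mul 2)).neg
  · exact (measurable_heat (h1 _) (h2 0)).mul (measurable_heat (h1 _) (h2 1))

/-- The integral of absolute values that controls `invDiv`. -/
def absInvDiv (lam : ℝ) (f : Plane → Fin 2 → ℝ) (x : Plane) : ℝ≥0∞ :=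
  ∫⁻ p : ℝ × Plane, ‖∑ j, mehler lam j p.1 x p.2 * f p.2 j‖ₑ
    ∂((volume.restrict (Ioi (0 : ℝ))).prod volume)

theorem enorm_invDiv_le (lam : ℝ) (f : Plane → Fin 2 → ℝ) (x : Plane) :
    ‖invDiv lam f x‖ₑ ≤ absInvDiv lam f x := by
  unfold invDiv absInvDiv
  rw [enorm_neg]
  exact enorm_integral_le_lintegral_enorm _

/-- The size of a two-component field in the weight `v`. -/
def weightedSize (m ε : ℝ) (f : Plane → Fin 2 → ℝ) (z : Plane) : ℝ≥0∞ :=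
  ∑ j, ENNReal.ofReal (expWeight m ε z) * ‖f z j‖ₑ

theorem AEMeasurable.weightedSize {m ε : ℝ} {f : Plane → Fin 2 → ℝ}
    (hf : ∀ j, AEMeasurable fun z => f z j) : AEMeasurable (weightedSize m ε f) := by
  unfold BurgersVortex.weightedSize
  refine Finset.aemeasurable_fun_sum _ fun j _ => ?_
  exact ((continuous_expWeight m ε).measurable.ennreal_ofReal.aemeasurable).mul (hf j).enorm

theorem expWeight_mul_absInvDiv_le {m δ : ℝ} (hm : 0 ≤ m) (hδ : 0 < δ) :
    ∃ C : ℝ, 0 < C ∧ ∀ ε ∈ Icc (0 : ℝ) 1, ∀ lam, (∀ j, rate lam j ∈ Icc δ 1) →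
      ∀ f : Plane → Fin 2 → ℝ, (∀ j, AEMeasurable fun z => f z j) → ∀ x,
      ENNReal.ofReal (expWeight m ε x) * absInvDiv lam f x ≤
        ENNReal.ofReal C * ∫⁻ t in Ioi (0 : ℝ), ENNReal.ofReal (Real.exp (-δ * t)) *
          ∫⁻ z, ENNReal.ofReal (majorant (δ / 16) t (x - drift lam t z)) * weightedSize m ε f z := by
  obtain ⟨C, hC, h⟩ := expWeight_mul_mehler_le hm hδ
  refine ⟨C, hC, fun ε hε lam hr f hf x => ?_⟩
  have hmaj : Measurable fun p : ℝ × Plane =>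
      ENNReal.ofReal (majorant (δ / 16) p.1 (x - drift lam p.1 p.2)) :=
    ((measurable_majorant (δ / 16) lam).comp (measurable_fst.prodMk
      (measurable_const.prodMk measurable_snd))).ennreal_ofReal
  have hF := AEMeasurable.weightedSize (m := m) (ε := ε) hf
  have hG : AEMeasurable (fun p : ℝ × Plane =>
      ENNReal.ofReal (Real.exp (-δ * p.1)) *
        (ENNReal.ofReal (majorant (δ / 16) p.1 (x - drift lam p.1 p.2)) * weightedSize m ε f p.2))
      ((volume.restrict (Ioi (0 : ℝ))).prod volume) := by
    refine AEMeasurable.mul (by fun_prop) (hmaj.aemeasurable.mul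
      (hF.comp_quasiMeasurePreserving Measure.quasiMeasurePreserving_snd))
  calc ENNReal.ofReal (expWeight m ε x) * absInvDiv lam f x
      = ∫⁻ p : ℝ × Plane, ENNReal.ofReal (expWeight m ε x)
          * ‖∑ j, mehler lam j p.1 x p.2 * f p.2 j‖ₑ
          ∂((volume.restrict (Ioi (0 : ℝ))).prod volume) :=
        (lintegral_const_mul' _ _ ENNReal.ofReal_ne_top).symm
    _ ≤ ∫⁻ p : ℝ × Plane, ENNReal.ofReal C * (ENNReal.ofReal (Real.exp (-δ * p.1)) *
          (ENNReal.ofReal (majorant (δ / 16) p.1 (x - drift lam p.1 p.2))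
            * weightedSize m ε f p.2)) ∂((volume.restrict (Ioi (0 : ℝ))).prod volume) := by
        refine lintegral_mono_ae ?_
        have hpos : ∀ᵐ p : ℝ × Plane ∂((volume.restrict (Ioi (0 : ℝ))).prod volume), 0 < p.1 :=
          Measure.quasiMeasurePreserving_fst.ae (ae_restrict_mem measurableSet_Ioi)
        filter_upwards [hpos] with p hp
        calc _ ≤ ENNReal.ofReal (expWeight m ε x) * ∑ j, ‖mehler lam j p.1 x p.2 * f p.2 j‖ₑ := by
              gcongr
              exact enorm_sum_le _ _
          _ = ∑ j, ENNReal.ofReal (expWeight m ε x * |mehler lam j p.1 x p.2|) * ‖f p.2 j‖ₑ := by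
              rw [Finset.mul_sum]
              refine Finset.sum_congr rfl fun j _ => ?_
              rw [enorm_mul, ← mul_assoc, ENNReal.ofReal_mul (expWeight_pos _ _ _).le,
                ← Real.norm_eq_abs, ofReal_norm]
          _ ≤ ∑ j, ENNReal.ofReal (C * (Real.exp (-δ * p.1) * majorant (δ / 16) p.1
                (x - drift lam p.1 p.2)) * expWeight m ε p.2) * ‖f p.2 j‖ₑ := by
              exact Finset.sum_le_sum fun j _ => mul_le_mul'
                (ENNReal.ofReal_le_ofReal (h ε hε lam hr p.1 hp j x p.2)) le_rfl
          _ = _ := by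
              have h0 := majorant_nonneg (δ / 16) hp (x - drift lam p.1 p.2)
              rw [ENNReal.ofReal_mul (by positivity), ENNReal.ofReal_mul hC.le,
                ENNReal.ofReal_mul (Real.exp_pos _).le, weightedSize, ← Finset.mul_sum,
                ← Finset.mul_sum]
              ring
    _ = _ := by
        rw [lintegral_const_mul' _ _ ENNReal.ofReal_ne_top, lintegral_prod _ hG]
        congr 1
        refine lintegral_congr fun t => ?_
        dsimp only
        rw [lintegral_const_mul' _ _ ENNReal.ofReal_ne_top]

/-- The linear drift has trace one, so its Jacobian is `exp (-t)` for every asymmetry. -/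
theorem rate_add (lam : ℝ) : rate lam 0 + rate lam 1 = 1 := by
  simp only [rate, Matrix.cons_val_zero, Matrix.cons_val_one]
  ring

theorem majorant_rpow {c p t : ℝ} (ht : 0 < t) (y : Plane) :
    ENNReal.ofReal (majorant c t y) ^ p = ENNReal.ofReal (spread 1 t ^ (-(3 / 2) * p)) *
      ENNReal.ofReal (Real.exp (-(p * c / spread 1 t) * (y 0 ^ 2 + y 1 ^ 2))) := by
  have hτ := spread_pos one_pos ht
  have h0 : 0 < spread 1 t ^ (-(3 / 2) : ℝ) := Real.rpow_pos_of_pos hτ _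
  have hpos : 0 < majorant c t y := by unfold majorant; positivity
  rw [ENNReal.ofReal_rpow_of_pos hpos, majorant, Real.mul_rpow h0.le (Real.exp_pos _).le,
    ← Real.rpow_mul hτ.le, ← Real.exp_mul, ENNReal.ofReal_mul (Real.rpow_nonneg hτ.le _),
    norm_sq_plane]
  ring_nf

theorem lintegral_majorant_left {c p t : ℝ} (hc : 0 < c) (hp : 0 < p) (ht : 0 < t) (w : Plane) :
    ∫⁻ x, ENNReal.ofReal (majorant c t (x - w)) ^ p =
      ENNReal.ofReal (spread 1 t ^ (1 - 3 / 2 * p) * (Real.pi / (p * c))) := by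
  have hτ := spread_pos one_pos ht
  simp only [majorant_rpow ht]
  rw [lintegral_const_mul' _ _ ENNReal.ofReal_ne_top]
  have := lintegral_gaussian_plane (b := p * c / spread 1 t) (by positivity) one_pos one_pos w
  simp only [one_mul] at this
  rw [lintegral_congr (fun x => by
    rw [PiLp.sub_apply, PiLp.sub_apply, sub_sq_comm (x 0), sub_sq_comm (x 1)]), this,
    ← ENNReal.ofReal_mul (Real.rpow_nonneg hτ.le _)]
  congr 1
  rw [sub_eq_add_neg, Real.rpow_add hτ, Real.rpow_one, neg_mul]
  field_simp

/-- Unlike the integral in `x`, the integral in `z` passes through the contraction `drift`, whose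
inverse Jacobian is the factor `exp t`. -/
theorem lintegral_majorant_right {c p t lam : ℝ} (hc : 0 < c) (hp : 0 < p) (ht : 0 < t)
    (x : Plane) :
    ∫⁻ z, ENNReal.ofReal (majorant c t (x - drift lam t z)) ^ p =
      ENNReal.ofReal (spread 1 t ^ (1 - 3 / 2 * p) * (Real.pi / (p * c))) *
        ENNReal.ofReal (Real.exp t) := by
  have hτ := spread_pos one_pos ht
  simp only [majorant_rpow ht]
  rw [lintegral_const_mul' _ _ ENNReal.ofReal_ne_top]
  have := lintegral_gaussian_plane (b := p * c / spread 1 t) (by positivity)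
    (Real.exp_pos (-rate lam 0 * t)) (Real.exp_pos (-rate lam 1 * t)) x
  simp only [PiLp.sub_apply, drift_apply]
  rw [this, ← ENNReal.ofReal_mul (Real.rpow_nonneg hτ.le _), ← ENNReal.ofReal_mul (by positivity)]
  congr 1
  rw [← Real.exp_add, ← Real.exp_neg, sub_eq_add_neg, Real.rpow_add hτ, Real.rpow_one, neg_mul,
    show -(-rate lam 0 * t + -rate lam 1 * t) = (rate lam 0 + rate lam 1) * t by ring,
    rate_add, one_mul]
  field_simp

/-- Near zero the integrand is at most of order `t ^ (κ - 1)`, integrable because `κ > 0`; the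
exponential handles large times. -/
theorem lintegral_time_lt_top {η κ : ℝ} (hη : 0 < η) (hκ : 0 < κ) (hκ1 : κ ≤ 1) :
    ∫⁻ t in Ioi (0 : ℝ), ENNReal.ofReal (Real.exp (-η * t) * spread 1 t ^ (κ - 1)) < ⊤ := by
  have i1 := integrableOn_rpow_mul_exp_neg_mul_rpow (p := 1) (s := κ - 1) (by linarith) one_pos hη
  have i2 := integrableOn_rpow_mul_exp_neg_mul_rpow (p := 1) (s := κ) (by linarith) one_pos hη
  have i3 := i1.add (i2.const_mul 2)
  refine lt_of_le_of_lt (setLIntegral_mono' measurableSet_Ioi fun t ht => ?_)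
    (Integrable.lintegral_lt_top i3)
  have ht : (0 : ℝ) < t := ht
  refine ENNReal.ofReal_le_ofReal ?_
  have h1 : spread 1 t ^ (κ - 1) ≤ t ^ (κ - 1) * (1 + 2 * t) := by
    calc spread 1 t ^ (κ - 1) ≤ (t / (1 + 2 * t)) ^ (κ - 1) :=
          Real.rpow_le_rpow_of_nonpos (by positivity) (le_spread_one ht) (by linarith)
      _ = t ^ (κ - 1) * (1 + 2 * t) ^ (1 - κ) := by
          rw [Real.div_rpow ht.le (by positivity), div_eq_mul_inv, ← Real.rpow_neg (by positivity),
            neg_sub]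
      _ ≤ _ := by
          gcongr
          calc (1 + 2 * t) ^ (1 - κ) ≤ (1 + 2 * t) ^ (1 : ℝ) :=
                Real.rpow_le_rpow_of_exponent_le (by linarith) (by linarith)
            _ = _ := Real.rpow_one _
  simp only [Pi.add_apply, Real.rpow_one]
  have h2 : t ^ κ = t ^ (κ - 1) * t := by
    rw [← Real.rpow_add_one ht.ne']; ring_nf
  rw [h2]
  calc _ ≤ Real.exp (-η * t) * (t ^ (κ - 1) * (1 + 2 * t)) := by gcongr
    _ = _ := by ring

theorem measurable_time (η s : ℝ) :
    Measurable fun t : ℝ => ENNReal.ofReal (Real.exp (-η * t) * spread 1 t ^ s) :=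
  ((by fun_prop : Measurable fun t : ℝ => Real.exp (-η * t)).mul
    ((continuous_spread 1).measurable.pow_const s)).ennreal_ofReal

theorem aemeasurable_majorant_mul {c lam : ℝ} {g : Plane → ℝ≥0∞} (hg : AEMeasurable g)
    (μ : Measure ℝ) [SFinite μ] : AEMeasurable (fun p : (ℝ × Plane) × Plane =>
      ENNReal.ofReal (majorant c p.1.1 (p.1.2 - drift lam p.1.1 p.2)) * g p.2)
      ((μ.prod volume).prod volume) := by
  refine AEMeasurable.mul ?_ (hg.comp_quasiMeasurePreserving Measure.quasiMeasurePreserving_snd)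
  exact ((measurable_majorant c lam).comp (measurable_fst.fst.prodMk
    (measurable_fst.snd.prodMk measurable_snd))).ennreal_ofReal.aemeasurable

/-- `invDiv` maps `L¹` to `L¹`. -/
theorem lintegral_absInvDiv_le {δ : ℝ} (hδ : 0 < δ) :
    ∃ C : ℝ≥0∞, C ≠ ⊤ ∧ ∀ lam, (∀ j, rate lam j ∈ Icc δ 1) →
      ∀ f : Plane → Fin 2 → ℝ, (∀ j, AEMeasurable fun z => f z j) →
      ∫⁻ x, absInvDiv lam f x ≤ C * ∫⁻ z, ∑ j, ‖f z j‖ₑ := by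
  obtain ⟨C, hC, h⟩ := expWeight_mul_absInvDiv_le le_rfl hδ
  have hfin := lintegral_time_lt_top hδ (κ := 1 / 2) (by norm_num) (by norm_num)
  set I := ∫⁻ t in Ioi (0 : ℝ), ENNReal.ofReal (Real.exp (-δ * t) * spread 1 t ^ ((1 : ℝ) / 2 - 1))
  refine ⟨ENNReal.ofReal C * (I * ENNReal.ofReal (Real.pi / (δ / 16))), by finiteness,
    fun lam hr f hf => ?_⟩
  have hw : ∀ x, expWeight 0 0 x = 1 := fun x => by simp [expWeight]
  have hs : weightedSize 0 0 f = fun z => ∑ j, ‖f z j‖ₑ := by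
    ext z; simp [weightedSize, hw]
  have hF := AEMeasurable.weightedSize (m := 0) (ε := 0) hf
  have hmeas := aemeasurable_majorant_mul (c := δ / 16) (lam := lam) hF
    (volume.restrict (Ioi (0 : ℝ)))
  have hmeas2 : AEMeasurable (fun p : Plane × ℝ => ENNReal.ofReal (Real.exp (-δ * p.2)) *
      ∫⁻ z, ENNReal.ofReal (majorant (δ / 16) p.2 (p.1 - drift lam p.2 z)) * weightedSize 0 0 f z)
      (volume.prod (volume.restrict (Ioi (0 : ℝ)))) := by
    have h3 := hmeas.lintegral_prod_right'.prod_swap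
    exact AEMeasurable.mul (by fun_prop) h3
  calc ∫⁻ x, absInvDiv lam f x
      ≤ ∫⁻ x, ENNReal.ofReal C * ∫⁻ t in Ioi (0 : ℝ), ENNReal.ofReal (Real.exp (-δ * t)) *
          ∫⁻ z, ENNReal.ofReal (majorant (δ / 16) t (x - drift lam t z)) * weightedSize 0 0 f z := by
        refine lintegral_mono fun x => ?_
        have := h 0 (by simp) lam hr f hf x
        rwa [hw, ENNReal.ofReal_one, one_mul] at this
    _ = ENNReal.ofReal C * ∫⁻ t in Ioi (0 : ℝ), ENNReal.ofReal (Real.exp (-δ * t)) * ∫⁻ x,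
          ∫⁻ z, ENNReal.ofReal (majorant (δ / 16) t (x - drift lam t z)) * weightedSize 0 0 f z := by
        rw [lintegral_const_mul' _ _ ENNReal.ofReal_ne_top, lintegral_lintegral_swap hmeas2]
        simp only [lintegral_const_mul' _ _ ENNReal.ofReal_ne_top]
    _ ≤ ENNReal.ofReal C * ∫⁻ t in Ioi (0 : ℝ), ENNReal.ofReal (Real.exp (-δ * t) *
          spread 1 t ^ ((1 : ℝ) / 2 - 1)) * (ENNReal.ofReal (Real.pi / (δ / 16)) *
            ∫⁻ z, weightedSize 0 0 f z) := by
        refine mul_le_mul_right (setLIntegral_mono' measurableSet_Ioi fun t ht => ?_) _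
        have ht : (0 : ℝ) < t := ht
        have hτ := spread_pos one_pos ht
        have hk : Measurable (Function.uncurry fun x z : Plane =>
            ENNReal.ofReal (majorant (δ / 16) t (x - drift lam t z))) :=
          ((measurable_majorant (δ / 16) lam).comp
            (measurable_const.prodMk measurable_id)).ennreal_ofReal
        -- In `L¹` the exponent of `B` in Young's inequality is `θa - θs = 0`, so `B = ⊤`
        -- contributes `⊤ ^ 0 = 1` and the growth `exp t` never appears.
        have := lnorm_kernel_le (θa := 1) (θr := 1) (θs := 1) (μ := volume) (ν := volume) one_pos
          le_rfl le_rfl rfl hk hF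
          (A := ENNReal.ofReal (spread 1 t ^ ((1 : ℝ) / 2 - 1) * (Real.pi / (δ / 16)))) (B := ⊤)
          (fun z => by
            have := lintegral_majorant_left (c := δ / 16) (p := 1 / 1) (by positivity)
              (by norm_num) ht (drift lam t z)
            rw [this]
            norm_num) (fun x => le_top)
        simp only [lnorm_one, sub_self, ENNReal.rpow_zero, ENNReal.rpow_one, mul_one] at this
        calc _ ≤ _ := mul_le_mul_right this _
          _ = _ := by
            rw [ENNReal.ofReal_mul (Real.rpow_nonneg hτ.le _), ENNReal.ofReal_mul (Real.exp_pos _).le]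
            ring
    _ = _ := by
        rw [lintegral_mul_const _ (measurable_time δ _), hs]
        ring

/-- `invDiv` maps `L^r(v)` to `L²(v)`, with `1 / r = 1 - δ / 2`, uniformly in the weight. -/
theorem lnorm_absInvDiv_le {m δ : ℝ} (hm : 0 ≤ m) (hδ : 0 < δ) (hδ1 : δ ≤ 1 / 2) :
    ∃ C : ℝ≥0∞, C ≠ ⊤ ∧ ∀ ε ∈ Icc (0 : ℝ) 1, ∀ lam, (∀ j, rate lam j ∈ Icc δ 1) →
      ∀ f : Plane → Fin 2 → ℝ, (∀ j, AEMeasurable fun z => f z j) →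
      lnorm (1 / 2) volume (fun x => ENNReal.ofReal (expWeight m ε x) * absInvDiv lam f x)
        ≤ C * lnorm (1 - δ / 2) volume (weightedSize m ε f) := by
  obtain ⟨C, hC, h⟩ := expWeight_mul_absInvDiv_le hm hδ
  have hfin := lintegral_time_lt_top (η := δ / 2) (κ := δ / 2) (by positivity) (by positivity)
    (by linarith)
  set I := ∫⁻ t in Ioi (0 : ℝ), ENNReal.ofReal (Real.exp (-(δ / 2) * t) *
    spread 1 t ^ (δ / 2 - 1))
  -- Forced by Young's relation `θ + (1 - δ/2) = 1 + 1/2`. The kernel then has size `(spread 1 t) ^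
  -- (θ - 3/2) = (spread 1 t) ^ (δ/2 - 1)`, which is integrable at time zero.
  set θ : ℝ := 1 / 2 + δ / 2 with hθ
  have hθ0 : 0 < θ := by positivity
  refine ⟨ENNReal.ofReal C * (I * ENNReal.ofReal ((Real.pi / (1 / θ * (δ / 16))) ^ θ)),
    by finiteness, fun ε hε lam hr f hf => ?_⟩
  have hF := AEMeasurable.weightedSize (m := m) (ε := ε) hf
  have hmeas := aemeasurable_majorant_mul (c := δ / 16) (lam := lam) hF
    (volume.restrict (Ioi (0 : ℝ)))
  have hmeas2 : AEMeasurable (Function.uncurry fun (t : ℝ) (x : Plane) =>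
      ENNReal.ofReal (Real.exp (-δ * t)) *
      ∫⁻ z, ENNReal.ofReal (majorant (δ / 16) t (x - drift lam t z)) * weightedSize m ε f z)
      ((volume.restrict (Ioi (0 : ℝ))).prod volume) := by
    refine AEMeasurable.mul (by fun_prop) hmeas.lintegral_prod_right'
  calc _ ≤ lnorm (1 / 2) volume (fun x => ENNReal.ofReal C *
          ∫⁻ t in Ioi (0 : ℝ), ENNReal.ofReal (Real.exp (-δ * t)) *
          ∫⁻ z, ENNReal.ofReal (majorant (δ / 16) t (x - drift lam t z)) * weightedSize m ε f z) :=
        lnorm_mono (by norm_num) (Filter.Eventually.of_forall fun x => h ε hε lam hr f hf x)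
    _ ≤ ENNReal.ofReal C * ∫⁻ t in Ioi (0 : ℝ), lnorm (1 / 2) volume (fun x =>
          ENNReal.ofReal (Real.exp (-δ * t)) * ∫⁻ z,
            ENNReal.ofReal (majorant (δ / 16) t (x - drift lam t z)) * weightedSize m ε f z) := by
        rw [lnorm_const_mul (by norm_num) _ ENNReal.ofReal_ne_top]
        gcongr
        exact lnorm_lintegral_le hmeas2
    _ ≤ ENNReal.ofReal C * ∫⁻ t in Ioi (0 : ℝ), ENNReal.ofReal (Real.exp (-(δ / 2) * t) *
          spread 1 t ^ (δ / 2 - 1)) * (ENNReal.ofReal ((Real.pi / (1 / θ * (δ / 16))) ^ θ) *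
            lnorm (1 - δ / 2) volume (weightedSize m ε f)) := by
        refine mul_le_mul_right (setLIntegral_mono' measurableSet_Ioi fun t ht => ?_) _
        have ht : (0 : ℝ) < t := ht
        have hτ := spread_pos one_pos ht
        have hk : Measurable (Function.uncurry fun x z : Plane =>
            ENNReal.ofReal (majorant (δ / 16) t (x - drift lam t z))) :=
          ((measurable_majorant (δ / 16) lam).comp
            (measurable_const.prodMk measurable_id)).ennreal_ofReal
        set a : ℝ := spread 1 t ^ (1 - 3 / 2 * (1 / θ)) * (Real.pi / (1 / θ * (δ / 16))) with ha
        have ha0 : 0 < a := mul_pos (Real.rpow_pos_of_pos hτ _) (by positivity)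
        have := lnorm_kernel_le (θa := θ) (θr := 1 - δ / 2) (θs := 1 / 2) (μ := volume)
          (ν := volume) (by norm_num) (by linarith) (by linarith) (by rw [hθ]; ring) hk hF
          (A := ENNReal.ofReal a) (B := ENNReal.ofReal a * ENNReal.ofReal (Real.exp t))
          (fun z => (lintegral_majorant_left (by positivity) (by positivity) ht _).le)
          (fun x => (lintegral_majorant_right (by positivity) (by positivity) ht _).le)
        rw [lnorm_const_mul (by norm_num) _ ENNReal.ofReal_ne_top]
        refine (mul_le_mul_right this _).trans (le_of_eq ?_)
        have e1 : θ - 1 / 2 = δ / 2 := by rw [hθ]; ring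
        have e2 : a ^ θ = spread 1 t ^ (δ / 2 - 1) * (Real.pi / (1 / θ * (δ / 16))) ^ θ := by
          rw [ha, Real.mul_rpow (Real.rpow_nonneg hτ.le _) (by positivity), ← Real.rpow_mul hτ.le]
          congr 2
          field_simp
          rw [hθ]; ring
        rw [e1, ENNReal.mul_rpow_of_nonneg _ _ (by positivity), ← mul_assoc (ENNReal.ofReal a ^ _),
          ← ENNReal.rpow_add_of_nonneg _ _ (by norm_num) (by positivity),
          ← hθ, ENNReal.ofReal_rpow_of_pos ha0, e2, ENNReal.ofReal_rpow_of_pos (Real.exp_pos _),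
          ← Real.exp_mul, ← mul_assoc, ← mul_assoc, ← ENNReal.ofReal_mul (by positivity),
          ← ENNReal.ofReal_mul (by positivity), ← mul_assoc (ENNReal.ofReal _),
          ← ENNReal.ofReal_mul (mul_nonneg (Real.exp_pos _).le (Real.rpow_nonneg hτ.le _))]
        congr 2
        -- The Jacobian `exp t` enters with the power `θ - 1/2 = δ/2`; the factor `exp (-δ t)` from
        -- the derivative in the kernel beats it and leaves `exp (-δ t / 2)`.
        have e3 : Real.exp (-(δ / 2) * t) = Real.exp (-δ * t) * Real.exp (t * (δ / 2)) := by
          rw [← Real.exp_add]; ring_nf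
        rw [e3]; ring
    _ = _ := by
        rw [lintegral_mul_const _ (measurable_time (δ / 2) _)]
        ring

end BurgersVortex

end


/-! ### Velocity estimates and weighted bounds for the flux and the shear. -/

noncomputable section

namespace BurgersVortex

open ENNReal

/-! ### The planar Biot-Savart law -/

/-- The planar Biot-Savart kernel `(-d₂, d₁) / (2 π |d|²)`. -/
def planeKernel (d : Plane) : Fin 2 → ℝ :=
  ![-(d 1) / (2 * Real.pi * ‖d‖ ^ 2), d 0 / (2 * Real.pi * ‖d‖ ^ 2)]

/-- The planar velocity field generated by the vorticity `a`. -/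
def planeVelocity (a : Plane → ℝ) (x : Plane) (j : Fin 2) : ℝ :=
  ∫ y, planeKernel (x - y) j * a y

/-- The Riesz potential that bounds the velocity. -/
def absVelocity (a : Plane → ℝ) (x : Plane) : ℝ≥0∞ :=
  ∫⁻ y, ENNReal.ofReal ‖x - y‖⁻¹ * ‖a y‖ₑ

theorem measurable_planeKernel (j : Fin 2) : Measurable fun d => planeKernel d j := by
  unfold planeKernel
  fin_cases j <;> simp only [Fin.zero_eta, Fin.mk_one, Matrix.cons_val_zero, Matrix.cons_val_one] <;>
    fun_prop

theorem abs_planeKernel_le (d : Plane) (j : Fin 2) : |planeKernel d j| ≤ ‖d‖⁻¹ := by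
  have key : ∀ i : Fin 2, |d i| / (2 * Real.pi * ‖d‖ ^ 2) ≤ ‖d‖⁻¹ := fun i => by
    rcases eq_or_ne d 0 with rfl | hd
    · simp
    have hd' : 0 < ‖d‖ := norm_pos_iff.2 hd
    rw [div_le_iff₀ (by positivity)]
    have e : ‖d‖⁻¹ * (2 * Real.pi * ‖d‖ ^ 2) = 2 * Real.pi * ‖d‖ := by field_simp
    rw [e]
    nlinarith [abs_le_norm d i, Real.pi_gt_three]
  have hp : 0 ≤ 2 * Real.pi * ‖d‖ ^ 2 := by positivity
  fin_cases j
  · simpa [planeKernel, abs_div, abs_of_nonneg Real.pi_pos.le] using key 1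
  · simpa [planeKernel, abs_div, abs_of_nonneg Real.pi_pos.le] using key 0

theorem enorm_planeKernel_mul_le (a : Plane → ℝ) (x y : Plane) (j : Fin 2) :
    ‖planeKernel (x - y) j * a y‖ₑ ≤ ENNReal.ofReal ‖x - y‖⁻¹ * ‖a y‖ₑ := by
  rw [enorm_mul, ← ofReal_norm (planeKernel (x - y) j), Real.norm_eq_abs]
  gcongr
  exact abs_planeKernel_le _ _

theorem enorm_planeVelocity_le (a : Plane → ℝ) (x : Plane) (j : Fin 2) :
    ‖planeVelocity a x j‖ₑ ≤ absVelocity a x :=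
  (enorm_integral_le_lintegral_enorm _).trans
    (lintegral_mono fun y => enorm_planeKernel_mul_le a x y j)

theorem aestronglyMeasurable_planeKernel_mul {a : Plane → ℝ} (ha : AEStronglyMeasurable a)
    (j : Fin 2) : AEStronglyMeasurable (fun p : Plane × Plane => planeKernel (p.1 - p.2) j * a p.2)
      (volume.prod volume) :=
  ((measurable_planeKernel j).comp (measurable_fst.sub measurable_snd)).aestronglyMeasurable.mul
    ha.comp_snd

theorem aestronglyMeasurable_planeVelocity {a : Plane → ℝ} (ha : AEStronglyMeasurable a)
    (j : Fin 2) : AEStronglyMeasurable fun x => planeVelocity a x j :=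
  (aestronglyMeasurable_planeKernel_mul ha j).integral_prod_right'

theorem aemeasurable_absVelocity {a : Plane → ℝ} (ha : AEStronglyMeasurable a) :
    AEMeasurable (absVelocity a) := by
  have : AEMeasurable (fun p : Plane × Plane => ENNReal.ofReal ‖p.1 - p.2‖⁻¹ * ‖a p.2‖ₑ)
      (volume.prod volume) := by
    refine AEMeasurable.mul (by fun_prop) ha.comp_snd.enorm
  exact this.lintegral_prod_right'

theorem integrable_planeKernel_mul {a : Plane → ℝ} (ha : AEStronglyMeasurable a) {x : Plane}
    (hx : absVelocity a x < ⊤) (j : Fin 2) : Integrable fun y => planeKernel (x - y) j * a y := by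
  refine ⟨((measurable_planeKernel j).comp
    (measurable_const.sub measurable_id)).aestronglyMeasurable.mul ha, ?_⟩
  exact (lintegral_mono fun y => enorm_planeKernel_mul_le a x y j).trans_lt hx

/-- Kernels of the form `k(x - y)`. -/
theorem lnorm_convolution_le {θa θr θs : ℝ} (hs : 0 < θs) (has : θs ≤ θa)
    (hrs : θs ≤ θr) (h : θa + θr = 1 + θs) {k : Plane → ℝ≥0∞} (hk : Measurable k)
    {g : Plane → ℝ≥0∞} (hg : AEMeasurable g) :
    lnorm θs volume (fun x => ∫⁻ y, k (x - y) * g y) ≤ lnorm θa volume k * lnorm θr volume g := by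
  have := lnorm_kernel_le (μ := volume) (ν := volume) hs has hrs h
    (k := fun x y : Plane => k (x - y)) (hk.comp (measurable_fst.sub measurable_snd)) hg
    (A := ∫⁻ x, k x ^ (1 / θa)) (B := ∫⁻ x, k x ^ (1 / θa))
    (fun z => (lintegral_sub_right_eq_self (fun x => k x ^ (1 / θa)) z).le)
    (fun x => (lintegral_sub_left_eq_self (fun x => k x ^ (1 / θa)) x).le)
  refine this.trans (le_of_eq ?_)
  rw [← rpow_add_of_nonneg _ _ hs.le (by linarith), add_sub_cancel]
  rfl

theorem lnorm_one_add_norm_inv_lt_top {θ : ℝ} (hθ : 0 < θ) (hθ1 : θ < 1 / 2) :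
    lnorm θ volume (fun x : Plane => ENNReal.ofReal (1 + ‖x‖)⁻¹) < ⊤ := by
  unfold lnorm
  refine rpow_lt_top_of_nonneg hθ.le (ne_of_lt ?_)
  have h2 : (Module.finrank ℝ Plane : ℝ) < 1 / θ := by
    rw [finrank_euclideanSpace_fin, lt_div_iff₀ hθ]
    push_cast
    linarith
  refine lt_of_le_of_lt (le_of_eq (lintegral_congr fun x => ?_))
    (integrable_one_add_norm (μ := (volume : Measure Plane)) h2).lintegral_lt_top
  rw [ENNReal.ofReal_rpow_of_pos (by positivity), Real.rpow_neg (by positivity),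
    Real.inv_rpow (by positivity)]

theorem lnorm_near_lt_top {θ : ℝ} (hθ : 1 / 2 < θ) :
    lnorm θ volume ((Metric.ball (0 : Plane) 1).indicator fun x => ENNReal.ofReal ‖x‖⁻¹) < ⊤ := by
  have hθ0 : 0 < θ := by linarith
  have hp : 0 < 1 / θ := by positivity
  unfold lnorm
  refine rpow_lt_top_of_nonneg hθ0.le (ne_of_lt ?_)
  have hi : IntegrableOn (fun x : Plane => ‖x‖ ^ (-(1 / θ))) (Metric.ball 0 1) := by
    refine integrableOn_ball_of_norm_le_rpow (C := 1) (α := 1 / θ)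
      (by rw [finrank_euclideanSpace_fin]; norm_num)
      ?_ (Filter.Eventually.of_forall fun x => ?_) ?_
    · rw [finrank_euclideanSpace_fin, div_lt_iff₀ hθ0]
      push_cast
      linarith
    · rw [one_mul, Real.norm_of_nonneg (Real.rpow_nonneg (norm_nonneg _) _)]
    · exact (measurable_norm.pow_const _).aestronglyMeasurable
  refine lt_of_le_of_lt (le_of_eq ?_) hi.lintegral_lt_top
  rw [← lintegral_indicator Metric.isOpen_ball.measurableSet]
  refine lintegral_congr fun x => ?_
  by_cases hx : x ∈ Metric.ball (0 : Plane) 1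
  · rw [indicator_of_mem hx, indicator_of_mem hx, ENNReal.ofReal_rpow_of_nonneg (by positivity) hp.le,
      Real.inv_rpow (norm_nonneg _), Real.rpow_neg (norm_nonneg _)]
  · rw [indicator_of_notMem hx, indicator_of_notMem hx, zero_rpow_of_pos hp]

/-- The velocity is in `L^q` for `q > 2`. -/
theorem lnorm_absVelocity_le {θ : ℝ} (hθ : 0 < θ) (hθ1 : θ < 1 / 2) :
    ∃ C : ℝ≥0∞, C ≠ ⊤ ∧ ∀ a : Plane → ℝ, AEStronglyMeasurable a →
      lnorm θ volume (absVelocity a) ≤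
        C * ((∫⁻ x, ‖a x‖ₑ) + lnorm (1 / 2) volume fun x => ‖a x‖ₑ) := by
  -- The kernel `‖x‖⁻¹` lies in no `L^p` of the plane. Its part near the origin lies in `L^p` for `p
  -- < 2` and acts on the `L²` norm of `a`; the rest lies in `L^p` for `p > 2` and acts on the `L¹`
  -- norm.
  set kn : Plane → ℝ≥0∞ := (Metric.ball (0 : Plane) 1).indicator fun x => ENNReal.ofReal ‖x‖⁻¹
  set kf : Plane → ℝ≥0∞ := fun x => ENNReal.ofReal 2 * ENNReal.ofReal (1 + ‖x‖)⁻¹ with hkf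
  have hkn : Measurable kn :=
    Measurable.indicator (by fun_prop) Metric.isOpen_ball.measurableSet
  have hkfm : Measurable kf := by fun_prop
  have h1 : lnorm (1 / 2 + θ) volume kn < ⊤ := lnorm_near_lt_top (by linarith)
  have h2 : lnorm θ volume kf < ⊤ := by
    rw [hkf, lnorm_const_mul hθ _ ENNReal.ofReal_ne_top]
    exact ENNReal.mul_lt_top ENNReal.ofReal_lt_top (lnorm_one_add_norm_inv_lt_top hθ hθ1)
  refine ⟨lnorm (1 / 2 + θ) volume kn + lnorm θ volume kf, by finiteness, fun a ha => ?_⟩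
  have hle : ∀ d : Plane, ENNReal.ofReal ‖d‖⁻¹ ≤ kn d + kf d := fun d => by
    by_cases hd : d ∈ Metric.ball (0 : Plane) 1
    · simp only [kn, indicator_of_mem hd]
      exact le_self_add
    · refine le_trans ?_ le_add_self
      rw [Metric.mem_ball, dist_zero_right, not_lt] at hd
      change _ ≤ ENNReal.ofReal 2 * ENNReal.ofReal (1 + ‖d‖)⁻¹
      rw [← ENNReal.ofReal_mul (by norm_num)]
      refine ENNReal.ofReal_le_ofReal ?_
      rw [← div_eq_mul_inv, inv_eq_one_div, div_le_div_iff₀ (by linarith) (by linarith)]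
      linarith
  have hmeas : ∀ k : Plane → ℝ≥0∞, Measurable k →
      AEMeasurable fun x => ∫⁻ y, k (x - y) * ‖a y‖ₑ := fun k hk => by
    have : AEMeasurable (fun p : Plane × Plane => k (p.1 - p.2) * ‖a p.2‖ₑ)
        (volume.prod volume) :=
      AEMeasurable.mul (hk.comp (measurable_fst.sub measurable_snd)).aemeasurable ha.comp_snd.enorm
    exact this.lintegral_prod_right'
  calc lnorm θ volume (absVelocity a)
      ≤ lnorm θ volume (fun x => (∫⁻ y, kn (x - y) * ‖a y‖ₑ) + ∫⁻ y, kf (x - y) * ‖a y‖ₑ) := by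
        refine lnorm_mono hθ (Filter.Eventually.of_forall fun x => ?_)
        rw [← lintegral_add_left']
        · refine lintegral_mono fun y => ?_
          rw [← add_mul]
          gcongr
          exact hle _
        · exact (hkn.comp (measurable_const.sub measurable_id)).aemeasurable.mul ha.enorm
    _ ≤ lnorm θ volume (fun x => ∫⁻ y, kn (x - y) * ‖a y‖ₑ)
        + lnorm θ volume (fun x => ∫⁻ y, kf (x - y) * ‖a y‖ₑ) :=
        lnorm_add_le hθ (by linarith) (hmeas kn hkn) (hmeas kf hkfm)
    _ ≤ lnorm (1 / 2 + θ) volume kn * lnorm (1 / 2) volume (fun x => ‖a x‖ₑ)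
        + lnorm θ volume kf * ∫⁻ x, ‖a x‖ₑ := by
        refine add_le_add ?_ ?_
        · exact lnorm_convolution_le hθ (by linarith) hθ1.le (by ring) hkn ha.enorm
        · rw [← lnorm_one]
          exact lnorm_convolution_le hθ le_rfl (by linarith) (by ring) hkfm ha.enorm
    _ ≤ _ := by
        rw [add_mul, mul_add, mul_add]
        refine add_le_add le_add_self le_self_add

/-! ### Weighted norms -/

/-- The norm `‖b^m exp (ε |x|) h‖_{L²}`. -/
def expNorm (m ε : ℝ) (h : Plane → ℝ) : ℝ≥0∞ :=
  lnorm (1 / 2) volume fun x => ENNReal.ofReal (expWeight m ε x) * ‖h x‖ₑ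

/-- The weight is a product over the coordinates, so the integral factors into one-dimensional
integrals of `(1 + t²) ^ (-s)`. -/
theorem lnorm_weight_lt_top {s : ℝ} (hs : 1 / 2 < s) :
    lnorm (1 / 2) volume (fun x => ENNReal.ofReal (weight x ^ (-s))) < ⊤ := by
  unfold lnorm
  refine rpow_lt_top_of_nonneg (by norm_num) (ne_of_lt ?_)
  have hi : Integrable fun t : ℝ => (1 + t ^ 2) ^ (-s) := by
    have := integrable_rpow_neg_one_add_norm_sq (E := ℝ) (μ := volume) (r := 2 * s)
      (by rw [Module.finrank_self]; push_cast; linarith)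
    refine this.congr (Filter.Eventually.of_forall fun t => ?_)
    simp only [Real.norm_eq_abs, sq_abs]
    congr 1
    ring
  have hm : Measurable fun t : ℝ => ENNReal.ofReal ((1 + t ^ 2) ^ (-s)) := by fun_prop
  have := lintegral_plane_mul hm.aemeasurable hm.aemeasurable
  refine lt_of_le_of_lt (le_of_eq (Eq.trans (lintegral_congr fun x => ?_) this))
    (ENNReal.mul_lt_top hi.lintegral_lt_top hi.lintegral_lt_top)
  rw [ENNReal.ofReal_rpow_of_pos (Real.rpow_pos_of_pos (weight_pos x) _),
    ← Real.rpow_mul (weight_pos x).le, ← ENNReal.ofReal_mul (by positivity)]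
  congr 1
  unfold weight
  rw [Real.mul_rpow (by positivity) (by positivity), Real.sqrt_eq_rpow, Real.sqrt_eq_rpow,
    ← Real.rpow_mul (by positivity), ← Real.rpow_mul (by positivity)]
  congr 2 <;> ring

variable {m ε : ℝ}

theorem one_le_ofReal_expWeight (hm : 0 ≤ m) (hε : 0 ≤ ε) (x : Plane) :
    1 ≤ ENNReal.ofReal (expWeight m ε x) := by
  rw [← ENNReal.ofReal_one]
  exact ENNReal.ofReal_le_ofReal (one_le_expWeight hm hε x)

theorem expNorm_mono {ε' : ℝ} (h : ε ≤ ε') (f : Plane → ℝ) : expNorm m ε f ≤ expNorm m ε' f :=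
  lnorm_mono (by norm_num) (Filter.Eventually.of_forall fun x => by
    gcongr
    exact expWeight_mono m h x)

theorem expNorm_congr {f g : Plane → ℝ} (h : f =ᵐ[volume] g) : expNorm m ε f = expNorm m ε g :=
  lnorm_congr (by filter_upwards [h] with x hx; rw [hx])

theorem lnorm_enorm_le_expNorm (hm : 0 ≤ m) (hε : 0 ≤ ε) (h : Plane → ℝ) :
    lnorm (1 / 2) volume (fun x => ‖h x‖ₑ) ≤ expNorm m ε h :=
  lnorm_mono (by norm_num) (Filter.Eventually.of_forall fun x => by
    calc ‖h x‖ₑ = 1 * ‖h x‖ₑ := (one_mul _).symm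
      _ ≤ _ := by gcongr; exact one_le_ofReal_expWeight hm hε x)

/-- The moments of order at most one are controlled by the weighted norm. -/
theorem lintegral_moment_le (hm : 3 / 2 < m) :
    ∃ C : ℝ≥0∞, C ≠ ⊤ ∧ ∀ ε, 0 ≤ ε → ∀ h : Plane → ℝ, AEStronglyMeasurable h →
      ∫⁻ x, ENNReal.ofReal (1 + ‖x‖) * ‖h x‖ₑ ≤ C * expNorm m ε h := by
  -- The hypothesis `m > 3/2` enters here: `1 + ‖x‖ ≤ 2 weight x` uses one power of the weight, and
  -- the remaining `weight ^ (1 - m)` is square integrable because `m - 1 > 1/2`.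
  have hfin := lnorm_weight_lt_top (s := m - 1) (by linarith)
  refine ⟨ENNReal.ofReal 2 *
    lnorm (1 / 2) volume (fun x => ENNReal.ofReal (weight x ^ (-(m - 1)))), by finiteness,
    fun ε hε h hh => ?_⟩
  have hmw : Measurable fun x : Plane => ENNReal.ofReal (weight x ^ (-(m - 1))) :=
    (continuous_weight.measurable.pow_const _).ennreal_ofReal
  have hme : Measurable fun x : Plane => ENNReal.ofReal (expWeight m ε x) :=
    (continuous_expWeight m ε).measurable.ennreal_ofReal
  have := lnorm_mul_le (θ := 1 / 2) (θ' := 1 / 2) (μ := volume) (by norm_num) (by norm_num)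
    hmw.aemeasurable (hme.aemeasurable.mul hh.enorm)
  rw [add_halves, lnorm_one] at this
  rw [mul_assoc]
  refine le_trans ?_ (mul_le_mul_right this _)
  rw [← lintegral_const_mul' _ _ ENNReal.ofReal_ne_top]
  refine lintegral_mono fun x => ?_
  rw [Pi.mul_apply, ← mul_assoc, ← mul_assoc]
  gcongr
  rw [← ENNReal.ofReal_mul (by norm_num), ← ENNReal.ofReal_mul (by have := weight_pos x; positivity)]
  refine ENNReal.ofReal_le_ofReal ?_
  have h1 := weight_pos x
  have h2 := one_le_weight x
  have h3 := norm_le_weight x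
  have e : weight x ^ (-(m - 1)) * weight x ^ m = weight x := by
    rw [← Real.rpow_add h1]
    ring_nf
    exact Real.rpow_one _
  have h4 : (1 : ℝ) ≤ Real.exp (ε * ‖x‖) := Real.one_le_exp (by positivity)
  calc 1 + ‖x‖ ≤ 2 * (weight x ^ (-(m - 1)) * weight x ^ m) * 1 := by rw [e]; linarith
    _ ≤ 2 * (weight x ^ (-(m - 1)) * weight x ^ m) * Real.exp (ε * ‖x‖) := by
        gcongr
    _ = _ := by rw [expWeight]; ring

/-- A weighted `L^r` field with `1 / r = 1 - κ` is integrable. -/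
theorem lintegral_size_le (hm : 3 / 2 < m) {κ : ℝ} (hκ : 0 < κ) (hκ1 : κ ≤ 1 / 2) :
    ∃ C : ℝ≥0∞, C ≠ ⊤ ∧ ∀ ε, 0 ≤ ε → ∀ f : Plane → Fin 2 → ℝ,
      (∀ j, AEMeasurable fun z => f z j) →
      ∫⁻ z, ∑ j, ‖f z j‖ₑ ≤ C * lnorm (1 - κ) volume (weightedSize m ε f) := by
  -- A function bounded by one and square integrable lies in `L^(1/κ)`, because `1/κ ≥ 2`.
  have hfin : lnorm κ volume (fun x => ENNReal.ofReal (weight x ^ (-m))) < ⊤ := by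
    unfold lnorm
    refine rpow_lt_top_of_nonneg hκ.le (ne_of_lt ?_)
    have h1 := lnorm_weight_lt_top (s := m) (by linarith)
    unfold lnorm at h1
    rw [ENNReal.rpow_lt_top_iff_of_pos (by norm_num)] at h1
    refine lt_of_le_of_lt (lintegral_mono fun x => ?_) h1
    refine ENNReal.rpow_le_rpow_of_exponent_ge ?_ (by gcongr)
    rw [← ENNReal.ofReal_one]
    exact ENNReal.ofReal_le_ofReal (Real.rpow_le_one_of_one_le_of_nonpos (one_le_weight x)
      (by linarith))
  refine ⟨lnorm κ volume (fun x => ENNReal.ofReal (weight x ^ (-m))), hfin.ne,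
    fun ε hε f hf => ?_⟩
  have hmw : Measurable fun x : Plane => ENNReal.ofReal (weight x ^ (-m)) :=
    (continuous_weight.measurable.pow_const _).ennreal_ofReal
  have := lnorm_mul_le (θ := κ) (θ' := 1 - κ) (μ := volume) hκ (by linarith)
    hmw.aemeasurable (AEMeasurable.weightedSize (m := m) (ε := ε) hf)
  rw [add_sub_cancel, lnorm_one] at this
  refine le_trans (lintegral_mono fun x => ?_) this
  rw [weightedSize, ← Finset.mul_sum, ← mul_assoc]
  calc ∑ j, ‖f x j‖ₑ = 1 * ∑ j, ‖f x j‖ₑ := (one_mul _).symm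
    _ ≤ _ := by
      gcongr
      have h1 := weight_pos x
      rw [← ENNReal.ofReal_mul (by positivity), ← ENNReal.ofReal_one]
      refine ENNReal.ofReal_le_ofReal ?_
      unfold expWeight
      rw [← mul_assoc, ← Real.rpow_add h1, neg_add_cancel, Real.rpow_zero, one_mul]
      exact Real.one_le_exp (by positivity)

/-! ### The nonlinear flux and the shear -/

/-- The symmetric flux `u_a b + u_b a`. -/
def flux (a b : Plane → ℝ) (x : Plane) (j : Fin 2) : ℝ :=
  planeVelocity a x j * b x + planeVelocity b x j * a x

/-- The field `(x₁ h, -x₂ h) / 2`. -/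
def shear (h : Plane → ℝ) (x : Plane) (j : Fin 2) : ℝ := ![x 0 / 2, -(x 1) / 2] j * h x

theorem aestronglyMeasurable_flux {a b : Plane → ℝ} (ha : AEStronglyMeasurable a)
    (hb : AEStronglyMeasurable b) (j : Fin 2) : AEStronglyMeasurable fun x => flux a b x j :=
  ((aestronglyMeasurable_planeVelocity ha j).mul hb).add
    ((aestronglyMeasurable_planeVelocity hb j).mul ha)

theorem aestronglyMeasurable_shear {h : Plane → ℝ} (hh : AEStronglyMeasurable h) (j : Fin 2) :
    AEStronglyMeasurable fun x => shear h x j := by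
  refine AEStronglyMeasurable.mul (Continuous.aestronglyMeasurable ?_) hh
  fin_cases j <;> simp <;> fun_prop

/-- Hölder with `(1/2 - κ) + 1/2 = 1 - κ`. The weight is put entirely on `b`: the velocity decays
slowly and could carry none, but its `L^q` norm only needs unweighted norms of `a`. Hence there is
no loss in `ε`. -/
theorem lnorm_velocity_mul_le {κ : ℝ} (hκ : 0 < κ) (hκ1 : κ < 1 / 2) (hm : 3 / 2 < m) :
    ∃ C : ℝ≥0∞, C ≠ ⊤ ∧ ∀ ε, 0 ≤ ε → ∀ a b : Plane → ℝ, AEStronglyMeasurable a →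
      AEStronglyMeasurable b →
      lnorm (1 - κ) volume (fun x => absVelocity a x * (ENNReal.ofReal (expWeight m ε x) * ‖b x‖ₑ))
        ≤ C * expNorm m ε a * expNorm m ε b := by
  obtain ⟨C, hC, h⟩ := lnorm_absVelocity_le (θ := 1 / 2 - κ) (by linarith) (by linarith)
  obtain ⟨C', hC', h'⟩ := lintegral_moment_le hm
  refine ⟨C * (C' + 1), by finiteness, fun ε hε a b ha hb => ?_⟩
  have hme : Measurable fun x : Plane => ENNReal.ofReal (expWeight m ε x) :=
    (continuous_expWeight m ε).measurable.ennreal_ofReal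
  have := lnorm_mul_le (θ := 1 / 2 - κ) (θ' := 1 / 2) (μ := volume) (by linarith) (by norm_num)
    (aemeasurable_absVelocity ha) (hme.aemeasurable.mul hb.enorm)
  rw [show 1 / 2 - κ + 1 / 2 = 1 - κ by ring] at this
  refine this.trans ?_
  change _ * expNorm m ε b ≤ _
  gcongr
  refine (h a ha).trans ?_
  rw [mul_assoc, add_mul, one_mul]
  gcongr
  · refine le_trans (lintegral_mono fun x => ?_) (h' ε hε a ha)
    calc ‖a x‖ₑ = 1 * ‖a x‖ₑ := (one_mul _).symm
      _ ≤ _ := by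
        gcongr
        rw [← ENNReal.ofReal_one]
        exact ENNReal.ofReal_le_ofReal (by linarith [norm_nonneg x])
  · exact lnorm_enorm_le_expNorm (by linarith) hε a

theorem lnorm_weightedSize_flux_le {κ : ℝ} (hκ : 0 < κ) (hκ1 : κ < 1 / 2) (hm : 3 / 2 < m) :
    ∃ C : ℝ≥0∞, C ≠ ⊤ ∧ ∀ ε, 0 ≤ ε → ∀ a b : Plane → ℝ, AEStronglyMeasurable a →
      AEStronglyMeasurable b →
      lnorm (1 - κ) volume (weightedSize m ε (flux a b)) ≤ C * expNorm m ε a * expNorm m ε b := by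
  obtain ⟨C, hC, h⟩ := lnorm_velocity_mul_le hκ hκ1 hm
  refine ⟨4 * C, by finiteness, fun ε hε a b ha hb => ?_⟩
  have hme : Measurable fun x : Plane => ENNReal.ofReal (expWeight m ε x) :=
    (continuous_expWeight m ε).measurable.ennreal_ofReal
  calc _ ≤ lnorm (1 - κ) volume (fun x =>
        2 * (absVelocity a x * (ENNReal.ofReal (expWeight m ε x) * ‖b x‖ₑ))
        + 2 * (absVelocity b x * (ENNReal.ofReal (expWeight m ε x) * ‖a x‖ₑ))) := by
        refine lnorm_mono (by linarith) (Filter.Eventually.of_forall fun x => ?_)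
        have hj : ∀ j, ‖flux a b x j‖ₑ ≤ absVelocity a x * ‖b x‖ₑ + absVelocity b x * ‖a x‖ₑ :=
          fun j => by
            refine (enorm_add_le _ _).trans ?_
            rw [enorm_mul, enorm_mul]
            gcongr
            · exact enorm_planeVelocity_le a x j
            · exact enorm_planeVelocity_le b x j
        rw [weightedSize, Fin.sum_univ_two]
        calc _ ≤ ENNReal.ofReal (expWeight m ε x) *
                (absVelocity a x * ‖b x‖ₑ + absVelocity b x * ‖a x‖ₑ)
              + ENNReal.ofReal (expWeight m ε x) *
                (absVelocity a x * ‖b x‖ₑ + absVelocity b x * ‖a x‖ₑ) := by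
              gcongr <;> exact hj _
          _ = _ := by ring
    _ ≤ 2 * (C * expNorm m ε a * expNorm m ε b) + 2 * (C * expNorm m ε b * expNorm m ε a) := by
        refine (lnorm_add_le (by linarith) (by linarith) ?_ ?_).trans ?_
        · exact ((aemeasurable_absVelocity ha).mul (hme.aemeasurable.mul hb.enorm)).const_mul 2
        · exact ((aemeasurable_absVelocity hb).mul (hme.aemeasurable.mul ha.enorm)).const_mul 2
        · rw [lnorm_const_mul (by linarith) _ (by norm_num),
            lnorm_const_mul (by linarith) _ (by norm_num)]
          gcongr
          · exact h ε hε a b ha hb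
          · exact h ε hε b a hb ha
    _ = _ := by ring

/-- The only operation that consumes exponential weight. The gap `ε - ε'` pays for the factor `‖x‖`
and for a further `(1 + ‖x‖)⁻¹`, which takes `L²` to `L^r` with `1/r = 1 - κ`. -/
theorem lnorm_weightedSize_shear_le {κ : ℝ} (hκ : 0 < κ) (hκ1 : κ < 1 / 2) {ε ε' : ℝ}
    (h : ε' < ε) :
    ∃ C : ℝ≥0∞, C ≠ ⊤ ∧ ∀ f : Plane → ℝ, AEStronglyMeasurable f →
      lnorm (1 - κ) volume (weightedSize m ε' (shear f)) ≤ C * expNorm m ε f := by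
  have hfin := lnorm_one_add_norm_inv_lt_top (θ := 1 / 2 - κ) (by linarith) (by linarith)
  -- Chosen so that `d (1 + ‖x‖) ≤ exp ((ε - ε') ‖x‖ / 2)`; the square of this inequality provides
  -- both powers of `1 + ‖x‖`.
  set d := min 1 ((ε - ε') / 2) with hd
  have hd0 : 0 < d := lt_min one_pos (by linarith)
  refine ⟨ENNReal.ofReal (d⁻¹ ^ 2) * lnorm (1 / 2 - κ) volume
    (fun x : Plane => ENNReal.ofReal (1 + ‖x‖)⁻¹), by finiteness, fun f hf => ?_⟩
  have hme : Measurable fun x : Plane => ENNReal.ofReal (expWeight m ε x) :=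
    (continuous_expWeight m ε).measurable.ennreal_ofReal
  have hmn : Measurable fun x : Plane => ENNReal.ofReal (1 + ‖x‖)⁻¹ := by fun_prop
  have := lnorm_mul_le (θ := 1 / 2 - κ) (θ' := 1 / 2) (μ := volume) (by linarith) (by norm_num)
    hmn.aemeasurable (hme.aemeasurable.mul hf.enorm)
  rw [show 1 / 2 - κ + 1 / 2 = 1 - κ by ring] at this
  rw [mul_assoc]
  refine le_trans ?_ (mul_le_mul_right this _)
  rw [← lnorm_const_mul (by linarith) _ ENNReal.ofReal_ne_top]
  refine lnorm_mono (by linarith) (Filter.Eventually.of_forall fun x => ?_)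
  have hj : ∀ j, ‖shear f x j‖ₑ ≤ ENNReal.ofReal (‖x‖ / 2) * ‖f x‖ₑ := fun j => by
    rw [shear, enorm_mul, ← ofReal_norm (![x 0 / 2, -(x 1) / 2] j)]
    gcongr
    fin_cases j
    · simpa [abs_div] using div_le_div_of_nonneg_right (abs_le_norm x 0) (by norm_num : (0:ℝ) ≤ 2)
    · simpa [abs_div] using div_le_div_of_nonneg_right (abs_le_norm x 1) (by norm_num : (0:ℝ) ≤ 2)
  have hw : ‖x‖ * expWeight m ε' x ≤ d⁻¹ ^ 2 * ((1 + ‖x‖)⁻¹ * expWeight m ε x) := by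
    have e1 : expWeight m ε x = expWeight m ε' x * Real.exp ((ε - ε') / 2 * ‖x‖) ^ 2 := by
      unfold expWeight
      rw [mul_assoc, ← Real.exp_nat_mul, ← Real.exp_add]
      push_cast
      ring_nf
    have e2 : d * (1 + ‖x‖) ≤ Real.exp ((ε - ε') / 2 * ‖x‖) := by
      have h1 := Real.add_one_le_exp ((ε - ε') / 2 * ‖x‖)
      have h2 : d ≤ 1 := min_le_left _ _
      have h3 : d ≤ (ε - ε') / 2 := min_le_right _ _
      nlinarith [norm_nonneg x]
    have e3 : (d * (1 + ‖x‖)) ^ 2 ≤ Real.exp ((ε - ε') / 2 * ‖x‖) ^ 2 := by gcongr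
    have hp := expWeight_pos m ε' x
    rw [e1, inv_pow, ← div_eq_inv_mul, le_div_iff₀ (by positivity), ← div_eq_inv_mul,
      le_div_iff₀ (by positivity)]
    calc ‖x‖ * expWeight m ε' x * d ^ 2 * (1 + ‖x‖)
        ≤ (1 + ‖x‖) * expWeight m ε' x * d ^ 2 * (1 + ‖x‖) := by gcongr; linarith
      _ = expWeight m ε' x * (d * (1 + ‖x‖)) ^ 2 := by ring
      _ ≤ _ := by gcongr
  rw [weightedSize, Fin.sum_univ_two]
  calc _ ≤ ENNReal.ofReal (expWeight m ε' x) * (ENNReal.ofReal (‖x‖ / 2) * ‖f x‖ₑ)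
        + ENNReal.ofReal (expWeight m ε' x) * (ENNReal.ofReal (‖x‖ / 2) * ‖f x‖ₑ) := by
        gcongr <;> exact hj _
    _ = ENNReal.ofReal (‖x‖ * expWeight m ε' x) * ‖f x‖ₑ := by
        have hp := expWeight_pos m ε' x
        rw [← mul_add, ← add_mul, ← ENNReal.ofReal_add (by positivity) (by positivity), add_halves,
          ← mul_assoc, ← ENNReal.ofReal_mul hp.le, mul_comm ‖x‖]
    _ ≤ ENNReal.ofReal (d⁻¹ ^ 2 * ((1 + ‖x‖)⁻¹ * expWeight m ε x)) * ‖f x‖ₑ := by gcongr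
    _ = _ := by
        rw [ENNReal.ofReal_mul (by positivity), ENNReal.ofReal_mul (by positivity), Pi.mul_apply]
        ring

end BurgersVortex

end


/-! ### Plane waves, injectivity of the Fourier transform, and transforms of Gaussians. -/

noncomputable section

namespace BurgersVortex

open Filter Topology Complex

/-! ### Fourier transforms of integrable functions on the plane -/

/-- The plane wave `exp (-i x·ξ)`. -/
def wave (ξ x : Plane) : ℂ := cexp (-I * (x 0 * ξ 0 + x 1 * ξ 1 : ℝ))

theorem norm_wave (ξ x : Plane) : ‖wave ξ x‖ = 1 := by
  unfold wave
  rw [show -I * ((x 0 * ξ 0 + x 1 * ξ 1 : ℝ) : ℂ) = ((-(x 0 * ξ 0 + x 1 * ξ 1) : ℝ) : ℂ) * I by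
    push_cast; ring, Complex.norm_exp_ofReal_mul_I]

theorem continuous_wave_left (ξ : Plane) : Continuous (wave ξ) := by
  unfold wave
  fun_prop

theorem continuous_wave_right (x : Plane) : Continuous fun ξ => wave ξ x := by
  unfold wave
  fun_prop

theorem wave_add (ξ x y : Plane) : wave ξ (x + y) = wave ξ x * wave ξ y := by
  unfold wave
  rw [← Complex.exp_add]
  congr 1
  simp only [PiLp.add_apply]
  push_cast
  ring

/-- The drift is diagonal and so equal to its transpose: transport in space becomes transport of
frequencies. -/
theorem wave_drift (lam t : ℝ) (ξ z : Plane) : wave ξ (drift lam t z) = wave (drift lam t ξ) z := by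
  unfold wave
  simp only [drift_apply]
  congr 3
  ring

theorem wave_eq_mul (ξ x : Plane) : wave ξ x = cexp (I * (-ξ 0 : ℝ) * x 0) * cexp (I * (-ξ 1 : ℝ) * x 1) := by
  unfold wave
  rw [← Complex.exp_add]
  congr 1
  push_cast
  ring

@[simp] theorem wave_zero (x : Plane) : wave 0 x = 1 := by simp [wave]

theorem integrable_mul_wave {h : Plane → ℝ} (hh : Integrable h) (ξ : Plane) :
    Integrable fun x => (h x : ℂ) * wave ξ x :=
  hh.ofReal.mul_bdd (c := 1) (continuous_wave_left ξ).aestronglyMeasurable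
    (.of_forall fun x => (norm_wave ξ x).le)

/-- The Fourier transform `∫ h(x) exp (-i x·ξ) dx`. -/
def FT (h : Plane → ℝ) (ξ : Plane) : ℂ := ∫ x, (h x : ℂ) * wave ξ x

theorem FT_congr {h g : Plane → ℝ} (e : h =ᵐ[volume] g) (ξ : Plane) : FT h ξ = FT g ξ :=
  integral_congr_ae (e.mono fun x hx => by simp only [hx])

theorem FT_zero (h : Plane → ℝ) : FT h 0 = ((∫ x, h x : ℝ) : ℂ) := by
  simp only [FT, wave_zero, mul_one]
  exact integral_ofReal

theorem norm_FT_le (h : Plane → ℝ) (ξ : Plane) : ‖FT h ξ‖ ≤ ∫ x, ‖h x‖ :=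
  (norm_integral_le_integral_norm _).trans_eq (integral_congr_ae (.of_forall fun x => by
    simp [norm_wave]))

theorem continuous_FT {h : Plane → ℝ} (hh : Integrable h) : Continuous (FT h) := by
  refine continuous_of_dominated (bound := fun x => ‖h x‖)
    (fun ξ => (integrable_mul_wave hh ξ).aestronglyMeasurable)
    (fun ξ => .of_forall fun x => by simp [norm_wave]) hh.norm
    (.of_forall fun x => continuous_const.mul (continuous_wave_right x))

/-- An integrable function is determined by its Fourier transform. -/
theorem ae_eq_zero_of_FT_eq_zero {h : Plane → ℝ} (hh : Integrable h) (h0 : ∀ ξ, FT h ξ = 0) :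
    h =ᵐ[volume] 0 := by
  have hn : Integrable fun x => -h x := hh.neg
  set μ : Measure Plane := volume.withDensity fun x => ENNReal.ofReal (h x) with hμ
  set ν : Measure Plane := volume.withDensity fun x => ENNReal.ofReal (-h x) with hν
  have fin1 : IsFiniteMeasure μ := isFiniteMeasure_withDensity_ofReal hh.hasFiniteIntegral
  have fin2 : IsFiniteMeasure ν := isFiniteMeasure_withDensity_ofReal hn.hasFiniteIntegral
  have key : μ = ν := by
    -- The positive and negative parts of `h` are densities of finite measures, and the vanishing of
    -- `FT h` says that these have the same characteristic function.
    refine Measure.ext_of_charFun (funext fun t => ?_)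
    have e : ∀ x : Plane, cexp (inner ℝ x t * I) = wave (-t) x := fun x => by
      unfold wave
      congr 1
      simp [PiLp.inner_apply, Fin.sum_univ_two]
      ring
    simp only [charFun_apply, e]
    rw [hμ, hν, integral_withDensity_eq_integral_toReal_smul₀ hh.aemeasurable.ennreal_ofReal
      (.of_forall fun _ => ENNReal.ofReal_lt_top),
      integral_withDensity_eq_integral_toReal_smul₀ hn.aemeasurable.ennreal_ofReal
      (.of_forall fun _ => ENNReal.ofReal_lt_top), ← sub_eq_zero, ← integral_sub, ← h0 (-t)]
    · refine integral_congr_ae (.of_forall fun x => ?_)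
      simp only [ENNReal.toReal_ofReal', Complex.real_smul]
      rw [← sub_mul, ← ofReal_sub, max_zero_sub_max_neg_zero_eq_self]
    · exact (integrable_mul_wave hh.pos_part (-t)).congr (.of_forall fun x => by
        simp [ENNReal.toReal_ofReal'])
    · exact (integrable_mul_wave hn.pos_part (-t)).congr (.of_forall fun x => by
        simp [ENNReal.toReal_ofReal'])
  have := (withDensity_eq_iff hh.aemeasurable.ennreal_ofReal hn.aemeasurable.ennreal_ofReal
    (by simpa [hμ, withDensity_apply] using (measure_lt_top μ univ).ne)).1 key
  filter_upwards [this] with x hx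
  rcases le_total 0 (h x) with h1 | h1
  · rw [ENNReal.ofReal_of_nonpos (p := -h x) (by linarith), ENNReal.ofReal_eq_zero] at hx
    exact le_antisymm hx h1
  · rw [ENNReal.ofReal_of_nonpos h1, eq_comm, ENNReal.ofReal_eq_zero] at hx
    exact le_antisymm h1 (by simp at hx ⊢; linarith)

/-! ### Gaussians -/

theorem integral_heat_wave {s : ℝ} (hs : 0 < s) (k : ℝ) :
    ∫ y : ℝ, (heat s y : ℂ) * cexp (I * (-k : ℝ) * y) = Real.exp (-k ^ 2 * s) := by
  have h := fourierIntegral_gaussian (b := ((4 * s)⁻¹ : ℝ)) (by rw [ofReal_re]; positivity) ((-k : ℝ) : ℂ)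
  have e : ∀ y : ℝ, (heat s y : ℂ) * cexp (I * (-k : ℝ) * y) =
      ((√(4 * Real.pi * s))⁻¹ : ℝ) * (cexp (I * (-k : ℝ) * y) * cexp (-((4 * s)⁻¹ : ℝ) * y ^ 2)) :=
    fun y => by
      unfold heat
      push_cast
      rw [show -(y : ℂ) ^ 2 / (4 * s) = -(4 * (s : ℂ))⁻¹ * y ^ 2 by ring]
      ring
  simp only [e]
  rw [integral_const_mul, h, ← mul_assoc]
  have e2 : ((Real.pi / ((4 * s)⁻¹ : ℝ) : ℂ)) ^ (1 / 2 : ℂ) = (√(4 * Real.pi * s) : ℝ) := by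
    rw [Real.sqrt_eq_rpow, Complex.ofReal_cpow (by positivity)]
    push_cast
    congr 1
    field_simp
  rw [e2, ← ofReal_mul, inv_mul_cancel₀ (by positivity), ofReal_one, one_mul, Complex.ofReal_exp]
  congr 1
  push_cast
  have : (s : ℂ) ≠ 0 := by exact_mod_cast hs.ne'
  field_simp

theorem integrable_heat {s : ℝ} (hs : 0 < s) : Integrable (heat s) := by
  refine ((integrable_exp_neg_mul_sq (b := (4 * s)⁻¹) (by positivity)).const_mul
    (√(4 * Real.pi * s))⁻¹).congr (.of_forall fun y => ?_)
  simp only [heat]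
  congr 2
  ring

theorem integrable_mul_heat {s : ℝ} (hs : 0 < s) : Integrable fun y => y * heat s y := by
  refine ((integrable_mul_exp_neg_mul_sq (b := (4 * s)⁻¹) (by positivity)).const_mul
    (√(4 * Real.pi * s))⁻¹).congr (.of_forall fun y => ?_)
  simp only [heat]
  rw [show -(4 * s)⁻¹ * y ^ 2 = -y ^ 2 / (4 * s) by ring]
  ring

theorem hasDerivAt_heat (s y : ℝ) : HasDerivAt (heat s) (-(y / (2 * s)) * heat s y) y := by
  unfold heat
  have h1 : HasDerivAt (fun y : ℝ => -y ^ 2 / (4 * s)) (-(y / (2 * s))) y := by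
    refine (((hasDerivAt_pow 2 y).neg).div_const (4 * s)).congr_deriv ?_
    simp
    ring
  refine (h1.exp.const_mul _).congr_deriv ?_
  ring

theorem integral_heat_deriv_wave {s : ℝ} (hs : 0 < s) (k : ℝ) :
    ∫ y : ℝ, ((-(y / (2 * s)) * heat s y : ℝ) : ℂ) * cexp (I * (-k : ℝ) * y) =
      I * k * Real.exp (-k ^ 2 * s) := by
  have hb : ∀ {g : ℝ → ℝ}, Integrable g → Integrable fun y : ℝ => (g y : ℂ) * cexp (I * (-k : ℝ) * y) :=
    fun {g} hg => hg.ofReal.mul_bdd (c := 1) (by fun_prop) (.of_forall fun y => by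
      rw [show I * ((-k : ℝ) : ℂ) * y = ((-k * y : ℝ) : ℂ) * I by push_cast; ring,
        Complex.norm_exp_ofReal_mul_I])
  have hd : Integrable fun y => -(y / (2 * s)) * heat s y :=
    ((integrable_mul_heat hs).const_mul (-(1 / (2 * s)))).congr (.of_forall fun y => by
      simp only
      ring)
  have hu : ∀ y : ℝ, HasDerivAt (fun y : ℝ => cexp (I * (-k : ℝ) * y))
      (cexp (I * (-k : ℝ) * y) * (I * (-k : ℝ))) y := fun y => by
    have := (((hasDerivAt_id y).ofReal_comp).const_mul (I * ((-k : ℝ) : ℂ))).cexp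
    simpa using this
  have hi := integral_mul_deriv_eq_deriv_mul_of_integrable (A := ℂ)
    (u := fun y : ℝ => cexp (I * (-k : ℝ) * y)) (v := fun y => (heat s y : ℂ))
    (u' := fun y : ℝ => cexp (I * (-k : ℝ) * y) * (I * (-k : ℝ)))
    (v' := fun y : ℝ => ((-(y / (2 * s)) * heat s y : ℝ) : ℂ))
    (fun y _ => hu y) (fun y _ => (hasDerivAt_heat s y).ofReal_comp)
    ((hb hd).congr (.of_forall fun y => mul_comm _ _))
    (((hb (integrable_heat hs)).const_mul (I * (-k : ℝ))).congr (.of_forall fun y => by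
      simp only [Pi.mul_apply]
      ring))
    ((hb (integrable_heat hs)).congr (.of_forall fun y => mul_comm _ _))
  calc _ = ∫ y : ℝ, cexp (I * (-k : ℝ) * y) * ((-(y / (2 * s)) * heat s y : ℝ) : ℂ) :=
        integral_congr_ae (.of_forall fun y => mul_comm _ _)
    _ = _ := hi
    _ = -∫ y : ℝ, (I * (-k : ℝ)) * ((heat s y : ℂ) * cexp (I * (-k : ℝ) * y)) := by
        congr 1
        refine integral_congr_ae (.of_forall fun y => ?_)
        simp only
        ring
    _ = _ := by
        rw [integral_const_mul, integral_heat_wave hs]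
        push_cast
        ring

/-- `∑ⱼ ξⱼ² (1 - exp (-2 αⱼ t)) / (2 αⱼ)`. -/
def spreadForm (lam t : ℝ) (ξ : Plane) : ℝ :=
  ξ 0 ^ 2 * spread (rate lam 0) t + ξ 1 ^ 2 * spread (rate lam 1) t

theorem integral_heatDeriv_wave {lam t : ℝ} (hr : ∀ j, 0 < rate lam j) (ht : 0 < t) (j : Fin 2)
    (ξ : Plane) : ∫ y : Plane, (heatDeriv lam j t y : ℂ) * wave ξ y =
      I * ξ j * Real.exp (-spreadForm lam t ξ) := by
  have hs := fun j => spread_pos (hr j) ht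
  fin_cases j
  · calc _ = ∫ y : Plane, (((-(y 0 / (2 * spread (rate lam 0) t)) * heat (spread (rate lam 0) t) (y 0) : ℝ) : ℂ)
          * cexp (I * (-ξ 0 : ℝ) * y 0)) *
          ((heat (spread (rate lam 1) t) (y 1) : ℂ) * cexp (I * (-ξ 1 : ℝ) * y 1)) := by
          refine integral_congr_ae (.of_forall fun y => ?_)
          simp only [heatDeriv, wave_eq_mul]
          push_cast
          simp
          ring
      _ = _ := by
          rw [integral_plane_mul (fun s => (((-(s / (2 * spread (rate lam 0) t)) * heat (spread (rate lam 0) t) s : ℝ) : ℂ)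
            * cexp (I * (-ξ 0 : ℝ) * s)))
            (fun s => ((heat (spread (rate lam 1) t) s : ℂ) * cexp (I * (-ξ 1 : ℝ) * s))),
            integral_heat_deriv_wave (hs 0), integral_heat_wave (hs 1), mul_assoc, ← ofReal_mul,
            ← Real.exp_add]
          simp [spreadForm]
          left
          ring_nf
  · calc _ = ∫ y : Plane, ((heat (spread (rate lam 0) t) (y 0) : ℂ) * cexp (I * (-ξ 0 : ℝ) * y 0)) *
          (((-(y 1 / (2 * spread (rate lam 1) t)) * heat (spread (rate lam 1) t) (y 1) : ℝ) : ℂ)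
          * cexp (I * (-ξ 1 : ℝ) * y 1)) := by
          refine integral_congr_ae (.of_forall fun y => ?_)
          simp only [heatDeriv, wave_eq_mul]
          push_cast
          simp
          ring
      _ = _ := by
          rw [integral_plane_mul (fun s => ((heat (spread (rate lam 0) t) s : ℂ) * cexp (I * (-ξ 0 : ℝ) * s)))
            (fun s => (((-(s / (2 * spread (rate lam 1) t)) * heat (spread (rate lam 1) t) s : ℝ) : ℂ)
            * cexp (I * (-ξ 1 : ℝ) * s))),
            integral_heat_deriv_wave (hs 1), integral_heat_wave (hs 0), mul_left_comm, ← ofReal_mul,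
            ← Real.exp_add]
          simp [spreadForm]
          left
          ring_nf

/-- The heat times `(2 αⱼ)⁻¹` are the limits of `spread` at infinite time, so the vortex is the
equilibrium of the semigroup. -/
theorem gaussianVortex_eq {lam : ℝ} (hr : ∀ j, 0 < rate lam j) (x : Plane) :
    gaussianVortex lam x = heat (2 * rate lam 0)⁻¹ (x 0) * heat (2 * rate lam 1)⁻¹ (x 1) := by
  have h0 : 0 < 1 + lam := by have := hr 0; simp [rate] at this; linarith
  have h1 : 0 < 1 - lam := by have := hr 1; simp [rate] at this; linarith
  unfold gaussianVortex heat rate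
  simp only [Matrix.cons_val_zero, Matrix.cons_val_one]
  rw [mul_mul_mul_comm, ← Real.exp_add, ← mul_inv, ← Real.sqrt_mul (by positivity)]
  congr 1
  · rw [show 4 * Real.pi * (2 * ((1 + lam) / 2))⁻¹ * (4 * Real.pi * (2 * ((1 - lam) / 2))⁻¹) =
      (4 * Real.pi) ^ 2 / (1 - lam ^ 2) by
        rw [show 1 - lam ^ 2 = (1 + lam) * (1 - lam) by ring]; field_simp,
      Real.sqrt_div (by positivity), Real.sqrt_sq (by positivity), inv_div]
  · congr 1
    field_simp
    ring

theorem integrable_gaussianVortex {lam : ℝ} (hr : ∀ j, 0 < rate lam j) :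
    Integrable (gaussianVortex lam) := by
  have hp := fun j => inv_pos.2 (mul_pos two_pos (hr j))
  exact (integrable_plane_mul (integrable_heat (hp 0)) (integrable_heat (hp 1))).congr
    (.of_forall fun x => (gaussianVortex_eq hr x).symm)

/-- `∑ⱼ ξⱼ² / (2 αⱼ)`. -/
def limitForm (lam : ℝ) (ξ : Plane) : ℝ :=
  ξ 0 ^ 2 * (2 * rate lam 0)⁻¹ + ξ 1 ^ 2 * (2 * rate lam 1)⁻¹

theorem FT_gaussianVortex {lam : ℝ} (hr : ∀ j, 0 < rate lam j) (ξ : Plane) :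
    FT (gaussianVortex lam) ξ = Real.exp (-limitForm lam ξ) := by
  have hp := fun j => inv_pos.2 (mul_pos two_pos (hr j))
  calc _ = ∫ y : Plane, ((heat (2 * rate lam 0)⁻¹ (y 0) : ℂ) * cexp (I * (-ξ 0 : ℝ) * y 0)) *
          ((heat (2 * rate lam 1)⁻¹ (y 1) : ℂ) * cexp (I * (-ξ 1 : ℝ) * y 1)) := by
          refine integral_congr_ae (.of_forall fun y => ?_)
          simp only [gaussianVortex_eq hr, wave_eq_mul]
          push_cast
          ring
    _ = _ := by
      rw [integral_plane_mul (fun s => ((heat (2 * rate lam 0)⁻¹ s : ℂ) * cexp (I * (-ξ 0 : ℝ) * s)))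
        (fun s => ((heat (2 * rate lam 1)⁻¹ s : ℂ) * cexp (I * (-ξ 1 : ℝ) * s))),
        integral_heat_wave (hp 0), integral_heat_wave (hp 1), ← ofReal_mul, ← Real.exp_add]
      simp only [limitForm]
      ring_nf

end BurgersVortex

end


/-! ### Solving `L h = div f` by characteristics in frequency space. -/

noncomputable section

namespace BurgersVortex

open Filter Topology Complex

/-! ### The stationary Fokker-Planck equation in Fourier variables -/

/-- The symbol `∑ⱼ αⱼ xⱼ ξⱼ` of the drift. -/
def driftSymbol (lam : ℝ) (ξ x : Plane) : ℝ := ∑ j, rate lam j * x j * ξ j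

/-- The Fourier transform of `∑ⱼ αⱼ ∂ⱼ (xⱼ h) + Δ h = ∑ⱼ ∂ⱼ fⱼ`. -/
def Solves (lam : ℝ) (h : Plane → ℝ) (f : Plane → Fin 2 → ℝ) : Prop :=
  ∀ ξ : Plane, ∫ x, (h x : ℂ) * (I * driftSymbol lam ξ x) * wave ξ x =
    (ξ 0 ^ 2 + ξ 1 ^ 2 : ℝ) * FT h ξ + I * ∑ j, (ξ j : ℂ) * FT (fun x => f x j) ξ

theorem abs_driftSymbol_le {lam : ℝ} (hr : ∀ j, rate lam j ∈ Icc 0 1) (ξ x : Plane) :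
    |driftSymbol lam ξ x| ≤ 2 * ‖ξ‖ * (1 + ‖x‖) := by
  unfold driftSymbol
  refine (Finset.abs_sum_le_sum_abs _ _).trans ?_
  have : ∀ j, |rate lam j * x j * ξ j| ≤ ‖ξ‖ * (1 + ‖x‖) := fun j => by
    rw [abs_mul, abs_mul, abs_of_nonneg (hr j).1, mul_comm]
    refine mul_le_mul (abs_le_norm _ _) ?_ (by have := (hr j).1; positivity) (norm_nonneg _)
    calc rate lam j * |x j| ≤ 1 * ‖x‖ := mul_le_mul (hr j).2 (abs_le_norm _ _) (abs_nonneg _) zero_le_one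
      _ ≤ _ := by linarith
  rw [Fin.sum_univ_two]
  linarith [this 0, this 1]

theorem continuous_driftSymbol (lam : ℝ) (ξ : Plane) : Continuous (driftSymbol lam ξ) := by
  unfold driftSymbol
  fun_prop

theorem drift_drift (lam s t : ℝ) (z : Plane) : drift lam t (drift lam s z) = drift lam (t + s) z := by
  ext j
  simp only [drift_apply]
  rw [← mul_assoc, ← Real.exp_add]
  ring_nf

@[simp] theorem drift_zero (lam : ℝ) (z : Plane) : drift lam 0 z = z := by
  ext j
  simp

theorem integrable_mul_driftSymbol {lam : ℝ} (hr : ∀ j, rate lam j ∈ Icc 0 1) {h : Plane → ℝ}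
    (hm : Integrable fun x => (1 + ‖x‖) * h x) (ξ η : Plane) :
    Integrable fun x => (h x : ℂ) * (I * driftSymbol lam ξ x) * wave η x := by
  have hg : Integrable fun x => driftSymbol lam ξ x * h x := by
    refine (hm.bdd_mul (c := 2 * ‖ξ‖) (f := fun x => driftSymbol lam ξ x / (1 + ‖x‖))
      ((continuous_driftSymbol lam ξ).div (by fun_prop)
        fun x => by positivity).aestronglyMeasurable ?_).congr (.of_forall fun x => ?_)
    · refine .of_forall fun x => ?_
      have : 0 < 1 + ‖x‖ := by positivity
      rw [norm_div, Real.norm_eq_abs, Real.norm_of_nonneg this.le, div_le_iff₀ this]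
      exact abs_driftSymbol_le hr ξ x
    · have : 1 + ‖x‖ ≠ 0 := by positivity
      simp only
      field_simp
  refine ((integrable_mul_wave hg η).const_mul I).congr (.of_forall fun x => ?_)
  simp only
  push_cast
  ring

theorem integrable_of_moment {h : Plane → ℝ} (hm : Integrable fun x => (1 + ‖x‖) * h x) :
    Integrable h := by
  refine (hm.bdd_mul (c := 1) (f := fun x => (1 + ‖x‖)⁻¹)
      (Continuous.aestronglyMeasurable ((by fun_prop : Continuous fun x : Plane => 1 + ‖x‖).inv₀
        fun x => by positivity)) ?_).congr (.of_forall fun x => ?_)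
  · refine .of_forall fun x => ?_
    rw [norm_inv, Real.norm_of_nonneg (by positivity)]
    exact inv_le_one_of_one_le₀ (by linarith [norm_nonneg x])
  · have : 1 + ‖x‖ ≠ 0 := by positivity
    simp only
    field_simp

theorem hasDerivAt_wave_drift (lam s : ℝ) (ξ x : Plane) :
    HasDerivAt (fun s => wave (drift lam s ξ) x)
      (I * driftSymbol lam (drift lam s ξ) x * wave (drift lam s ξ) x) s := by
  unfold wave
  have hj : ∀ j, HasDerivAt (fun s => x j * (drift lam s ξ) j)
      (-(rate lam j * x j * (drift lam s ξ) j)) s := fun j => by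
    simp only [drift_apply]
    have h1 : HasDerivAt (fun s => -rate lam j * s) (-rate lam j) s := by
      simpa using (hasDerivAt_id s).const_mul (-rate lam j)
    refine ((h1.exp.mul_const (ξ j)).const_mul (x j)).congr_deriv ?_
    ring
  have := ((((hj 0).add (hj 1)).ofReal_comp).const_mul (-I)).cexp
  refine this.congr_deriv ?_
  simp only [driftSymbol, Fin.sum_univ_two, Pi.add_apply]
  push_cast
  ring

/-- The drift term of the equation is the derivative of the transform along the flow; a finite first
moment is what differentiation under the integral requires. -/
theorem hasDerivAt_FT_drift {lam : ℝ} (hr : ∀ j, rate lam j ∈ Icc 0 1) {h : Plane → ℝ}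
    (hm : Integrable fun x => (1 + ‖x‖) * h x) (ξ : Plane) (s : ℝ) :
    HasDerivAt (fun s => FT h (drift lam s ξ))
      (∫ x, (h x : ℂ) * (I * driftSymbol lam (drift lam s ξ) x) * wave (drift lam s ξ) x) s := by
  have hh := integrable_of_moment hm
  obtain ⟨C, hC⟩ : ∃ C, ∀ r ∈ Metric.closedBall s 1, ‖drift lam r ξ‖ ≤ C := by
    have hc : Continuous fun r => drift lam r ξ :=
      (continuous_drift lam).comp (continuous_id.prodMk continuous_const)
    exact (isCompact_closedBall s 1).exists_bound_of_continuousOn hc.continuousOn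
  refine (hasDerivAt_integral_of_dominated_loc_of_deriv_le
    (F' := fun s x => (h x : ℂ) * (I * driftSymbol lam (drift lam s ξ) x) * wave (drift lam s ξ) x)
    (bound := fun x => 2 * C * ‖(1 + ‖x‖) * h x‖)
    (Metric.closedBall_mem_nhds s one_pos)
    (.of_forall fun r => (integrable_mul_wave hh _).aestronglyMeasurable)
    (integrable_mul_wave hh _) (integrable_mul_driftSymbol hr hm _ _).aestronglyMeasurable
    (.of_forall fun x r hx => ?_) (hm.norm.const_mul _) (.of_forall fun x r _ => ?_)).2
  · rw [norm_mul, norm_wave, mul_one, norm_mul, norm_mul, norm_I, one_mul, norm_real, norm_real,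
      norm_mul, Real.norm_of_nonneg (by positivity : 0 ≤ 1 + ‖x‖), ← mul_assoc, mul_comm]
    refine mul_le_mul_of_nonneg_right ((abs_driftSymbol_le hr _ x).trans ?_) (norm_nonneg _)
    have := hC r hx
    gcongr
  · exact ((hasDerivAt_wave_drift lam r ξ x).const_mul (h x : ℂ)).congr_deriv (by ring)

theorem hasDerivAt_spread {a : ℝ} (ha : 0 < a) (t : ℝ) :
    HasDerivAt (spread a) (Real.exp (-2 * a * t)) t := by
  unfold spread
  have h1 : HasDerivAt (fun s => -2 * a * s) (-2 * a) t := by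
    simpa using (hasDerivAt_id t).const_mul (-2 * a)
  refine ((h1.exp.const_sub 1).div_const (2 * a)).congr_deriv ?_
  field_simp

/-- `spreadForm` is the time integral of `|drift ξ|²`, so `exp (-spreadForm)` is the integrating
factor of the Laplacian along a characteristic. -/
theorem hasDerivAt_spreadForm {lam : ℝ} (hr : ∀ j, 0 < rate lam j) (ξ : Plane) (t : ℝ) :
    HasDerivAt (fun t => spreadForm lam t ξ) (drift lam t ξ 0 ^ 2 + drift lam t ξ 1 ^ 2) t := by
  refine (((hasDerivAt_spread (hr 0) t).const_mul (ξ 0 ^ 2)).add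
    ((hasDerivAt_spread (hr 1) t).const_mul (ξ 1 ^ 2))).congr_deriv ?_
  simp only [drift_apply, mul_pow, ← Real.exp_nat_mul]
  rw [mul_comm, add_comm, mul_comm (ξ 1 ^ 2), add_comm]
  congr 3 <;> · push_cast; ring_nf

theorem spread_add (a s t : ℝ) : spread a (t + s) = spread a s + Real.exp (-a * s) ^ 2 * spread a t := by
  unfold spread
  rw [← Real.exp_nat_mul, show -2 * a * (t + s) = -2 * a * t + -2 * a * s by ring, Real.exp_add,
    show ((2 : ℕ) : ℝ) * (-a * s) = -2 * a * s by push_cast; ring]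
  ring

theorem spreadForm_drift (lam s t : ℝ) (ξ : Plane) :
    spreadForm lam s ξ + spreadForm lam t (drift lam s ξ) = spreadForm lam (t + s) ξ := by
  simp only [spreadForm, drift_apply, spread_add _ s t]
  ring

theorem limitForm_drift {lam : ℝ} (hr : ∀ j, 0 < rate lam j) (s : ℝ) (ξ : Plane) :
    spreadForm lam s ξ + limitForm lam (drift lam s ξ) = limitForm lam ξ := by
  have h : ∀ j : Fin 2, ξ j ^ 2 * spread (rate lam j) s +
      (Real.exp (-rate lam j * s) * ξ j) ^ 2 * (2 * rate lam j)⁻¹ = ξ j ^ 2 * (2 * rate lam j)⁻¹ :=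
    fun j => by
      have := (hr j).ne'
      unfold spread
      rw [mul_pow, ← Real.exp_nat_mul,
        show ((2 : ℕ) : ℝ) * (-rate lam j * s) = -2 * rate lam j * s by push_cast; ring]
      field_simp
      ring
  simp only [spreadForm, limitForm, drift_apply]
  linarith [h 0, h 1]

theorem tendsto_exp_neg_mul {a : ℝ} (ha : 0 < a) :
    Tendsto (fun t => Real.exp (-a * t)) atTop (𝓝 0) := by
  refine Real.tendsto_exp_atBot.comp ?_
  exact tendsto_id.const_mul_atTop_of_neg (neg_lt_zero.2 ha)

theorem tendsto_drift {lam : ℝ} (hr : ∀ j, 0 < rate lam j) (ξ : Plane) :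
    Tendsto (fun t => drift lam t ξ) atTop (𝓝 0) := by
  have h : Tendsto (fun t => fun j => Real.exp (-rate lam j * t) * ξ j) atTop (𝓝 (0 : Fin 2 → ℝ)) := by
    refine tendsto_pi_nhds.2 fun j => ?_
    simpa using (tendsto_exp_neg_mul (hr j)).mul_const (ξ j)
  exact ((PiLp.continuous_toLp 2 (fun _ : Fin 2 => ℝ)).tendsto 0).comp h

theorem tendsto_spreadForm {lam : ℝ} (hr : ∀ j, 0 < rate lam j) (ξ : Plane) :
    Tendsto (fun t => spreadForm lam t ξ) atTop (𝓝 (limitForm lam ξ)) := by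
  have h : ∀ j, Tendsto (fun t => spread (rate lam j) t) atTop (𝓝 (2 * rate lam j)⁻¹) := fun j => by
    unfold spread
    have := ((tendsto_exp_neg_mul (a := 2 * rate lam j) (by linarith [hr j])).const_sub 1).div_const
      (2 * rate lam j)
    simpa [neg_mul] using this
  exact ((h 0).const_mul _).add ((h 1).const_mul _)

/-- The integrand of the Duhamel formula in Fourier variables. -/
def duhamel (lam : ℝ) (f : Plane → Fin 2 → ℝ) (ξ : Plane) (t : ℝ) : ℂ :=
  Real.exp (-spreadForm lam t ξ) *
    (I * ∑ j, (drift lam t ξ j : ℂ) * FT (fun x => f x j) (drift lam t ξ))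

theorem duhamel_drift (lam : ℝ) (f : Plane → Fin 2 → ℝ) (ξ : Plane) (s t : ℝ) :
    Real.exp (-spreadForm lam s ξ) * duhamel lam f (drift lam s ξ) t = duhamel lam f ξ (t + s) := by
  unfold duhamel
  rw [drift_drift, ← mul_assoc, ← ofReal_mul, ← Real.exp_add, ← neg_add, spreadForm_drift]

theorem continuous_duhamel {lam : ℝ} {f : Plane → Fin 2 → ℝ} (hf : ∀ j, Integrable fun x => f x j)
    (ξ : Plane) : Continuous (duhamel lam f ξ) := by
  have hc : Continuous fun r => drift lam r ξ :=
    (continuous_drift lam).comp (continuous_id.prodMk continuous_const)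
  have hs := continuous_spread
  have hF : ∀ j, Continuous fun t => FT (fun x => f x j) (drift lam t ξ) := fun j =>
    (continuous_FT (hf j)).comp hc
  have hd : ∀ j, Continuous fun t => (drift lam t ξ j : ℂ) := fun j => by
    simp only [drift_apply]
    fun_prop
  unfold duhamel spreadForm
  refine Continuous.mul ?_ (continuous_const.mul (continuous_finsetSum _ fun j _ => (hd j).mul (hF j)))
  have := hs (rate lam 0)
  have := hs (rate lam 1)
  fun_prop

theorem spreadForm_nonneg {lam t : ℝ} (hr : ∀ j, 0 < rate lam j) (ht : 0 < t) (ξ : Plane) :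
    0 ≤ spreadForm lam t ξ := by
  have h0 := spread_pos (hr 0) ht
  have h1 := spread_pos (hr 1) ht
  unfold spreadForm
  positivity

theorem integrableOn_duhamel {lam : ℝ} (hr : ∀ j, 0 < rate lam j) {f : Plane → Fin 2 → ℝ}
    (hf : ∀ j, Integrable fun x => f x j) (ξ : Plane) :
    IntegrableOn (duhamel lam f ξ) (Ioi 0) := by
  have hb : IntegrableOn (fun t => ∑ j, Real.exp (-rate lam j * t) *
      (|ξ j| * ∫ x, ‖f x j‖)) (Ioi 0) :=
    integrable_finsetSum _ fun j _ => (exp_neg_integrableOn_Ioi 0 (hr j)).mul_const _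
  refine hb.mono' (continuous_duhamel hf ξ).aestronglyMeasurable ?_
  refine (ae_restrict_iff' measurableSet_Ioi).2 (.of_forall fun t ht => ?_)
  unfold duhamel
  rw [norm_mul, norm_mul, norm_I, one_mul, norm_real, Real.norm_of_nonneg (Real.exp_pos _).le]
  refine (mul_le_of_le_one_left (norm_nonneg _) (Real.exp_le_one_iff.2 ?_)).trans
    ((norm_sum_le _ _).trans (Finset.sum_le_sum fun j _ => ?_))
  · linarith [spreadForm_nonneg hr ht ξ]
  · rw [norm_mul, norm_real, drift_apply, norm_mul, Real.norm_of_nonneg (Real.exp_pos _).le, mul_assoc]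
    have := norm_FT_le (fun x => f x j) (drift lam t ξ)
    rw [Real.norm_eq_abs]
    gcongr

/-- Along `drift lam t ξ` the equation is a linear ordinary differential equation. Multiplied by the
integrating factor it is integrated from time zero to infinity, where the characteristic reaches the
frequency zero and only the mass survives. -/
theorem Solves.FT_eq {lam : ℝ} (hr : ∀ j, rate lam j ∈ Ioc 0 1) {h : Plane → ℝ}
    {f : Plane → Fin 2 → ℝ} (hs : Solves lam h f) (hm : Integrable fun x => (1 + ‖x‖) * h x)
    (hf : ∀ j, Integrable fun x => f x j) (ξ : Plane) :
    FT h ξ = Real.exp (-limitForm lam ξ) * FT h 0 - ∫ t in Ioi 0, duhamel lam f ξ t := by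
  have hr' : ∀ j, 0 < rate lam j := fun j => (hr j).1
  have hd : ∀ t, HasDerivAt (fun t => (Real.exp (-spreadForm lam t ξ) : ℂ) * FT h (drift lam t ξ))
      (duhamel lam f ξ t) t := fun t => by
    have h1 := (((hasDerivAt_spreadForm hr' ξ t).neg.exp).ofReal_comp).mul
      (hasDerivAt_FT_drift (fun j => ⟨(hr j).1.le, (hr j).2⟩) hm ξ t)
    refine h1.congr_deriv ?_
    rw [hs (drift lam t ξ)]
    unfold duhamel
    simp only [Pi.neg_apply]
    push_cast
    ring
  have hl : Tendsto (fun t => (Real.exp (-spreadForm lam t ξ) : ℂ) * FT h (drift lam t ξ)) atTop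
      (𝓝 (Real.exp (-limitForm lam ξ) * FT h 0)) := by
    refine Tendsto.mul ?_ (((continuous_FT (integrable_of_moment hm)).tendsto 0).comp
      (tendsto_drift hr' ξ))
    exact (continuous_ofReal.tendsto _).comp
      ((Real.continuous_exp.tendsto _).comp (tendsto_spreadForm hr' ξ).neg)
  have := integral_Ioi_of_hasDerivAt_of_tendsto' (a := 0) (fun t _ => hd t)
    (integrableOn_duhamel hr' hf ξ) hl
  rw [this]
  simp [spreadForm, spread]

/-- The formula is propagated along the characteristic by `duhamel_drift` and `limitForm_drift`.
Differentiating it at time zero in two ways gives the equation at `ξ`. -/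
theorem solves_of_FT_eq {lam : ℝ} (hr : ∀ j, rate lam j ∈ Ioc 0 1) {h : Plane → ℝ}
    {f : Plane → Fin 2 → ℝ} (c : ℂ) (hm : Integrable fun x => (1 + ‖x‖) * h x)
    (hf : ∀ j, Integrable fun x => f x j)
    (he : ∀ ξ, FT h ξ = Real.exp (-limitForm lam ξ) * c - ∫ t in Ioi 0, duhamel lam f ξ t) :
    Solves lam h f := by
  intro ξ
  have hr' : ∀ j, 0 < rate lam j := fun j => (hr j).1
  have hc := continuous_duhamel (lam := lam) hf ξ
  have hsh : ∀ s, (Real.exp (-spreadForm lam s ξ) : ℂ) * FT h (drift lam s ξ) =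
      Real.exp (-limitForm lam ξ) * c - (∫ t in Ioi 0, duhamel lam f ξ t) +
        ∫ t in (0 : ℝ)..s, duhamel lam f ξ t := fun s => by
    have e1 : (Real.exp (-spreadForm lam s ξ) : ℂ) * ∫ t in Ioi 0, duhamel lam f (drift lam s ξ) t =
        ∫ t in Ioi s, duhamel lam f ξ t := by
      rw [← integral_const_mul]
      simp only [duhamel_drift]
      have := (measurePreserving_add_right (volume : Measure ℝ) s).setIntegral_preimage_emb
        (MeasurableEquiv.addRight s).measurableEmbedding (duhamel lam f ξ) (Ioi s)
      rw [← this]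
      simp
    have hi : IntegrableOn (duhamel lam f ξ) (Ioi s) := by
      refine ((hc.integrableOn_Icc (a := s) (b := 0)).union (integrableOn_duhamel hr' hf ξ)).mono_set
        fun t ht => ?_
      rcases le_or_gt t 0 with h0 | h0
      exacts [Or.inl ⟨le_of_lt ht, h0⟩, Or.inr h0]
    have e2 := intervalIntegral.integral_interval_add_Ioi (integrableOn_duhamel hr' hf ξ) hi
    rw [he, mul_sub, e1, ← mul_assoc, ← ofReal_mul, ← Real.exp_add, ← neg_add,
      limitForm_drift hr', ← e2]
    ring
  have hd1 := (((hasDerivAt_spreadForm hr' ξ 0).neg.exp).ofReal_comp).mul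
      (hasDerivAt_FT_drift (fun j => ⟨(hr j).1.le, (hr j).2⟩) hm ξ 0)
  have hd2 : HasDerivAt (fun s => (Real.exp (-spreadForm lam s ξ) : ℂ) * FT h (drift lam s ξ))
      (duhamel lam f ξ 0) 0 := by
    simp only [hsh]
    exact (intervalIntegral.integral_hasDerivAt_right (hc.intervalIntegrable _ _)
      hc.stronglyMeasurable.stronglyMeasurableAtFilter hc.continuousAt).const_add _
  have := hd1.unique hd2
  simp [duhamel, spreadForm, spread] at this
  rw [Fin.sum_univ_two, ← this]
  push_cast
  ring

theorem integrable_heatDeriv {lam t : ℝ} (hr : ∀ j, 0 < rate lam j) (ht : 0 < t) (j : Fin 2) :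
    Integrable (heatDeriv lam j t) := by
  have hs := fun j => spread_pos (hr j) ht
  have h0 := fun j => integrable_heat (hs j)
  have h1 := fun j => (integrable_mul_heat (hs j)).const_mul (-(1 / (2 * spread (rate lam j) t)))
  fin_cases j
  · refine (integrable_plane_mul (h1 0) (h0 1)).congr (.of_forall fun y => ?_)
    simp only [heatDeriv, Fin.zero_eta]
    ring
  · refine (integrable_plane_mul (h0 0) (h1 1)).congr (.of_forall fun y => ?_)
    simp only [heatDeriv, Fin.mk_one]
    ring

/-- Tonelli and the `L¹` bound for `absInvDiv`. This joint integrability justifies the exchanges of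
integrals in `FT_invDiv` and the almost everywhere convergence of `invDiv`. -/
theorem integrable_mehler_mul {lam δ : ℝ} (hδ : 0 < δ) (hr : ∀ j, rate lam j ∈ Icc δ 1)
    {f : Plane → Fin 2 → ℝ} (hf : ∀ j, Integrable fun x => f x j) :
    Integrable (fun q : (ℝ × Plane) × Plane => ∑ j, mehler lam j q.1.1 q.2 q.1.2 * f q.1.2 j)
      (((volume.restrict (Ioi (0 : ℝ))).prod volume).prod volume) := by
  set ν : Measure (ℝ × Plane) := (volume.restrict (Ioi (0 : ℝ))).prod volume
  have hmf : AEStronglyMeasurable (fun q : (ℝ × Plane) × Plane =>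
      ∑ j, mehler lam j q.1.1 q.2 q.1.2 * f q.1.2 j) (ν.prod volume) :=
    Finset.aestronglyMeasurable_fun_sum _ fun j _ =>
      (measurable_mehler lam j).aestronglyMeasurable.mul
        (((hf j).aestronglyMeasurable.comp_snd).comp_fst)
  refine ⟨hmf, ?_⟩
  obtain ⟨C, hC, hb⟩ := lintegral_absInvDiv_le hδ
  have h1 := hb lam hr f fun j => (hf j).aestronglyMeasurable.aemeasurable
  have h2 : ∫⁻ z, ∑ j, ‖f z j‖ₑ < ⊤ := by
    rw [lintegral_finsetSum' _ fun j _ => (hf j).aestronglyMeasurable.enorm]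
    exact ENNReal.sum_lt_top.2 fun j _ => (hf j).hasFiniteIntegral
  refine lt_of_le_of_lt ?_ (h1.trans_lt (ENNReal.mul_lt_top hC.lt_top h2))
  rw [lintegral_prod_symm _ hmf.enorm]
  rfl

theorem integrable_invDiv {lam δ : ℝ} (hδ : 0 < δ) (hr : ∀ j, rate lam j ∈ Icc δ 1)
    {f : Plane → Fin 2 → ℝ} (hf : ∀ j, Integrable fun x => f x j) : Integrable (invDiv lam f) :=
  (integrable_mehler_mul hδ hr hf).integral_prod_right.neg

/-- Fubini's theorem for the Fourier transform of `L⁻¹ div f`. -/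
theorem FT_invDiv {lam δ : ℝ} (hδ : 0 < δ) (hr : ∀ j, rate lam j ∈ Icc δ 1)
    {f : Plane → Fin 2 → ℝ} (hf : ∀ j, Integrable fun x => f x j) (ξ : Plane) :
    FT (invDiv lam f) ξ = -∫ t in Ioi 0, duhamel lam f ξ t := by
  have hr' : ∀ j, 0 < rate lam j := fun j => hδ.trans_le (hr j).1
  set ν : Measure (ℝ × Plane) := (volume.restrict (Ioi (0 : ℝ))).prod volume
  have hint := integrable_mehler_mul hδ hr hf
  have hint2 : Integrable (fun q : (ℝ × Plane) × Plane =>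
      ((∑ j, mehler lam j q.1.1 q.2 q.1.2 * f q.1.2 j : ℝ) : ℂ) * wave ξ q.2) (ν.prod volume) :=
    hint.ofReal.mul_bdd (c := 1)
      ((continuous_wave_left ξ).comp continuous_snd).aestronglyMeasurable
      (.of_forall fun q => (norm_wave ξ q.2).le)
  have e1 : FT (invDiv lam f) ξ = -∫ x, ∫ p, ((∑ j, mehler lam j p.1 x p.2 * f p.2 j : ℝ) : ℂ) *
      wave ξ x ∂ν := by
    rw [← integral_neg]
    refine integral_congr_ae (.of_forall fun x => ?_)
    simp only [invDiv]
    rw [integral_mul_const, ofReal_neg, neg_mul]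
    congr 2
    exact integral_ofReal.symm
  have e2 : ∀ p : ℝ × Plane, 0 < p.1 → ∫ x, ((∑ j, mehler lam j p.1 x p.2 * f p.2 j : ℝ) : ℂ) *
      wave ξ x = ∑ j, (Real.exp (-spreadForm lam p.1 ξ) * (I * drift lam p.1 ξ j)) *
        ((f p.2 j : ℂ) * wave (drift lam p.1 ξ) p.2) := fun p hp => by
    have hi : ∀ j, Integrable fun x : Plane => (heatDeriv lam j p.1 (x - drift lam p.1 p.2) : ℂ) *
        wave ξ (x - drift lam p.1 p.2) := fun j =>
      (integrable_mul_wave (integrable_heatDeriv hr' hp j) ξ).comp_sub_right _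
    have e3 : ∀ x, ((∑ j, mehler lam j p.1 x p.2 * f p.2 j : ℝ) : ℂ) * wave ξ x =
        ∑ j, (Real.exp (-rate lam j * p.1) * f p.2 j * wave (drift lam p.1 ξ) p.2) *
          ((heatDeriv lam j p.1 (x - drift lam p.1 p.2) : ℂ) * wave ξ (x - drift lam p.1 p.2)) :=
      fun x => by
        have := wave_add ξ (x - drift lam p.1 p.2) (drift lam p.1 p.2)
        rw [sub_add_cancel, wave_drift] at this
        rw [this, ofReal_sum, Finset.sum_mul]
        refine Finset.sum_congr rfl fun j _ => ?_
        unfold mehler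
        push_cast
        ring
    simp only [e3]
    rw [integral_finsetSum _ fun j _ => (hi j).const_mul _]
    refine Finset.sum_congr rfl fun j _ => ?_
    rw [integral_const_mul,
      integral_sub_right_eq_self fun x => (heatDeriv lam j p.1 x : ℂ) * wave ξ x,
      integral_heatDeriv_wave hr' hp, drift_apply]
    push_cast
    ring
  have e4 : (fun p => ∫ x, ((∑ j, mehler lam j p.1 x p.2 * f p.2 j : ℝ) : ℂ) * wave ξ x) =ᵐ[ν]
      fun p => ∑ j, (Real.exp (-spreadForm lam p.1 ξ) * (I * drift lam p.1 ξ j)) *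
        ((f p.2 j : ℂ) * wave (drift lam p.1 ξ) p.2) := by
    have : ∀ᵐ p ∂ν, p.1 ∈ Ioi (0 : ℝ) :=
      Measure.quasiMeasurePreserving_fst.ae (ae_restrict_mem measurableSet_Ioi)
    filter_upwards [this] with p hp using e2 p hp
  rw [e1, ← integral_integral_swap hint2, integral_congr_ae e4,
    integral_prod _ (hint2.integral_prod_left.congr e4)]
  congr 1
  refine integral_congr_ae (.of_forall fun t => ?_)
  simp only
  rw [integral_finsetSum _ fun j _ => (integrable_mul_wave (hf j) _).const_mul _]
  unfold duhamel
  simp only [integral_const_mul, Finset.mul_sum]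
  refine Finset.sum_congr rfl fun j _ => ?_
  unfold FT
  ring

theorem limitForm_zero (lam : ℝ) : limitForm lam 0 = 0 := by simp [limitForm]

theorem duhamel_zero (lam : ℝ) (f : Plane → Fin 2 → ℝ) (t : ℝ) : duhamel lam f 0 t = 0 := by
  simp [duhamel]

theorem rate_bounds {lam δ : ℝ} (hδ : 0 < δ) (hr : ∀ j, rate lam j ∈ Icc δ 1) (j : Fin 2) :
    rate lam j ∈ Ioc 0 1 := ⟨hδ.trans_le (hr j).1, (hr j).2⟩

/-- Both sides have the same Fourier transform. In particular the kernel of `L`, among functions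
with a first moment, is spanned by the Gaussian vortex. -/
theorem Solves.ae_eq {lam δ : ℝ} (hδ : 0 < δ) (hr : ∀ j, rate lam j ∈ Icc δ 1) {h : Plane → ℝ}
    {f : Plane → Fin 2 → ℝ} (hs : Solves lam h f) (hm : Integrable fun x => (1 + ‖x‖) * h x)
    (hf : ∀ j, Integrable fun x => f x j) :
    h =ᵐ[volume] fun x => (∫ y, h y) * gaussianVortex lam x + invDiv lam f x := by
  have hi := integrable_invDiv hδ hr hf
  have hG := (integrable_gaussianVortex fun j => (rate_bounds hδ hr j).1).const_mul (∫ y, h y)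
  have := ae_eq_zero_of_FT_eq_zero (((integrable_of_moment hm).sub hG).sub hi) fun ξ => by
    have e : FT ((h - fun x => (∫ y, h y) * gaussianVortex lam x) - invDiv lam f) ξ =
        FT h ξ - (∫ y, h y : ℝ) * FT (gaussianVortex lam) ξ - FT (invDiv lam f) ξ := by
      unfold FT
      rw [← integral_const_mul, ← integral_sub (integrable_mul_wave (integrable_of_moment hm) ξ)
        ((integrable_mul_wave (integrable_gaussianVortex fun j => (rate_bounds hδ hr j).1) ξ).const_mul _),
        ← integral_sub _ (integrable_mul_wave hi ξ)]
      · refine integral_congr_ae (.of_forall fun x => ?_)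
        simp only [Pi.sub_apply]
        push_cast
        ring
      · exact (integrable_mul_wave (integrable_of_moment hm) ξ).sub
          ((integrable_mul_wave (integrable_gaussianVortex fun j => (rate_bounds hδ hr j).1) ξ).const_mul _)
    rw [e, hs.FT_eq (rate_bounds hδ hr) hm hf, FT_invDiv hδ hr hf,
      FT_gaussianVortex fun j => (rate_bounds hδ hr j).1, FT_zero]
    ring
  filter_upwards [this] with x hx
  simp only [Pi.sub_apply, Pi.zero_apply] at hx
  linarith

theorem solves_invDiv {lam δ : ℝ} (hδ : 0 < δ) (hr : ∀ j, rate lam j ∈ Icc δ 1)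
    {f : Plane → Fin 2 → ℝ} (hf : ∀ j, Integrable fun x => f x j)
    (hm : Integrable fun x => (1 + ‖x‖) * invDiv lam f x) : Solves lam (invDiv lam f) f :=
  solves_of_FT_eq (rate_bounds hδ hr) 0 hm hf fun ξ => by
    rw [FT_invDiv hδ hr hf]
    simp

/-- The Duhamel integrand vanishes at frequency zero; all circulation of a vortex is carried by the
Gaussian term. -/
theorem integral_invDiv {lam δ : ℝ} (hδ : 0 < δ) (hr : ∀ j, rate lam j ∈ Icc δ 1)
    {f : Plane → Fin 2 → ℝ} (hf : ∀ j, Integrable fun x => f x j) : ∫ x, invDiv lam f x = 0 := by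
  have := FT_zero (invDiv lam f)
  rw [FT_invDiv hδ hr hf] at this
  simpa [duhamel_zero] using this.symm

theorem integral_gaussianVortex {lam : ℝ} (hr : ∀ j, 0 < rate lam j) :
    ∫ x, gaussianVortex lam x = 1 := by
  have := FT_zero (gaussianVortex lam)
  rw [FT_gaussianVortex hr, limitForm_zero] at this
  simpa using (Complex.ofReal_injective this).symm

theorem solves_gaussianVortex {lam : ℝ} (hr : ∀ j, rate lam j ∈ Ioc 0 1)
    (hm : Integrable fun x => (1 + ‖x‖) * gaussianVortex lam x) :
    Solves lam (gaussianVortex lam) 0 :=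
  solves_of_FT_eq hr 1 hm (fun j => integrable_zero _ _ _) fun ξ => by
    rw [FT_gaussianVortex fun j => (hr j).1]
    simp [duhamel, FT]

theorem Solves.congr {lam : ℝ} {h h' : Plane → ℝ} {f : Plane → Fin 2 → ℝ} (hs : Solves lam h f)
    (e : h =ᵐ[volume] h') : Solves lam h' f := fun ξ => by
  rw [← FT_congr e, ← hs ξ]
  exact integral_congr_ae (e.mono fun x hx => by simp only [hx])

theorem Solves.lin {lam : ℝ} (hr : ∀ j, rate lam j ∈ Icc 0 1) {h h' : Plane → ℝ}
    {f f' : Plane → Fin 2 → ℝ}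
    (hs : Solves lam h f) (hs' : Solves lam h' f') (c : ℝ)
    (hm : Integrable fun x => (1 + ‖x‖) * h x) (hm' : Integrable fun x => (1 + ‖x‖) * h' x)
    (hf : ∀ j, Integrable fun x => f x j) (hf' : ∀ j, Integrable fun x => f' x j) :
    Solves lam (fun x => h x + c * h' x) (fun x j => f x j + c * f' x j) := fun ξ => by
  have hF : ∀ {g g' : Plane → ℝ}, Integrable g → Integrable g' →
      FT (fun x => g x + c * g' x) ξ = FT g ξ + c * FT g' ξ := fun {g g'} hg hg' => by
    unfold FT
    rw [← integral_const_mul, ← integral_add (integrable_mul_wave hg ξ)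
      ((integrable_mul_wave hg' ξ).const_mul _)]
    refine integral_congr_ae (.of_forall fun x => ?_)
    simp only
    push_cast
    ring
  have e : ∫ x, ((h x + c * h' x : ℝ) : ℂ) * (I * driftSymbol lam ξ x) * wave ξ x =
      (∫ x, (h x : ℂ) * (I * driftSymbol lam ξ x) * wave ξ x) +
        c * ∫ x, (h' x : ℂ) * (I * driftSymbol lam ξ x) * wave ξ x := by
    rw [← integral_const_mul, ← integral_add (integrable_mul_driftSymbol hr hm ξ ξ)
      ((integrable_mul_driftSymbol hr hm' ξ ξ).const_mul _)]
    refine integral_congr_ae (.of_forall fun x => ?_)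
    simp only
    push_cast
    ring
  rw [e, hs ξ, hs' ξ, hF (integrable_of_moment hm) (integrable_of_moment hm')]
  simp only [hF (hf _) (hf' _), Fin.sum_univ_two]
  ring

theorem integrable_shear {h : Plane → ℝ} (hm : Integrable fun x => (1 + ‖x‖) * h x) (j : Fin 2) :
    Integrable fun x => shear h x j := by
  refine hm.mono (aestronglyMeasurable_shear (integrable_of_moment hm).aestronglyMeasurable j)
    (.of_forall fun x => ?_)
  rw [shear, norm_mul, norm_mul, Real.norm_of_nonneg (by positivity : 0 ≤ 1 + ‖x‖)]
  refine mul_le_mul_of_nonneg_right ?_ (norm_nonneg _)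
  have h0 := abs_le_norm x 0
  have h1 := abs_le_norm x 1
  have := norm_nonneg x
  fin_cases j
  · simp
    linarith
  · simp
    linarith

/-- The equation depends on the asymmetry through the strain `shear`. -/
theorem Solves.change_rate {lam mu : ℝ} (hr : ∀ j, rate lam j ∈ Icc 0 1) {h : Plane → ℝ}
    {f : Plane → Fin 2 → ℝ} (hs : Solves lam h f) (hm : Integrable fun x => (1 + ‖x‖) * h x)
    (hf : ∀ j, Integrable fun x => f x j) :
    Solves mu h (fun x j => f x j + (mu - lam) * shear h x j) := fun ξ => by
  have hF : ∀ j, FT (fun x => f x j + (mu - lam) * shear h x j) ξ =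
      FT (fun x => f x j) ξ + (mu - lam : ℝ) * FT (fun x => shear h x j) ξ := fun j => by
    unfold FT
    rw [← integral_const_mul, ← integral_add (integrable_mul_wave (hf j) ξ)
      ((integrable_mul_wave (integrable_shear hm j) ξ).const_mul _)]
    refine integral_congr_ae (.of_forall fun x => ?_)
    simp only
    push_cast
    ring
  have e : ∫ x, (h x : ℂ) * (I * driftSymbol mu ξ x) * wave ξ x =
      (∫ x, (h x : ℂ) * (I * driftSymbol lam ξ x) * wave ξ x) +
        I * (mu - lam : ℝ) * ∑ j, (ξ j : ℂ) * FT (fun x => shear h x j) ξ := by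
    unfold FT
    simp only [← integral_const_mul]
    rw [← integral_finsetSum _ fun j _ => ((integrable_mul_wave (integrable_shear hm j) ξ).const_mul _),
      ← integral_const_mul, ← integral_add (integrable_mul_driftSymbol hr hm ξ ξ)
      ((integrable_finsetSum _ fun j _ =>
        ((integrable_mul_wave (integrable_shear hm j) ξ).const_mul _)).const_mul _)]
    refine integral_congr_ae (.of_forall fun x => ?_)
    simp [Fin.sum_univ_two, driftSymbol, rate, shear]
    ring
  rw [e, hs ξ]
  simp only [hF, Fin.sum_univ_two]
  ring

end BurgersVortex

end


/-! ### Equivalence of the Fourier and the distributional forms of the planar equation. -/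

noncomputable section

namespace BurgersVortex

open Filter Topology Complex FourierTransform LineDeriv
open scoped SchwartzMap

/-! ### The weak formulation of the equation on the plane -/

/-- The partial derivative of a function on the plane. -/
def pd (j : Fin 2) (ψ : Plane → ℝ) (x : Plane) : ℝ := fderiv ℝ ψ x (EuclideanSpace.single j 1)

/-- `fⱼ - αⱼ xⱼ h`. -/
def totalFlux (lam : ℝ) (h : Plane → ℝ) (f : Plane → Fin 2 → ℝ) (x : Plane) (j : Fin 2) : ℝ :=
  f x j - rate lam j * x j * h x

/-- The integrand of the weak formulation. -/
def weakIntegrand (lam : ℝ) (h : Plane → ℝ) (f : Plane → Fin 2 → ℝ) (ψ : Plane → ℝ) (x : Plane) : ℝ :=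
  (∑ j, totalFlux lam h f x j * pd j ψ x) + h x * ∑ j, pd j (pd j ψ) x

theorem integrable_coord_mul {h : Plane → ℝ} (hm : Integrable fun x => (1 + ‖x‖) * h x) (j : Fin 2) :
    Integrable fun x => x j * h x := by
  have hc : AEStronglyMeasurable (fun x : Plane => x j) :=
    Continuous.aestronglyMeasurable (by fun_prop)
  refine hm.mono (hc.mul (integrable_of_moment hm).aestronglyMeasurable) (.of_forall fun x => ?_)
  rw [norm_mul, norm_mul, Real.norm_of_nonneg (by positivity : 0 ≤ 1 + ‖x‖)]
  refine mul_le_mul_of_nonneg_right ?_ (norm_nonneg _)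
  have := abs_le_norm x j
  rw [Real.norm_eq_abs]
  linarith

theorem integrable_totalFlux {lam : ℝ} {h : Plane → ℝ} {f : Plane → Fin 2 → ℝ}
    (hm : Integrable fun x => (1 + ‖x‖) * h x) (hf : ∀ j, Integrable fun x => f x j) (j : Fin 2) :
    Integrable fun x => totalFlux lam h f x j := by
  refine ((hf j).sub ((integrable_coord_mul hm j).const_mul (rate lam j))).congr
    (.of_forall fun x => ?_)
  simp [totalFlux, mul_assoc]

/-- Parseval's formula with the transform moved onto `k`. The factor `2π` reconciles the character
`exp (-2π i x·ξ)` with `wave`. -/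
theorem integral_mul_schwartz {k : Plane → ℝ} (hk : Integrable k) (Ψ : 𝓢(Plane, ℂ)) :
    ∫ x, (k x : ℂ) * Ψ x = ∫ ξ, FT k ((2 * Real.pi) • ξ) * (𝓕⁻ Ψ) ξ := by
  have h := VectorFourier.integral_fourierIntegral_smul_eq_flip (L := innerₗ Plane)
    (μ := (volume : Measure Plane)) (ν := (volume : Measure Plane)) (f := fun x => (k x : ℂ))
    (g := (𝓕⁻ Ψ : 𝓢(Plane, ℂ))) Real.continuous_fourierChar continuous_inner hk.ofReal
    (𝓕⁻ Ψ : 𝓢(Plane, ℂ)).integrable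
  have e1 : ∀ x, VectorFourier.fourierIntegral Real.fourierChar volume (innerₗ Plane).flip
      (𝓕⁻ Ψ : 𝓢(Plane, ℂ)) x = Ψ x := fun x => by
    rw [flip_innerₗ]
    change 𝓕 ((𝓕⁻ Ψ : 𝓢(Plane, ℂ)) : Plane → ℂ) x = Ψ x
    rw [← SchwartzMap.fourier_coe, FourierTransform.fourier_fourierInv_eq]
  have e2 : ∀ ξ, VectorFourier.fourierIntegral Real.fourierChar volume (innerₗ Plane)
      (fun x => (k x : ℂ)) ξ = FT k ((2 * Real.pi) • ξ) := fun ξ => by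
    change 𝓕 (fun x => (k x : ℂ)) ξ = _
    rw [Real.fourier_eq']
    unfold FT wave
    refine integral_congr_ae (.of_forall fun x => ?_)
    simp only [smul_eq_mul]
    rw [mul_comm]
    congr 2
    simp [PiLp.inner_apply, Fin.sum_univ_two]
    ring
  simp only [e1, e2, smul_eq_mul] at h
  exact h.symm

theorem integrable_FT_mul_schwartz {k : Plane → ℝ} (hk : Integrable k) (Φ : 𝓢(Plane, ℂ)) :
    Integrable fun ξ => FT k ((2 * Real.pi) • ξ) * Φ ξ :=
  Φ.integrable.bdd_mul ((continuous_FT hk).comp (by fun_prop)).aestronglyMeasurable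
    (.of_forall fun ξ => norm_FT_le k _)

theorem fourierInv_lineDeriv_apply (Ψ : 𝓢(Plane, ℂ)) (j : Fin 2) (ξ : Plane) :
    (𝓕⁻ (∂_{(EuclideanSpace.single j 1 : Plane)} Ψ)) ξ = -(2 * Real.pi * I * ξ j) * (𝓕⁻ Ψ) ξ := by
  rw [SchwartzMap.fourierInv_lineDerivOp_eq]
  have : (inner ℝ · (EuclideanSpace.single j 1 : Plane)).HasTemperateGrowth := by fun_prop
  have e : inner ℝ ξ (EuclideanSpace.single j 1 : Plane) = ξ j := by
    simp [EuclideanSpace.inner_single_right]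
  simp only [smul_apply, SchwartzMap.smulLeftCLM_apply_apply this, e]
  simp
  ring

theorem contDiff_pd {ψ : Plane → ℝ} (hψ : ContDiff ℝ ∞ ψ) (j : Fin 2) : ContDiff ℝ ∞ (pd j ψ) :=
  (hψ.fderiv_right (m := ∞) (by simp)).clm_apply contDiff_const

theorem hasCompactSupport_pd {ψ : Plane → ℝ} (hψ : HasCompactSupport ψ) (j : Fin 2) :
    HasCompactSupport (pd j ψ) := hψ.fderiv_apply (𝕜 := ℝ) _

/-- A real test function as a complex Schwartz function. -/
def complexTest (ψ : Plane → ℝ) (h : ContDiff ℝ ∞ ψ) (hc : HasCompactSupport ψ) : 𝓢(Plane, ℂ) :=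
  HasCompactSupport.toSchwartzMap (f := fun x => (ψ x : ℂ)) (hc.comp_left ofReal_zero)
    (ofRealCLM.contDiff.comp h)

theorem lineDeriv_complexTest {ψ : Plane → ℝ} (h : ContDiff ℝ ∞ ψ) (hc : HasCompactSupport ψ)
    (j : Fin 2) : ∂_{(EuclideanSpace.single j 1 : Plane)} (complexTest ψ h hc) =
      complexTest (pd j ψ) (contDiff_pd h j) (hasCompactSupport_pd hc j) := by
  ext x
  rw [SchwartzMap.lineDerivOp_apply_eq_fderiv]
  have h1 : HasFDerivAt ψ (fderiv ℝ ψ x) x := (h.differentiable (by simp) x).hasFDerivAt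
  have h2 : HasFDerivAt (complexTest ψ h hc) (ofRealCLM.comp (fderiv ℝ ψ x)) x :=
    ofRealCLM.hasFDerivAt.comp x h1
  rw [h2.fderiv]
  rfl

/-- After Parseval each derivative of the test function is a factor `-2π i ξⱼ`, and the integrand
vanishes pointwise: it is the equation at the frequency `2πξ` times the inverse transform of the
test function. -/
theorem Solves.weak {lam : ℝ} {h : Plane → ℝ}
    {f : Plane → Fin 2 → ℝ} (hs : Solves lam h f) (hm : Integrable fun x => (1 + ‖x‖) * h x)
    (hf : ∀ j, Integrable fun x => f x j) {ψ : Plane → ℝ} (hψ : ContDiff ℝ ∞ ψ)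
    (hc : HasCompactSupport ψ) : ∫ x, weakIntegrand lam h f ψ x = 0 := by
  have hh := integrable_of_moment hm
  set Ψ := complexTest ψ hψ hc
  set e : Fin 2 → Plane := fun j => EuclideanSpace.single j 1
  have hd : ∀ j x, (∂_{e j} Ψ) x = (pd j ψ x : ℂ) := fun j x => by
    rw [lineDeriv_complexTest]
    rfl
  have hdd : ∀ j x, (∂_{e j} (∂_{e j} Ψ)) x = (pd j (pd j ψ) x : ℂ) := fun j x => by
    rw [lineDeriv_complexTest, lineDeriv_complexTest]
    rfl
  have hk := fun j => integrable_totalFlux (lam := lam) hm hf j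
  have hb : ∀ {k : Plane → ℝ} (_ : Integrable k) (Φ : 𝓢(Plane, ℂ)),
      Integrable fun x => (k x : ℂ) * Φ x := fun {k} hk Φ =>
    hk.ofReal.mul_bdd (c := ‖Φ.toBoundedContinuousFunction‖) Φ.continuous.aestronglyMeasurable
      (.of_forall fun x => Φ.toBoundedContinuousFunction.norm_coe_le_norm x)
  have key : ∫ x, ((weakIntegrand lam h f ψ x : ℝ) : ℂ) = 0 := by
    calc _ = ∫ x, ((∑ j, (totalFlux lam h f x j : ℂ) * (∂_{e j} Ψ) x) +
          ∑ j, (h x : ℂ) * (∂_{e j} (∂_{e j} Ψ)) x) := by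
          refine integral_congr_ae (.of_forall fun x => ?_)
          simp only [weakIntegrand, hd, hdd, Finset.mul_sum]
          push_cast
          rfl
      _ = (∑ j, ∫ ξ, FT (fun x => totalFlux lam h f x j) ((2 * Real.pi) • ξ) * (𝓕⁻ (∂_{e j} Ψ)) ξ) +
          ∑ j, ∫ ξ, FT h ((2 * Real.pi) • ξ) * (𝓕⁻ (∂_{e j} (∂_{e j} Ψ))) ξ := by
          rw [integral_add (integrable_finsetSum _ fun j _ => hb (hk j) _)
            (integrable_finsetSum _ fun j _ => hb hh _),
            integral_finsetSum _ fun j _ => hb (hk j) _, integral_finsetSum _ fun j _ => hb hh _]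
          simp only [integral_mul_schwartz (hk _), integral_mul_schwartz hh]
      _ = ∫ ξ, ((∑ j, FT (fun x => totalFlux lam h f x j) ((2 * Real.pi) • ξ) * (𝓕⁻ (∂_{e j} Ψ)) ξ) +
          ∑ j, FT h ((2 * Real.pi) • ξ) * (𝓕⁻ (∂_{e j} (∂_{e j} Ψ))) ξ) := by
          rw [integral_add (integrable_finsetSum _ fun j _ => integrable_FT_mul_schwartz (hk j) _)
            (integrable_finsetSum _ fun j _ => integrable_FT_mul_schwartz hh _),
            integral_finsetSum _ fun j _ => integrable_FT_mul_schwartz (hk j) _,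
            integral_finsetSum _ fun j _ => integrable_FT_mul_schwartz hh _]
      _ = ∫ ξ : Plane, (0 : ℂ) := by
          refine integral_congr_ae (.of_forall fun ξ => ?_)
          simp only [e, fourierInv_lineDeriv_apply]
          set η : Plane := (2 * Real.pi) • ξ with hη
          have hη' : ∀ j, (η j : ℂ) = 2 * Real.pi * ξ j := fun j => by simp [hη]
          have e1 : ∀ j, FT (fun x => totalFlux lam h f x j) η =
              FT (fun x => f x j) η - ∫ x, (rate lam j * x j * h x : ℝ) * wave η x := fun j => by
            unfold FT
            rw [← integral_sub (integrable_mul_wave (hf j) η)]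
            · refine integral_congr_ae (.of_forall fun x => ?_)
              simp only [totalFlux]
              push_cast
              ring
            · exact integrable_mul_wave (((integrable_coord_mul hm j).const_mul (rate lam j)).congr
                (.of_forall fun x => by simp only [mul_assoc])) η
          have e2 : ∫ x, (h x : ℂ) * (I * driftSymbol lam η x) * wave η x =
              ∑ j, I * η j * ∫ x, (rate lam j * x j * h x : ℝ) * wave η x := by
            simp only [← integral_const_mul]
            rw [← integral_finsetSum _ fun j _ => (integrable_mul_wave
              (((integrable_coord_mul hm j).const_mul (rate lam j)).congr
                (.of_forall fun x => by simp only [mul_assoc])) η).const_mul _]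
            refine integral_congr_ae (.of_forall fun x => ?_)
            simp only [driftSymbol, Fin.sum_univ_two]
            push_cast
            ring
          have e3 := hs η
          rw [e2] at e3
          simp only [Fin.sum_univ_two, hη'] at e3
          simp only [Fin.sum_univ_two, e1]
          have e4 : ((η 0 ^ 2 + η 1 ^ 2 : ℝ) : ℂ) = (2 * Real.pi * ξ 0) ^ 2 + (2 * Real.pi * ξ 1) ^ 2 := by
            push_cast
            rw [hη', hη']
          rw [e4] at e3
          linear_combination (𝓕⁻ Ψ) ξ * e3 + (𝓕⁻ Ψ) ξ * FT h η *
            ((2 * Real.pi * ξ 0) ^ 2 + (2 * Real.pi * ξ 1) ^ 2) * (I_sq)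
      _ = 0 := by simp
  have := key
  rw [integral_complex_ofReal] at this
  exact_mod_cast this

/-! ### Bounded test functions -/

theorem pd_mul {a b : Plane → ℝ} (ha : ContDiff ℝ ∞ a) (hb : ContDiff ℝ ∞ b) (j : Fin 2) :
    pd j (fun x => a x * b x) = fun x => a x * pd j b x + pd j a x * b x := by
  funext x
  unfold pd
  rw [fderiv_fun_mul (ha.differentiable (by simp) x) (hb.differentiable (by simp) x)]
  simp [mul_comm]

theorem pd_add {a b : Plane → ℝ} (ha : ContDiff ℝ ∞ a) (hb : ContDiff ℝ ∞ b) (j : Fin 2) :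
    pd j (fun x => a x + b x) = fun x => pd j a x + pd j b x := by
  funext x
  unfold pd
  rw [fderiv_fun_add (ha.differentiable (by simp) x) (hb.differentiable (by simp) x)]
  simp

theorem pd_congr {a b : Plane → ℝ} {U : Set Plane} (hU : IsOpen U) (h : ∀ x ∈ U, a x = b x)
    (j : Fin 2) : ∀ x ∈ U, pd j a x = pd j b x := fun x hx => by
  have : a =ᶠ[𝓝 x] b := by filter_upwards [hU.mem_nhds hx] with y hy using h y hy
  unfold pd
  rw [this.fderiv_eq]

theorem pd_comp_smul {a : Plane → ℝ} (c : ℝ) (j : Fin 2) :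
    pd j (fun x => a (c • x)) = fun x => c * pd j a (c • x) := by
  funext x
  unfold pd
  rw [fderiv_comp_smul]
  rfl

theorem pd_const_mul {a : Plane → ℝ} (ha : ContDiff ℝ ∞ a) (c : ℝ) (j : Fin 2) :
    pd j (fun x => c * a x) = fun x => c * pd j a x := by
  funext x
  unfold pd
  rw [fderiv_const_mul (ha.differentiable (by simp) x)]
  rfl

/-- The equation may be tested with smooth functions with bounded derivatives. -/
theorem integral_weakIntegrand_of_bounded {lam : ℝ} {h : Plane → ℝ}
    {f : Plane → Fin 2 → ℝ} (hm : Integrable fun x => (1 + ‖x‖) * h x)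
    (hf : ∀ j, Integrable fun x => f x j)
    (hw : ∀ ψ : Plane → ℝ, ContDiff ℝ ∞ ψ → HasCompactSupport ψ → ∫ x, weakIntegrand lam h f ψ x = 0)
    {g : Plane → ℝ} (hg : ContDiff ℝ ∞ g) {C : ℝ} (h0 : ∀ x, |g x| ≤ C) (h1 : ∀ j x, |pd j g x| ≤ C)
    (h2 : ∀ j x, |pd j (pd j g) x| ≤ C) : ∫ x, weakIntegrand lam h f g x = 0 := by
  have hh := integrable_of_moment hm
  have hk := fun j => integrable_totalFlux (lam := lam) hm hf j
  -- The rescaled cutoffs `χ (c n • x)` equal one on the ball of radius `n + 1`, and their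
  -- derivatives are bounded uniformly in `n` because `c n ≤ 1`. Dominated convergence removes them.
  let χ : ContDiffBump (0 : Plane) := ⟨1, 2, one_pos, one_lt_two⟩
  have hχ : ContDiff ℝ ∞ χ := χ.contDiff
  have hbd : ∀ {k : Plane → ℝ}, ContDiff ℝ ∞ k → HasCompactSupport k → ∃ B, ∀ x, |k x| ≤ B :=
    fun {k} h1 h2 => h1.continuous.bounded_above_of_compact_support h2
  have hC : 0 ≤ C := (abs_nonneg _).trans (h0 0)
  obtain ⟨B, hB0, hB1, hB2⟩ : ∃ B, (∀ x, |χ x| ≤ B) ∧ (∀ j x, |pd j χ x| ≤ B) ∧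
      ∀ j x, |pd j (pd j χ) x| ≤ B := by
    have hs := χ.hasCompactSupport
    obtain ⟨B0, hB0⟩ := hbd hχ hs
    choose B1 hB1 using fun j => hbd (contDiff_pd hχ j) (hasCompactSupport_pd hs j)
    choose B2 hB2 using fun j => hbd (contDiff_pd (contDiff_pd hχ j) j)
      (hasCompactSupport_pd (hasCompactSupport_pd hs j) j)
    have p0 := (abs_nonneg _).trans (hB0 0)
    have p1 := fun j => (abs_nonneg _).trans (hB1 j 0)
    have p2 := fun j => (abs_nonneg _).trans (hB2 j 0)
    refine ⟨B0 + ∑ j, B1 j + ∑ j, B2 j, fun x => (hB0 x).trans ?_, fun j x => (hB1 j x).trans ?_,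
      fun j x => (hB2 j x).trans ?_⟩
    · linarith [Finset.sum_nonneg fun j (_ : j ∈ Finset.univ) => p1 j,
        Finset.sum_nonneg fun j (_ : j ∈ Finset.univ) => p2 j]
    · linarith [Finset.single_le_sum (fun j _ => p1 j) (Finset.mem_univ j),
        Finset.sum_nonneg fun j (_ : j ∈ Finset.univ) => p2 j]
    · linarith [Finset.single_le_sum (fun j _ => p2 j) (Finset.mem_univ j),
        Finset.sum_nonneg fun j (_ : j ∈ Finset.univ) => p1 j]
  have hB : 0 ≤ B := (abs_nonneg _).trans (hB0 0)
  let c : ℕ → ℝ := fun n => ((n : ℝ) + 1)⁻¹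
  have hc : ∀ n, 0 < c n ∧ c n ≤ 1 := fun n =>
    ⟨by positivity, inv_le_one_of_one_le₀ (by linarith [n.cast_nonneg (α := ℝ)])⟩
  have hχn : ∀ n, ContDiff ℝ ∞ fun x => χ (c n • x) := fun n => hχ.comp (by fun_prop)
  have cs : ∀ n, HasCompactSupport fun x => χ (c n • x) := fun n =>
    χ.hasCompactSupport.comp_smul (hc n).1.ne'
  have b0 : ∀ n x, |χ (c n • x)| ≤ B := fun n x => hB0 _
  have b1 : ∀ n j x, |pd j (fun x => χ (c n • x)) x| ≤ B := fun n j x => by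
    rw [pd_comp_smul, abs_mul, abs_of_pos (hc n).1]
    exact (mul_le_of_le_one_left (abs_nonneg _) (hc n).2).trans (hB1 _ _)
  have b2 : ∀ n j x, |pd j (pd j (fun x => χ (c n • x))) x| ≤ B := fun n j x => by
    rw [pd_comp_smul, pd_const_mul (a := fun x => pd j χ (c n • x)) ((contDiff_pd hχ j).comp (by fun_prop)),
      pd_comp_smul, abs_mul, abs_mul, abs_of_pos (hc n).1]
    exact (mul_le_of_le_one_left (by have := (hc n).1; positivity) (hc n).2).trans
      ((mul_le_of_le_one_left (abs_nonneg _) (hc n).2).trans (hB2 _ _))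
  let ψ : ℕ → Plane → ℝ := fun n x => χ (c n • x) * g x
  have hψ : ∀ n, ContDiff ℝ ∞ (ψ n) := fun n => (hχn n).mul hg
  have d1 : ∀ n j x, |pd j (ψ n) x| ≤ 2 * (B * C) := fun n j x => by
    simp only [ψ]
    rw [pd_mul (hχn n) hg]
    refine (abs_add_le _ _).trans ?_
    rw [abs_mul, abs_mul]
    linarith [mul_le_mul (b0 n x) (h1 j x) (abs_nonneg _) hB,
      mul_le_mul (b1 n j x) (h0 x) (abs_nonneg _) hB]
  have d2 : ∀ n j x, |pd j (pd j (ψ n)) x| ≤ 4 * (B * C) := fun n j x => by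
    simp only [ψ]
    rw [pd_mul (hχn n) hg, pd_add ((hχn n).mul (contDiff_pd hg j)) ((contDiff_pd (hχn n) j).mul hg),
      pd_mul (hχn n) (contDiff_pd hg j), pd_mul (contDiff_pd (hχn n) j) hg]
    refine (abs_add_le _ _).trans ((add_le_add (abs_add_le _ _) (abs_add_le _ _)).trans ?_)
    simp only [abs_mul]
    linarith [mul_le_mul (b0 n x) (h2 j x) (abs_nonneg _) hB,
      mul_le_mul (b1 n j x) (h1 j x) (abs_nonneg _) hB,
      mul_le_mul (b2 n j x) (h0 x) (abs_nonneg _) hB]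
  have cont : ∀ {g : Plane → ℝ}, ContDiff ℝ ∞ g →
      AEStronglyMeasurable (weakIntegrand lam h f g) := fun {g} hg =>
    (Finset.aestronglyMeasurable_fun_sum _ fun j _ => (hk j).aestronglyMeasurable.mul
      (contDiff_pd hg j).continuous.aestronglyMeasurable).add
      (hh.aestronglyMeasurable.mul (continuous_finsetSum _ fun j _ =>
        (contDiff_pd (contDiff_pd hg j) j).continuous).aestronglyMeasurable)
  refine tendsto_nhds_unique (tendsto_integral_of_dominated_convergence
    (F := fun n => weakIntegrand lam h f (ψ n))
    (fun x => (∑ j, ‖totalFlux lam h f x j‖ * (2 * (B * C))) + ‖h x‖ * (2 * (4 * (B * C))))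
    (fun n => cont (hψ n)) ?_ (fun n => .of_forall fun x => ?_) (.of_forall fun x => ?_)) ?_
  · exact (integrable_finsetSum _ fun j _ => (hk j).norm.mul_const _).add (hh.norm.mul_const _)
  · unfold weakIntegrand
    refine (norm_add_le _ _).trans (add_le_add ((norm_sum_le _ _).trans
      (Finset.sum_le_sum fun j _ => ?_)) ?_)
    · rw [norm_mul]
      exact mul_le_mul_of_nonneg_left (d1 n j x) (norm_nonneg _)
    · rw [norm_mul]
      refine mul_le_mul_of_nonneg_left ?_ (norm_nonneg _)
      rw [Fin.sum_univ_two]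
      refine (norm_add_le _ _).trans ?_
      simp only [Real.norm_eq_abs]
      linarith [d2 n 0 x, d2 n 1 x]
  · obtain ⟨N, hN⟩ := exists_nat_gt ‖x‖
    refine tendsto_const_nhds.congr' ?_
    filter_upwards [eventually_ge_atTop N] with n hn
    have hU : ∀ y ∈ Metric.ball (0 : Plane) (n + 1), ψ n y = g y := fun y hy => by
      have : χ (c n • y) = 1 := χ.one_of_mem_closedBall (by
        simp only [mem_ball_zero_iff, mem_closedBall_zero_iff] at hy ⊢
        rw [norm_smul, Real.norm_of_nonneg (hc n).1.le, inv_mul_le_iff₀ (by positivity)]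
        simpa [χ] using hy.le)
      simp only [ψ, this, one_mul]
    have hx : x ∈ Metric.ball (0 : Plane) (n + 1) := by
      rw [mem_ball_zero_iff]
      have : (N : ℝ) ≤ n := by exact_mod_cast hn
      linarith
    unfold weakIntegrand
    have e1 := fun j => pd_congr Metric.isOpen_ball hU j
    simp only [e1 _ x hx, pd_congr Metric.isOpen_ball (e1 _) _ x hx]
  · simp only [hw _ (hψ _) (cs _).mul_right]
    exact tendsto_const_nhds

theorem pd_comp_phase {F F' : ℝ → ℝ} (hF : ∀ s, HasDerivAt F (F' s) s) (ξ : Plane) (j : Fin 2) :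
    pd j (fun x => F (x 0 * ξ 0 + x 1 * ξ 1)) = fun x => ξ j * F' (x 0 * ξ 0 + x 1 * ξ 1) := by
  funext x
  have hx : ∀ i : Fin 2, HasFDerivAt (fun x : Plane => x i)
      (EuclideanSpace.proj i : Plane →L[ℝ] ℝ) x := fun i =>
    (EuclideanSpace.proj i : Plane →L[ℝ] ℝ).hasFDerivAt
  have h1 := (hF (x 0 * ξ 0 + x 1 * ξ 1)).comp_hasFDerivAt x
    (((hx 0).mul_const (ξ 0)).add ((hx 1).mul_const (ξ 1)))
  unfold pd
  have h2 := h1.fderiv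
  simp only [Function.comp_def, Pi.add_apply] at h2
  rw [h2]
  fin_cases j <;> simp <;> ring

/-- The functions `cos (x·ξ)` and `sin (x·ξ)` have bounded derivatives and are admissible by
`integral_weakIntegrand_of_bounded`. The combination `cos - i sin` is the plane wave and yields the
equation at `ξ`. -/
theorem solves_of_weak {lam : ℝ} {h : Plane → ℝ}
    {f : Plane → Fin 2 → ℝ} (hm : Integrable fun x => (1 + ‖x‖) * h x)
    (hf : ∀ j, Integrable fun x => f x j)
    (hw : ∀ ψ : Plane → ℝ, ContDiff ℝ ∞ ψ → HasCompactSupport ψ → ∫ x, weakIntegrand lam h f ψ x = 0) :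
    Solves lam h f := by
  intro ξ
  have hh := integrable_of_moment hm
  set p : Plane → ℝ := fun x => x 0 * ξ 0 + x 1 * ξ 1
  have hC : ∀ j, |ξ j| ≤ 1 + ‖ξ‖ ^ 2 ∧ |ξ j * ξ j| ≤ 1 + ‖ξ‖ ^ 2 := fun j => by
    have h1 := abs_le_norm ξ j
    have := abs_nonneg (ξ j)
    constructor
    · nlinarith [sq_nonneg (‖ξ‖ - 1)]
    · rw [abs_mul]
      nlinarith
  have test : ∀ {F F' F'' : ℝ → ℝ}, ContDiff ℝ ∞ F → (∀ s, HasDerivAt F (F' s) s) →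
      (∀ s, HasDerivAt F' (F'' s) s) → ContDiff ℝ ∞ F' → (∀ s, |F s| ≤ 1) → (∀ s, |F' s| ≤ 1) →
      (∀ s, |F'' s| ≤ 1) →
      ∫ x, ((∑ j, totalFlux lam h f x j * (ξ j * F' (p x))) + h x * ∑ j, ξ j * (ξ j * F'' (p x))) = 0 :=
    fun {F F' F''} c0 d0 d1 c1 b0 b1 b2 => by
      have hp : ContDiff ℝ ∞ p := by fun_prop
      have q1 : ∀ j, pd j (fun x => F (p x)) = fun x => ξ j * F' (p x) := pd_comp_phase d0 ξ
      have q2 : ∀ j, pd j (pd j fun x => F (p x)) = fun x => ξ j * (ξ j * F'' (p x)) := fun j => by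
        rw [q1, pd_const_mul (a := fun x => F' (p x)) (c1.comp hp), pd_comp_phase d1 ξ]
      have := integral_weakIntegrand_of_bounded hm hf hw (g := fun x => F (p x)) (c0.comp hp)
        (C := 1 + ‖ξ‖ ^ 2) (fun x => (b0 _).trans (by nlinarith [norm_nonneg ξ]))
        (fun j x => by
          rw [q1, abs_mul]
          exact (mul_le_of_le_one_right (abs_nonneg _) (b1 _)).trans (hC j).1)
        (fun j x => by
          rw [q2]
          simp only
          rw [← mul_assoc, abs_mul]
          exact (mul_le_of_le_one_right (abs_nonneg _) (b2 _)).trans (hC j).2)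
      simp only [weakIntegrand, q2] at this
      simpa only [q1] using this
  have t1 := test (F := Real.cos) (F' := fun s => -Real.sin s) (F'' := fun s => -Real.cos s)
    Real.contDiff_cos Real.hasDerivAt_cos (fun s => (Real.hasDerivAt_sin s).neg)
    Real.contDiff_sin.neg Real.abs_cos_le_one (fun s => by simpa using Real.abs_sin_le_one s)
    (fun s => by simpa using Real.abs_cos_le_one s)
  have t2 := test (F := Real.sin) (F' := Real.cos) (F'' := fun s => -Real.sin s)
    Real.contDiff_sin Real.hasDerivAt_sin Real.hasDerivAt_cos
    Real.contDiff_cos Real.abs_sin_le_one Real.abs_cos_le_one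
    (fun s => by simpa using Real.abs_sin_le_one s)
  have hk := fun j => integrable_totalFlux (lam := lam) hm hf j
  have hreal : ∀ {k : Plane → ℝ}, Integrable k → ∀ {F : ℝ → ℝ}, Continuous F → (∀ s, |F s| ≤ 1) →
      Integrable fun x => k x * F (p x) := fun {k} hk {F} hF hb =>
    hk.mul_bdd (c := 1) (hF.comp (by fun_prop)).aestronglyMeasurable (.of_forall fun x => hb _)
  have hint : ∀ {F' F'' : ℝ → ℝ}, Continuous F' → Continuous F'' → (∀ s, |F' s| ≤ 1) →
      (∀ s, |F'' s| ≤ 1) → Integrable fun x =>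
      (∑ j, totalFlux lam h f x j * (ξ j * F' (p x))) + h x * ∑ j, ξ j * (ξ j * F'' (p x)) :=
    fun {F' F''} c1 c2 b1 b2 => by
      refine ((integrable_finsetSum Finset.univ fun j _ => (hreal (hk j) c1 b1).mul_const (ξ j)).add
        ((hreal hh c2 b2).mul_const (∑ j, ξ j * ξ j))).congr (.of_forall fun x => ?_)
      simp only [Pi.add_apply, Fin.sum_univ_two]
      ring
  have i1 := hint (F' := fun s => -Real.sin s) (F'' := fun s => -Real.cos s)
    Real.continuous_sin.neg Real.continuous_cos.neg
    (fun s => by simpa using Real.abs_sin_le_one s) (fun s => by simpa using Real.abs_cos_le_one s)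
  have i2 := hint (F' := Real.cos) (F'' := fun s => -Real.sin s)
    Real.continuous_cos Real.continuous_sin.neg
    Real.abs_cos_le_one (fun s => by simpa using Real.abs_sin_le_one s)
  have comb : ∫ x, ((∑ j, (totalFlux lam h f x j : ℂ) * (-I * ξ j * wave ξ x)) -
      h x * ((ξ 0 ^ 2 + ξ 1 ^ 2 : ℝ) : ℂ) * wave ξ x) = 0 := by
    have hsub : ∀ {A B : Plane → ℝ}, Integrable A → Integrable B → ∫ x, A x = 0 → ∫ x, B x = 0 →
        ∫ x, ((A x : ℂ) - I * B x) = 0 := fun {A B} iA iB hA hB => by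
      have jA : Integrable fun x => (A x : ℂ) := iA.ofReal
      have jB : Integrable fun x => (B x : ℂ) := iB.ofReal
      rw [integral_sub jA (jB.const_mul I), integral_const_mul, integral_complex_ofReal,
        integral_complex_ofReal, hA, hB]
      simp
    rw [← hsub i1 i2 t1 t2]
    refine integral_congr_ae (.of_forall fun x => ?_)
    have hw : wave ξ x = (Real.cos (p x) : ℂ) - I * Real.sin (p x) := by
      unfold wave
      rw [show -I * ((x 0 * ξ 0 + x 1 * ξ 1 : ℝ) : ℂ) = -((p x : ℝ) : ℂ) * I by simp only [p]; ring,
        Complex.exp_mul_I]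
      simp
      ring
    simp only [hw, Fin.sum_univ_two]
    push_cast
    linear_combination (-(totalFlux lam h f x 0 : ℂ) * ξ 0 - totalFlux lam h f x 1 * ξ 1) *
      Complex.sin (p x : ℂ) * (-I_sq)
  have hiw := fun j => integrable_mul_wave (hk j) ξ
  have e0 : (∑ j, -I * (ξ j : ℂ) * ∫ x, (totalFlux lam h f x j : ℂ) * wave ξ x) =
      ((ξ 0 ^ 2 + ξ 1 ^ 2 : ℝ) : ℂ) * FT h ξ := by
    unfold FT
    simp only [← integral_const_mul]
    rw [← integral_finsetSum _ fun j _ => (hiw j).const_mul _, ← sub_eq_zero, ← integral_sub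
      (integrable_finsetSum _ fun j _ => (hiw j).const_mul _) ((integrable_mul_wave hh ξ).const_mul _),
      ← comb]
    refine integral_congr_ae (.of_forall fun x => ?_)
    simp only [Fin.sum_univ_two]
    ring
  have e1 : ∫ x, (h x : ℂ) * (I * driftSymbol lam ξ x) * wave ξ x =
      I * ∑ j, (ξ j : ℂ) * (FT (fun x => f x j) ξ - ∫ x, (totalFlux lam h f x j : ℂ) * wave ξ x) := by
    unfold FT
    simp only [← integral_sub (integrable_mul_wave (hf _) ξ) (hiw _), ← integral_const_mul]
    rw [← integral_finsetSum (f := fun j x => (ξ j : ℂ) * ((f x j : ℂ) * wave ξ x -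
      (totalFlux lam h f x j : ℂ) * wave ξ x)) _
      fun j _ => ((integrable_mul_wave (hf j) ξ).sub (hiw j)).const_mul _, ← integral_const_mul]
    refine integral_congr_ae (.of_forall fun x => ?_)
    simp only [Fin.sum_univ_two, driftSymbol, totalFlux]
    push_cast
    ring
  rw [e1, ← e0]
  simp only [Fin.sum_univ_two]
  ring

end BurgersVortex

end


/-! ### From three dimensions to two: columnar fields and their stationary equation. -/

noncomputable section

namespace BurgersVortex

open Filter Topology

/-! ### Integrals over the space -/

/-- The horizontal part of a point. -/
def horizontal (x : Space) : Plane := !₂[x 0, x 1]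

/-- The point at height `z` above `x`. -/
def lift (x : Plane) (z : ℝ) : Space := !₂[x 0, x 1, z]

@[simp] theorem lift_zero (x : Plane) (z : ℝ) : lift x z 0 = x 0 := rfl
@[simp] theorem lift_one (x : Plane) (z : ℝ) : lift x z 1 = x 1 := rfl
@[simp] theorem lift_two (x : Plane) (z : ℝ) : lift x z 2 = z := rfl
@[simp] theorem horizontal_zero (x : Space) : horizontal x 0 = x 0 := rfl
@[simp] theorem horizontal_one (x : Space) : horizontal x 1 = x 1 := rfl

@[simp] theorem horizontal_lift (x : Plane) (z : ℝ) : horizontal (lift x z) = x := by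
  ext j
  fin_cases j <;> rfl

@[simp] theorem lift_horizontal (x : Space) : lift (horizontal x) (x 2) = x := by
  ext j
  fin_cases j <;> rfl

theorem continuous_horizontal : Continuous horizontal := by
  unfold horizontal
  fun_prop

theorem continuous_lift : Continuous fun p : Plane × ℝ => lift p.1 p.2 := by
  unfold lift
  fun_prop

/-- The coordinates `(x_⊥, x₃)`. -/
def spaceEquiv : Space ≃ᵐ Plane × ℝ where
  toFun x := (horizontal x, x 2)
  invFun p := lift p.1 p.2
  left_inv x := lift_horizontal x
  right_inv p := by simp
  measurable_toFun := (continuous_horizontal.prodMk (by fun_prop)).measurable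
  measurable_invFun := continuous_lift.measurable

theorem measurePreserving_spaceEquiv : MeasurePreserving spaceEquiv := by
  have h1 := EuclideanSpace.volume_preserving_symm_measurableEquiv_toLp (Fin 3)
  have h2 := volume_preserving_piFinSuccAbove (fun _ : Fin 3 => ℝ) 2
  have h3 : MeasurePreserving (Prod.map (id : ℝ → ℝ) (MeasurableEquiv.toLp 2 (Fin 2 → ℝ)))
      (volume.prod volume) (volume.prod volume) :=
    (MeasurePreserving.id volume).prod
      (EuclideanSpace.volume_preserving_symm_measurableEquiv_toLp (Fin 2)).symm
  have h4 : MeasurePreserving (Prod.swap : ℝ × Plane → Plane × ℝ) (volume.prod volume)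
    (volume.prod volume) := Measure.measurePreserving_swap
  suffices e : ⇑spaceEquiv = Prod.swap ∘ Prod.map (id : ℝ → ℝ) (MeasurableEquiv.toLp 2 (Fin 2 → ℝ)) ∘
      MeasurableEquiv.piFinSuccAbove (fun _ : Fin 3 => ℝ) 2 ∘
        (MeasurableEquiv.toLp 2 (Fin 3 → ℝ)).symm by
    rw [e]
    exact h4.comp (h3.comp (h2.comp h1))
  refine funext fun x => Prod.ext ?_ rfl
  ext j
  fin_cases j <;> rfl

theorem integral_space {E : Type*} [NormedAddCommGroup E] [NormedSpace ℝ E] (F : Space → E) :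
    ∫ x, F x = ∫ p : Plane × ℝ, F (lift p.1 p.2) :=
  (measurePreserving_spaceEquiv.symm.integral_comp spaceEquiv.symm.measurableEmbedding F).symm

theorem integrable_space_iff {E : Type*} [NormedAddCommGroup E] {F : Space → E} :
    Integrable F ↔ Integrable (fun p : Plane × ℝ => F (lift p.1 p.2)) (volume.prod volume) :=
  (measurePreserving_spaceEquiv.symm.integrable_comp_emb
    spaceEquiv.symm.measurableEmbedding).symm

theorem ae_horizontal {P : Plane → Prop} (h : ∀ᵐ x, P x) : ∀ᵐ x : Space, P (horizontal x) := by
  have h1 : ∀ᵐ p : Plane × ℝ, P p.1 := Measure.quasiMeasurePreserving_fst.ae h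
  exact measurePreserving_spaceEquiv.quasiMeasurePreserving.ae h1

theorem norm_sq_space (x : Space) : ‖x‖ ^ 2 = ‖horizontal x‖ ^ 2 + x 2 ^ 2 := by
  rw [norm_sq_plane]
  simp [EuclideanSpace.norm_sq_eq, Fin.sum_univ_three]

theorem norm_lift_sub (x y : Plane) (z s : ℝ) :
    ‖lift x z - lift y s‖ = √(‖x - y‖ ^ 2 + (z - s) ^ 2) := by
  rw [← Real.sqrt_sq (norm_nonneg (lift x z - lift y s)), norm_sq_space]
  have : horizontal (lift x z - lift y s) = x - y := by
    ext j
    fin_cases j <;> rfl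
  rw [this]
  rfl

theorem locallyIntegrable_comp_horizontal {k : Plane → ℝ} (hk : Integrable k) :
    LocallyIntegrable fun x : Space => k (horizontal x) := by
  refine locallyIntegrable_iff.2 fun K hK => ?_
  obtain ⟨R, hR⟩ := hK.isBounded.exists_norm_le
  have h1 : Integrable (fun p : Plane × ℝ => k p.1) (volume.prod (volume.restrict (Icc (-R) R))) :=
    hk.comp_fst _
  have h2 : IntegrableOn (fun p : Plane × ℝ => k p.1) (univ ×ˢ Icc (-R) R) (volume.prod volume) := by
    rwa [IntegrableOn, ← Measure.prod_restrict, Measure.restrict_univ]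
  have h3 := (measurePreserving_spaceEquiv.integrableOn_comp_preimage
    spaceEquiv.measurableEmbedding).2 h2
  refine h3.mono_set fun x hx => ⟨mem_univ _, abs_le.1 ?_⟩
  exact (by simpa using PiLp.norm_apply_le x 2 : |x 2| ≤ ‖x‖).trans (hR x hx)

/-! ### The velocity field of a columnar vortex -/

/-- An explicit primitive with limits `± r⁻²`, the source of the vertical integral `2 / r²`. -/
theorem hasDerivAt_primitive {r : ℝ} (hr : 0 < r) (z : ℝ) :
    HasDerivAt (fun z => z / (r ^ 2 * √(r ^ 2 + z ^ 2))) (√(r ^ 2 + z ^ 2) ^ 3)⁻¹ z := by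
  have hp : 0 < r ^ 2 + z ^ 2 := by positivity
  have hs := Real.sqrt_pos.2 hp
  have h1 : HasDerivAt (fun z : ℝ => r ^ 2 + z ^ 2) (2 * z) z := by
    simpa using (hasDerivAt_pow 2 z).const_add (r ^ 2)
  have h2 := (hasDerivAt_id z).div ((h1.sqrt hp.ne').const_mul (r ^ 2)) (by positivity)
  refine h2.congr_deriv ?_
  have e : √(r ^ 2 + z ^ 2) ^ 2 = r ^ 2 + z ^ 2 := Real.sq_sqrt hp.le
  simp only [id]
  field_simp
  rw [e]
  ring

theorem integrable_inv_cube {r : ℝ} (hr : 0 < r) : Integrable fun z => (√(r ^ 2 + z ^ 2) ^ 3)⁻¹ := by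
  refine ((integrable_inv_one_add_sq.comp_div hr.ne').const_mul (r ^ 3)⁻¹).mono'
    (Continuous.aestronglyMeasurable (Continuous.inv₀ (by fun_prop) fun z => ?_))
    (.of_forall fun z => ?_)
  · have : 0 < r ^ 2 + z ^ 2 := by positivity
    positivity
  · have hp : 0 < r ^ 2 + z ^ 2 := by positivity
    have hs : r ≤ √(r ^ 2 + z ^ 2) := Real.le_sqrt_of_sq_le (by nlinarith [sq_nonneg z])
    have e : √(r ^ 2 + z ^ 2) ^ 2 = r ^ 2 + z ^ 2 := Real.sq_sqrt hp.le
    rw [Real.norm_of_nonneg (by positivity), ← mul_inv]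
    refine inv_anti₀ (by positivity) ?_
    calc r ^ 3 * (1 + (z / r) ^ 2) = r * (r ^ 2 + z ^ 2) := by field_simp
      _ = r * √(r ^ 2 + z ^ 2) ^ 2 := by rw [e]
      _ ≤ √(r ^ 2 + z ^ 2) * √(r ^ 2 + z ^ 2) ^ 2 := by gcongr
      _ = _ := by ring

theorem integral_inv_cube {r : ℝ} (hr : 0 < r) :
    ∫ z, (√(r ^ 2 + z ^ 2) ^ 3)⁻¹ = 2 / r ^ 2 := by
  have hz : Tendsto (fun z : ℝ => z⁻¹) atTop (𝓝 0) := tendsto_inv_atTop_zero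
  have ht : Tendsto (fun z => z / (r ^ 2 * √(r ^ 2 + z ^ 2))) atTop (𝓝 (r ^ 2)⁻¹) := by
    have h1 : Tendsto (fun z : ℝ => (r ^ 2 * √(r ^ 2 * z⁻¹ ^ 2 + 1))⁻¹) atTop
        (𝓝 (r ^ 2 * √(r ^ 2 * 0 ^ 2 + 1))⁻¹) := by
      refine Tendsto.inv₀ ?_ (by simp [hr.ne'])
      exact ((((hz.pow 2).const_mul (r ^ 2)).add_const 1).sqrt).const_mul _
    simp only [ne_eq, OfNat.ofNat_ne_zero, not_false_eq_true, zero_pow, mul_zero, zero_add,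
      Real.sqrt_one, mul_one] at h1
    refine h1.congr' ?_
    filter_upwards [eventually_gt_atTop 0] with z hz
    have : √(r ^ 2 + z ^ 2) = z * √(r ^ 2 * z⁻¹ ^ 2 + 1) := by
      rw [← Real.sqrt_sq hz.le, ← Real.sqrt_mul (by positivity), Real.sqrt_sq hz.le]
      congr 1
      field_simp
    rw [this, mul_left_comm, div_mul_cancel_left₀ hz.ne']
  have hb : Tendsto (fun z => z / (r ^ 2 * √(r ^ 2 + z ^ 2))) atBot (𝓝 (-(r ^ 2)⁻¹)) := by
    refine ((ht.comp tendsto_neg_atBot_atTop).neg).congr fun z => ?_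
    simp [neg_div]
  rw [integral_of_hasDerivAt_of_tendsto (fun z => hasDerivAt_primitive hr z)
    (integrable_inv_cube hr) hb ht]
  field_simp
  ring

theorem biotSavartIntegrand_lift (w : Plane → ℝ) (x : Space) (y : Plane) (s : ℝ) :
    biotSavartIntegrand (verticalField w) x (lift y s) =
      (√(‖horizontal x - y‖ ^ 2 + (x 2 - s) ^ 2) ^ 3)⁻¹ •
        !₂[(x 1 - y 1) * w y, -(x 0 - y 0) * w y, 0] := by
  unfold biotSavartIntegrand
  congr 1
  · rw [← norm_lift_sub, lift_horizontal]
  · ext j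
    have e : w !₂[y 0, y 1] = w y := congrArg w (horizontal_lift y s)
    fin_cases j <;> simp [verticalField, crossProduct, e]
    all_goals ring

/-- The hypothesis `hc` covers the vertical line through the evaluation point, where the kernel is
not integrable but the numerator vanishes. -/
theorem integrable_inv_cube_mul {c : ℝ} {d : Plane} (hc : d = 0 → c = 0) (t : ℝ) :
    Integrable fun s => (√(‖d‖ ^ 2 + (t - s) ^ 2) ^ 3)⁻¹ * c := by
  rcases eq_or_ne d 0 with hd | hd
  · simp [hc hd]
  · exact ((integrable_inv_cube (norm_pos_iff.2 hd)).comp_sub_left t).mul_const c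

theorem integral_inv_cube_mul {c : ℝ} {d : Plane} (hc : d = 0 → c = 0) (t : ℝ) :
    ∫ s, (√(‖d‖ ^ 2 + (t - s) ^ 2) ^ 3)⁻¹ * c = 2 / ‖d‖ ^ 2 * c := by
  rcases eq_or_ne d 0 with hd | hd
  · simp [hc hd]
  · rw [integral_mul_const, integral_sub_left_eq_self fun s => (√(‖d‖ ^ 2 + s ^ 2) ^ 3)⁻¹,
      integral_inv_cube (norm_pos_iff.2 hd)]

/-- The vertical integral of `|d| / (|d|² + s²)^(3/2)` is `2 / |d|`, so integrability in space
reduces to finiteness of the planar Riesz potential. -/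
theorem integrable_biotSavartIntegrand {w : Plane → ℝ} (hw : AEStronglyMeasurable w) {x : Space}
    (hx : absVelocity w (horizontal x) < ⊤) : Integrable (biotSavartIntegrand (verticalField w) x) := by
  rw [integrable_space_iff]
  simp only [biotSavartIntegrand_lift]
  have hmk : Measurable fun p : Plane × ℝ =>
      (√(‖horizontal x - p.1‖ ^ 2 + (x 2 - p.2) ^ 2) ^ 3)⁻¹ := by fun_prop
  have comp : ∀ c : Plane → ℝ, Measurable c → (∀ y, |c y| ≤ ‖horizontal x - y‖) →
      Integrable (fun p : Plane × ℝ => (√(‖horizontal x - p.1‖ ^ 2 + (x 2 - p.2) ^ 2) ^ 3)⁻¹ *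
        (c p.1 * w p.1)) (volume.prod volume) := fun c hc hcb => by
    have hmeas : AEStronglyMeasurable (fun p : Plane × ℝ =>
        (√(‖horizontal x - p.1‖ ^ 2 + (x 2 - p.2) ^ 2) ^ 3)⁻¹ * (c p.1 * w p.1))
        (volume.prod volume) :=
      hmk.aestronglyMeasurable.mul ((hc.comp measurable_fst).aestronglyMeasurable.mul hw.comp_fst)
    have h0 : ∀ y, horizontal x - y = 0 → c y * w y = 0 := fun y hy => by
      have := hcb y
      rw [hy, norm_zero, abs_nonpos_iff] at this
      rw [this, zero_mul]
    refine (integrable_prod_iff hmeas).2 ⟨.of_forall fun y => integrable_inv_cube_mul (h0 y) _, ?_⟩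
    have e : ∀ y, ∫ s, ‖(√(‖horizontal x - y‖ ^ 2 + (x 2 - s) ^ 2) ^ 3)⁻¹ * (c y * w y)‖ =
        2 / ‖horizontal x - y‖ ^ 2 * |c y * w y| := fun y => by
      rw [← integral_inv_cube_mul (fun h => by rw [h0 y h, abs_zero]) (x 2)]
      refine integral_congr_ae (.of_forall fun s => ?_)
      simp only
      rw [norm_mul, Real.norm_of_nonneg (by positivity), Real.norm_eq_abs]
    simp only [e]
    have hg : Integrable fun y => ‖horizontal x - y‖⁻¹ * ‖w y‖ := by
      refine ⟨(Measurable.aestronglyMeasurable (by fun_prop)).mul hw.norm, ?_⟩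
      refine lt_of_eq_of_lt (lintegral_congr fun y => ?_) hx
      rw [enorm_mul, enorm_norm, Real.enorm_of_nonneg (by positivity)]
    refine (hg.const_mul 2).mono' ((Measurable.aestronglyMeasurable (by fun_prop)).mul
      (hc.aestronglyMeasurable.mul hw).norm) (.of_forall fun y => ?_)
    rw [norm_mul, Real.norm_of_nonneg (by positivity), Real.norm_of_nonneg (abs_nonneg _), abs_mul,
      Real.norm_eq_abs]
    rcases eq_or_ne (horizontal x - y) 0 with hd | hd
    · simp [hd]
    have hd' := norm_pos_iff.2 hd
    calc 2 / ‖horizontal x - y‖ ^ 2 * (|c y| * |w y|)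
        ≤ 2 / ‖horizontal x - y‖ ^ 2 * (‖horizontal x - y‖ * |w y|) := by
          gcongr
          exact hcb y
      _ = _ := by field_simp
  have hb : ∀ j y, |x (Fin.castSucc j) - y j| ≤ ‖horizontal x - y‖ := fun j y => by
    have := abs_le_norm (horizontal x - y) j
    fin_cases j <;> exact this
  have h0 := (comp (fun y => x 1 - y 1) (by fun_prop) (hb 1)).smul_const
    (EuclideanSpace.single 0 1 : Space)
  have h1 := (comp (fun y => -(x 0 - y 0)) (by fun_prop)
    (fun y => by rw [abs_neg]; exact hb 0 y)).smul_const (EuclideanSpace.single 1 1 : Space)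
  refine (h0.add h1).congr (.of_forall fun p => ?_)
  ext j
  fin_cases j <;> simp

/-- Integrating out the height turns `-1/(4π)` into `-1/(2π |d|²)`, and the cross product with a
vertical vector rotates `d`: this is the planar kernel. -/
theorem biotSavart_verticalField {w : Plane → ℝ} (hw : AEStronglyMeasurable w) {x : Space}
    (hx : absVelocity w (horizontal x) < ⊤) :
    biotSavart (verticalField w) x =
      !₂[planeVelocity w (horizontal x) 0, planeVelocity w (horizontal x) 1, 0] := by
  have hi := integrable_biotSavartIntegrand hw hx
  have hc : ∀ j : Fin 3, (∫ y, biotSavartIntegrand (verticalField w) x y) j =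
      ∫ y : Plane, ∫ s, biotSavartIntegrand (verticalField w) x (lift y s) j := fun j => by
    have h1 := (EuclideanSpace.proj j : Space →L[ℝ] ℝ).integral_comp_comm hi
    have h2 := (EuclideanSpace.proj j : Space →L[ℝ] ℝ).integrable_comp hi
    rw [integral_space, Measure.volume_eq_prod, integral_prod _ (integrable_space_iff.1 h2)] at h1
    exact h1.symm
  have key : ∀ c : Plane → ℝ, (∀ y, horizontal x - y = 0 → c y = 0) →
      ∫ y : Plane, ∫ s, (√(‖horizontal x - y‖ ^ 2 + (x 2 - s) ^ 2) ^ 3)⁻¹ * (c y * w y) =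
      ∫ y : Plane, 2 / ‖horizontal x - y‖ ^ 2 * (c y * w y) := fun c h0 =>
    integral_congr_ae (.of_forall fun y =>
      integral_inv_cube_mul (fun h => by rw [h0 y h, zero_mul]) _)
  have hz : ∀ j : Fin 2, ∀ y, horizontal x - y = 0 → x (Fin.castSucc j) - y j = 0 := fun j y h => by
    have := congrArg (fun d : Plane => d j) h
    fin_cases j <;> exact this
  have hp := Real.pi_ne_zero
  ext j
  unfold biotSavart
  rw [PiLp.smul_apply, hc, smul_eq_mul]
  simp only [biotSavartIntegrand_lift]
  fin_cases j
  · have := key (fun y => x 1 - y 1) (hz 1)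
    simp only [Fin.zero_eta, PiLp.smul_apply, smul_eq_mul, Matrix.cons_val_zero] at this ⊢
    rw [this, ← integral_const_mul]
    refine integral_congr_ae (.of_forall fun y => ?_)
    simp only [planeKernel, Matrix.cons_val_zero, PiLp.sub_apply, horizontal_one]
    field_simp
    ring
  · have := key (fun y => -(x 0 - y 0)) (fun y h => by rw [neg_eq_zero]; exact hz 0 y h)
    simp only [Fin.mk_one, PiLp.smul_apply, smul_eq_mul, Matrix.cons_val_one, Matrix.cons_val_zero] at this ⊢
    rw [this, ← integral_const_mul]
    refine integral_congr_ae (.of_forall fun y => ?_)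
    simp only [planeKernel, Matrix.cons_val_one, Matrix.cons_val_fin_one, PiLp.sub_apply,
      horizontal_zero]
    field_simp
    ring
  · simp

/-! ### Test functions on the space -/

theorem exists_eq_zero_of_hasCompactSupport {E : Type*} [NormedAddCommGroup E] {φ : E → ℝ}
    (hc : HasCompactSupport φ) : ∃ R, ∀ x, R < ‖x‖ → φ x = 0 := by
  obtain ⟨R, hR⟩ := hc.isCompact.isBounded.exists_norm_le
  refine ⟨R, fun x hx => ?_⟩
  by_contra h
  exact absurd (hR x (subset_tsupport φ h)) (not_le.2 hx)

theorem contDiff_partialDeriv {φ : Space → ℝ} (hφ : ContDiff ℝ ∞ φ) (j : Fin 3) :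
    ContDiff ℝ ∞ (partialDeriv j φ) :=
  (hφ.fderiv_right (m := ∞) (by simp)).clm_apply contDiff_const

theorem hasCompactSupport_partialDeriv {φ : Space → ℝ} (hφ : HasCompactSupport φ) (j : Fin 3) :
    HasCompactSupport (partialDeriv j φ) := hφ.fderiv_apply (𝕜 := ℝ) _

theorem hasFDerivAt_lift_left (x : Plane) (z : ℝ) :
    ∃ L : Plane →L[ℝ] Space, HasFDerivAt (fun x => lift x z) L x ∧
      ∀ j : Fin 2, L (EuclideanSpace.single j 1) = EuclideanSpace.single (Fin.castSucc j) 1 := by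
  let L : Plane →L[ℝ] Space := LinearMap.toContinuousLinearMap
    { toFun := fun y => lift y 0
      map_add' := fun y y' => by ext j; fin_cases j <;> simp
      map_smul' := fun c y => by ext j; fin_cases j <;> simp }
  refine ⟨L, ?_, fun j => ?_⟩
  · have : (fun x => lift x z) = fun x => L x + lift 0 z := by
      funext y
      ext j
      fin_cases j <;> simp [L]
    rw [this]
    exact L.hasFDerivAt.add_const _
  · ext i
    fin_cases j <;> fin_cases i <;> simp [L]

theorem contDiff_lift_left (z : ℝ) : ContDiff ℝ ∞ fun x => lift x z := by
  unfold lift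
  refine contDiff_euclidean.2 fun i => ?_
  fin_cases i <;> simp <;> fun_prop

theorem contDiff_horizontal : ContDiff ℝ ∞ horizontal := by
  unfold horizontal
  refine contDiff_euclidean.2 fun i => ?_
  fin_cases i <;> simp <;> fun_prop

theorem pd_comp_lift {φ : Space → ℝ} (hφ : ContDiff ℝ ∞ φ) (j : Fin 2) (z : ℝ) :
    pd j (fun x => φ (lift x z)) = fun x => partialDeriv (Fin.castSucc j) φ (lift x z) := by
  funext x
  obtain ⟨L, hL, hj⟩ := hasFDerivAt_lift_left x z
  have := ((hφ.differentiable (by simp) (lift x z)).hasFDerivAt.comp x hL).fderiv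
  unfold pd partialDeriv
  rw [← hj, ← ContinuousLinearMap.comp_apply, ← this]
  rfl

theorem hasDerivAt_comp_lift {φ : Space → ℝ} (hφ : ContDiff ℝ ∞ φ) (x : Plane) (z : ℝ) :
    HasDerivAt (fun z => φ (lift x z)) (partialDeriv 2 φ (lift x z)) z := by
  have h1 : HasDerivAt (fun z => lift x z) (EuclideanSpace.single 2 1 : Space) z := by
    have : (fun z => lift x z) = fun z => lift x 0 + z • (EuclideanSpace.single 2 1 : Space) := by
      funext s
      ext j
      fin_cases j <;> simp
    rw [this]
    simpa using ((hasDerivAt_id z).smul_const (EuclideanSpace.single 2 1 : Space)).const_add (lift x 0)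
  exact (hφ.differentiable (by simp) (lift x z)).hasFDerivAt.comp_hasDerivAt z h1

theorem norm_le_norm_lift (x : Plane) (z : ℝ) : ‖x‖ ≤ ‖lift x z‖ ∧ |z| ≤ ‖lift x z‖ := by
  have h := norm_sq_space (lift x z)
  rw [horizontal_lift, lift_two] at h
  exact ⟨abs_le_of_sq_le_sq' (by nlinarith [sq_nonneg z]) (norm_nonneg _) |>.2,
    abs_le_of_sq_le_sq (by nlinarith [sq_nonneg ‖x‖]) (norm_nonneg _)⟩

theorem hasCompactSupport_comp_lift_left {φ : Space → ℝ} (hc : HasCompactSupport φ) (z : ℝ) :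
    HasCompactSupport fun x => φ (lift x z) := by
  obtain ⟨R, hR⟩ := exists_eq_zero_of_hasCompactSupport hc
  refine HasCompactSupport.intro (isCompact_closedBall (0 : Plane) R) fun x hx => hR _ ?_
  rw [mem_closedBall_zero_iff, not_le] at hx
  exact hx.trans_le (norm_le_norm_lift x z).1

theorem hasCompactSupport_comp_lift_right {φ : Space → ℝ} (hc : HasCompactSupport φ) (x : Plane) :
    HasCompactSupport fun z => φ (lift x z) := by
  obtain ⟨R, hR⟩ := exists_eq_zero_of_hasCompactSupport hc
  refine HasCompactSupport.intro (isCompact_closedBall (0 : ℝ) R) fun z hx => hR _ ?_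
  rw [mem_closedBall_zero_iff, not_le, Real.norm_eq_abs] at hx
  exact hx.trans_le (norm_le_norm_lift x z).2

theorem integrable_horizontal_mul {k : Plane → ℝ} (hk : Integrable k) {φ : Space → ℝ}
    (hφ : Continuous φ) (hc : HasCompactSupport φ) :
    Integrable fun x => k (horizontal x) * φ x := by
  have := (locallyIntegrable_comp_horizontal hk).integrable_smul_left_of_hasCompactSupport hφ hc
  exact this.congr (.of_forall fun x => by simp [mul_comm])

/-- Vertical derivatives of test functions integrate to zero against horizontal functions. -/
theorem integral_horizontal_mul_partialDeriv {k : Plane → ℝ} (hk : Integrable k) {φ : Space → ℝ}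
    (hφ : ContDiff ℝ ∞ φ) (hc : HasCompactSupport φ) :
    ∫ x : Space, k (horizontal x) * partialDeriv 2 φ x = 0 := by
  have hi := integrable_space_iff.1 (integrable_horizontal_mul hk
    (contDiff_partialDeriv hφ 2).continuous (hasCompactSupport_partialDeriv hc 2))
  rw [integral_space, Measure.volume_eq_prod, integral_prod _ hi]
  refine integral_eq_zero_of_ae (.of_forall fun x => ?_)
  simp only [horizontal_lift, Pi.zero_apply]
  have hl : Continuous fun z => lift x z := continuous_lift.comp (continuous_const.prodMk continuous_id)
  rw [integral_const_mul, integral_eq_zero_of_hasDerivAt_of_integrable (hasDerivAt_comp_lift hφ x)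
    (((contDiff_partialDeriv hφ 2).continuous.comp hl).integrable_of_hasCompactSupport
      (hasCompactSupport_comp_lift_right (hasCompactSupport_partialDeriv hc 2) x))
    ((hφ.continuous.comp hl).integrable_of_hasCompactSupport
      (hasCompactSupport_comp_lift_right hc x)), mul_zero]

/-! ### Columnar stationary solutions -/

/-- The flux `u w` of the vorticity `w` in its own velocity field. -/
def selfFlux (w : Plane → ℝ) (x : Plane) (j : Fin 2) : ℝ := planeVelocity w x j * w x

/-- The third component of the vorticity equation, tested with `φ`. -/
def verticalTest (lam : ℝ) (w : Plane → ℝ) (φ : Space → ℝ) (x : Space) : ℝ :=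
  (∑ j : Fin 2, totalFlux lam w (selfFlux w) (horizontal x) j * partialDeriv (Fin.castSucc j) φ x)
    + w (horizontal x) * laplace φ x

/-- Fubini in the height. The vertical second derivative in the Laplacian integrates to zero, and
what remains is planar on each slice. -/
theorem integral_verticalTest {lam : ℝ} {w : Plane → ℝ} (hm : Integrable fun x => (1 + ‖x‖) * w x)
    (hf : ∀ j, Integrable fun x => selfFlux w x j) {φ : Space → ℝ} (hφ : ContDiff ℝ ∞ φ)
    (hc : HasCompactSupport φ) :
    ∫ x, verticalTest lam w φ x =
      ∫ z, ∫ x, weakIntegrand lam w (selfFlux w) (fun x => φ (lift x z)) x := by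
  have hk := fun j => integrable_totalFlux (lam := lam) hm hf j
  have hw := integrable_of_moment hm
  have hd := fun j => contDiff_partialDeriv hφ j
  have hdc := fun j => hasCompactSupport_partialDeriv hc j
  have i1 : ∀ j : Fin 2, Integrable fun x : Space =>
      totalFlux lam w (selfFlux w) (horizontal x) j * partialDeriv (Fin.castSucc j) φ x := fun j =>
    integrable_horizontal_mul (hk j) (hd _).continuous (hdc _)
  have i2 : ∀ j : Fin 3, Integrable fun x : Space =>
      w (horizontal x) * partialDeriv j (partialDeriv j φ) x := fun j =>
    integrable_horizontal_mul hw (contDiff_partialDeriv (hd j) j).continuous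
      (hasCompactSupport_partialDeriv (hdc j) j)
  have e : ∀ x, verticalTest lam w φ x =
      ((∑ j : Fin 2, totalFlux lam w (selfFlux w) (horizontal x) j * partialDeriv (Fin.castSucc j) φ x)
      + ∑ j : Fin 2, w (horizontal x) * partialDeriv (Fin.castSucc j) (partialDeriv (Fin.castSucc j) φ) x)
      + w (horizontal x) * partialDeriv 2 (partialDeriv 2 φ) x := fun x => by
    unfold verticalTest laplace
    rw [add_assoc, Fin.sum_univ_castSucc (n := 2) (fun j : Fin 3 => partialDeriv j (partialDeriv j φ) x),
      mul_add, Finset.mul_sum]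
    rfl
  have i3 : Integrable fun x =>
      ((∑ j : Fin 2, totalFlux lam w (selfFlux w) (horizontal x) j * partialDeriv (Fin.castSucc j) φ x)
      + ∑ j : Fin 2, w (horizontal x) *
        partialDeriv (Fin.castSucc j) (partialDeriv (Fin.castSucc j) φ) x) :=
    (integrable_finsetSum Finset.univ fun j _ => i1 j).add
    (integrable_finsetSum Finset.univ fun j _ => i2 (Fin.castSucc j))
  simp only [e]
  rw [integral_add i3 (i2 2), integral_horizontal_mul_partialDeriv hw (hd 2) (hdc 2), add_zero,
    integral_space, Measure.volume_eq_prod, integral_prod_symm _ (integrable_space_iff.1 i3)]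
  refine integral_congr_ae (.of_forall fun z => integral_congr_ae (.of_forall fun x => ?_))
  simp only [weakIntegrand, pd_comp_lift hφ, pd_comp_lift (hd _), horizontal_lift, Finset.mul_sum]

/-- One direction tests with products `c(x₃) ψ(x_⊥)`, where `∫ c > 0`; for the other, every
horizontal slice of a test function is a planar test function. -/
theorem integral_verticalTest_eq_zero_iff {lam : ℝ} {w : Plane → ℝ}
    (hm : Integrable fun x => (1 + ‖x‖) * w x) (hf : ∀ j, Integrable fun x => selfFlux w x j) :
    (∀ φ : Space → ℝ, ContDiff ℝ ∞ φ → HasCompactSupport φ → ∫ x, verticalTest lam w φ x = 0) ↔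
      Solves lam w (selfFlux w) := by
  constructor
  · refine fun h => solves_of_weak hm hf fun ψ hψ hc => ?_
    let c : ContDiffBump (0 : ℝ) := ⟨1, 2, one_pos, one_lt_two⟩
    let φ : Space → ℝ := fun x => c (x 2) * ψ (horizontal x)
    have hφ : ContDiff ℝ ∞ φ := (c.contDiff.comp (by fun_prop : ContDiff ℝ ∞ fun x : Space => x 2)).mul
      (hψ.comp contDiff_horizontal)
    have hφc : HasCompactSupport φ := by
      obtain ⟨R, hR⟩ := exists_eq_zero_of_hasCompactSupport hc
      obtain ⟨R', hR'⟩ := exists_eq_zero_of_hasCompactSupport c.hasCompactSupport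
      refine HasCompactSupport.intro (isCompact_closedBall (0 : Space) (|R| + |R'|)) fun x hx => ?_
      rw [mem_closedBall_zero_iff, not_le] at hx
      simp only [φ]
      by_contra hne
      have h1 : ‖horizontal x‖ ≤ |R| := by
        by_contra hh
        exact hne (by rw [hR _ ((le_abs_self R).trans_lt (not_le.1 hh)), mul_zero])
      have h2 : ‖x 2‖ ≤ |R'| := by
        by_contra hh
        exact hne (by rw [hR' _ ((le_abs_self R').trans_lt (not_le.1 hh)), zero_mul])
      have h3 := norm_sq_space x
      rw [← sq_abs (x 2), ← Real.norm_eq_abs] at h3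
      nlinarith [norm_nonneg (horizontal x), norm_nonneg (x 2), abs_nonneg R, abs_nonneg R',
        norm_nonneg x]
    have e : ∀ z x, weakIntegrand lam w (selfFlux w) (fun x => φ (lift x z)) x =
        c z * weakIntegrand lam w (selfFlux w) ψ x := fun z x => by
      have e1 : (fun x => φ (lift x z)) = fun x => c z * ψ x := by
        funext x
        simp [φ]
      simp only [weakIntegrand, e1, pd_const_mul hψ, pd_const_mul (contDiff_pd hψ _), Fin.sum_univ_two]
      ring
    have h0 := h φ hφ hφc
    rw [integral_verticalTest hm hf hφ hφc] at h0
    simp only [e, integral_const_mul, integral_mul_const] at h0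
    exact (mul_eq_zero.1 h0).resolve_left (c.integral_pos (μ := volume)).ne'
  · intro h φ hφ hc
    rw [integral_verticalTest hm hf hφ hc]
    exact integral_eq_zero_of_ae (.of_forall fun z => h.weak hm hf (hφ.comp (contDiff_lift_left z))
      (hasCompactSupport_comp_lift_left hc z))

/-- The horizontal equations carry no information: only the terms with `∂₃ φ` survive, and they
integrate to zero against functions of `x_⊥`. In the vertical equation the terms with `∂₃ φ` cancel,
and `γⱼ = -αⱼ` turns the strain into the drift of `totalFlux`. -/
theorem isStationarySolution_iff {lam : ℝ} {w : Plane → ℝ} (hm : Integrable fun x => (1 + ‖x‖) * w x)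
    (hv : ∀ᵐ x, absVelocity w x < ⊤) (hf : ∀ j, Integrable fun x => selfFlux w x j) :
    IsStationarySolution (strainRate lam) (verticalField w) ↔ Solves lam w (selfFlux w) := by
  have hw := integrable_of_moment hm
  have hU : ∀ᵐ x : Space, biotSavart (verticalField w) x =
      !₂[planeVelocity w (horizontal x) 0, planeVelocity w (horizontal x) 1, 0] :=
    (ae_horizontal hv).mono fun x hx => biotSavart_verticalField hw.aestronglyMeasurable hx
  have hΩ : ∀ x : Space, verticalField w x = !₂[0, 0, w (horizontal x)] := fun x => rfl
  have eq2 : ∀ φ : Space → ℝ, ∫ x : Space, ((∑ j : Fin 3,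
          ((biotSavart (verticalField w) x j + strain (strainRate lam) x j) * verticalField w x 2
            - verticalField w x j * (biotSavart (verticalField w) x 2 + strain (strainRate lam) x 2))
              * partialDeriv j φ x) + verticalField w x 2 * laplace φ x) =
      ∫ x, verticalTest lam w φ x := fun φ => by
    refine integral_congr_ae (hU.mono fun x hx => ?_)
    simp only [hx, hΩ, verticalTest, Fin.sum_univ_three, Fin.sum_univ_two, strain, strainRate,
      totalFlux, selfFlux, rate]
    simp
    ring
  rw [← integral_verticalTest_eq_zero_iff hm hf]
  constructor
  · intro h φ hφ hc
    rw [← eq2]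
    exact h.equation φ hφ hc 2
  · intro h
    refine ⟨?_, (ae_horizontal hv).mono fun x hx =>
      integrable_biotSavartIntegrand hw.aestronglyMeasurable hx, fun i j => ?_, fun φ hφ hc => ?_,
      fun φ hφ hc i => ?_⟩
    · have e : verticalField w = fun x => w (horizontal x) • (EuclideanSpace.single 2 1 : Space) := by
        funext x
        rw [hΩ]
        ext j
        fin_cases j <;> simp
      have hl := locallyIntegrable_comp_horizontal hw
      rw [e]
      exact hl.mono (hl.aestronglyMeasurable.smul_const _) (.of_forall fun x => by
        rw [norm_smul]; simp)
    · obtain ⟨k, hk, e⟩ : ∃ k : Plane → ℝ, Integrable k ∧ ∀ᵐ x : Space,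
          k (horizontal x) = biotSavart (verticalField w) x j * verticalField w x i := by
        have h0 : ∀ k : Plane → ℝ, (∀ x, k x = 0) → Integrable k := fun k hk => by
          rw [funext hk]
          exact integrable_zero _ _ _
        fin_cases i
        · exact ⟨fun _ => 0, h0 _ fun _ => rfl, .of_forall fun x => by simp [hΩ]⟩
        · exact ⟨fun _ => 0, h0 _ fun _ => rfl, .of_forall fun x => by simp [hΩ]⟩
        · fin_cases j
          · exact ⟨_, hf 0, hU.mono fun x hx => by simp [hx, hΩ, selfFlux]⟩
          · exact ⟨_, hf 1, hU.mono fun x hx => by simp [hx, hΩ, selfFlux]⟩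
          · exact ⟨fun _ => 0, h0 _ fun _ => rfl, hU.mono fun x hx => by simp [hx]⟩
      have hl := locallyIntegrable_comp_horizontal hk
      exact hl.mono (hl.aestronglyMeasurable.congr e) (e.mono fun x hx => by rw [hx])
    · have e : ∀ x, ∑ j : Fin 3, verticalField w x j * partialDeriv j φ x =
          w (horizontal x) * partialDeriv 2 φ x := fun x => by
        simp [hΩ, Fin.sum_univ_three]
      simp only [e]
      exact integral_horizontal_mul_partialDeriv hw hφ hc
    · have hside : ∀ i : Fin 2, ∫ x : Space, ((∑ j : Fin 3,
          ((biotSavart (verticalField w) x j + strain (strainRate lam) x j)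
            * verticalField w x (Fin.castSucc i) - verticalField w x j
            * (biotSavart (verticalField w) x (Fin.castSucc i) + strain (strainRate lam) x (Fin.castSucc i)))
              * partialDeriv j φ x) + verticalField w x (Fin.castSucc i) * laplace φ x) = 0 := fun i => by
        have := integral_horizontal_mul_partialDeriv
          (integrable_totalFlux (lam := lam) hm hf i).neg hφ hc
        rw [← this]
        refine integral_congr_ae (hU.mono fun x hx => ?_)
        simp only [hx, hΩ, Fin.sum_univ_three, strain, strainRate, totalFlux, selfFlux, rate,
          Pi.neg_apply]
        fin_cases i <;> simp <;> ring_nf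
      fin_cases i
      · exact hside 0
      · exact hside 1
      · exact (eq2 φ).trans (h φ hφ hc)

end BurgersVortex

end


/-! ### Membership in `L²(m)`, linearity, and bounds for the nonlinear operators. -/

noncomputable section

namespace BurgersVortex

open ENNReal

variable {m : ℝ}

/-! ### The weighted spaces -/

theorem measurable_weightedDensity (m : ℝ) :
    Measurable fun x : Plane => ENNReal.ofReal (weight x ^ (2 * m)) :=
  (continuous_weight.measurable.pow_const _).ennreal_ofReal

/-- The density is positive everywhere, so the two measures have the same null sets and almost
everywhere statements pass between them. -/
theorem ae_weightedMeasure (m : ℝ) : ae (weightedMeasure m) = ae (volume : Measure Plane) := by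
  refine le_antisymm (withDensity_absolutelyContinuous _ _).ae_le ?_
  refine (withDensity_absolutelyContinuous' (measurable_weightedDensity m).aemeasurable
    (.of_forall fun x => ?_)).ae_le
  exact (ENNReal.ofReal_pos.2 (Real.rpow_pos_of_pos (weight_pos x) _)).ne'

theorem aestronglyMeasurable_weightedMeasure {h : Plane → ℝ} :
    AEStronglyMeasurable h (weightedMeasure m) ↔ AEStronglyMeasurable h :=
  ⟨fun H => ⟨H.mk h, H.stronglyMeasurable_mk, by
    have := H.ae_eq_mk
    rwa [Filter.EventuallyEq, ae_weightedMeasure] at this⟩,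
  fun H => ⟨H.mk h, H.stronglyMeasurable_mk, by
    have := H.ae_eq_mk
    rwa [Filter.EventuallyEq, ae_weightedMeasure]⟩⟩

theorem expNorm_eq_eLpNorm (m ε : ℝ) (h : Plane → ℝ) :
    expNorm m ε h = eLpNorm (fun x => expWeight m ε x * h x) 2 volume := by
  rw [eLpNorm_eq_lintegral_rpow_enorm_toReal (by norm_num) (by norm_num)]
  unfold expNorm lnorm
  simp only [enorm_mul, ENNReal.toReal_ofNat, one_div, inv_inv,
    Real.enorm_of_nonneg (expWeight_pos m ε _).le]

theorem weightedNorm_eq_expNorm (m : ℝ) (h : Plane → ℝ) : weightedNorm m h = expNorm m 0 h := by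
  unfold weightedNorm expNorm lnorm weightedMeasure
  rw [eLpNorm_eq_lintegral_rpow_enorm_toReal (by norm_num) (by norm_num),
    lintegral_withDensity_eq_lintegral_mul_non_measurable₀ _
      (measurable_weightedDensity m).aemeasurable (.of_forall fun _ => ENNReal.ofReal_lt_top)]
  simp only [ENNReal.toReal_ofNat, one_div, inv_inv]
  congr 1
  refine lintegral_congr fun x => ?_
  have h0 := weight_pos x
  simp only [Pi.mul_apply]
  rw [ENNReal.mul_rpow_of_nonneg _ _ zero_le_two, ENNReal.ofReal_rpow_of_nonneg
    (expWeight_pos _ _ _).le zero_le_two]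
  congr 2
  unfold expWeight
  rw [zero_mul, Real.exp_zero, mul_one, ← Real.rpow_mul h0.le, mul_comm]

theorem memLp_weighted_iff {h : Plane → ℝ} :
    MemLp h 2 (weightedMeasure m) ↔ AEStronglyMeasurable h ∧ expNorm m 0 h < ⊤ := by
  rw [← weightedNorm_eq_expNorm, ← aestronglyMeasurable_weightedMeasure (m := m)]
  rfl

theorem expNorm_add_le {ε : ℝ} {f g : Plane → ℝ} (hf : AEStronglyMeasurable f)
    (hg : AEStronglyMeasurable g) :
    expNorm m ε (fun x => f x + g x) ≤ expNorm m ε f + expNorm m ε g := by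
  have hw := (continuous_expWeight m ε).aestronglyMeasurable (μ := (volume : Measure Plane))
  simp only [expNorm_eq_eLpNorm, mul_add]
  exact eLpNorm_add_le (hw.mul hf) (hw.mul hg) (by norm_num)

theorem expNorm_const_mul (ε c : ℝ) (f : Plane → ℝ) :
    expNorm m ε (fun x => c * f x) = ENNReal.ofReal |c| * expNorm m ε f := by
  simp only [expNorm_eq_eLpNorm, mul_left_comm _ c]
  have := eLpNorm_const_smul c (fun x => expWeight m ε x * f x) 2 (volume : Measure Plane)
  rw [← Real.norm_eq_abs, ofReal_norm]
  exact this

theorem integrable_moment (hm : 3 / 2 < m) {h : Plane → ℝ} (hh : MemLp h 2 (weightedMeasure m)) :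
    Integrable fun x => (1 + ‖x‖) * h x := by
  rw [memLp_weighted_iff] at hh
  obtain ⟨C, hC, hb⟩ := lintegral_moment_le hm
  refine ⟨(Continuous.aestronglyMeasurable (by fun_prop)).mul hh.1, ?_⟩
  refine lt_of_eq_of_lt (lintegral_congr fun x => ?_)
    ((hb 0 le_rfl h hh.1).trans_lt (ENNReal.mul_lt_top hC.lt_top hh.2))
  rw [enorm_mul, Real.enorm_of_nonneg (by positivity)]

theorem ae_absVelocity_lt_top (hm : 3 / 2 < m) {h : Plane → ℝ} (hh : MemLp h 2 (weightedMeasure m)) :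
    ∀ᵐ x, absVelocity h x < ⊤ := by
  have hi := integrable_of_moment (integrable_moment hm hh)
  rw [memLp_weighted_iff] at hh
  obtain ⟨C, hC, hb⟩ := lnorm_absVelocity_le (θ := 1 / 4) (by norm_num) (by norm_num)
  have h1 : lnorm (1 / 4) volume (absVelocity h) < ⊤ := by
    refine (hb h hh.1).trans_lt (ENNReal.mul_lt_top hC.lt_top (ENNReal.add_lt_top.2 ⟨hi.2, ?_⟩))
    exact (lnorm_enorm_le_expNorm (by linarith) le_rfl h).trans_lt hh.2
  unfold lnorm at h1
  rw [ENNReal.rpow_lt_top_iff_of_pos (by norm_num)] at h1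
  filter_upwards [ae_lt_top' ((aemeasurable_absVelocity hh.1).pow_const _) h1.ne] with x hx
  rwa [ENNReal.rpow_lt_top_iff_of_pos (by norm_num)] at hx

theorem integrable_of_lintegral_size {f : Plane → Fin 2 → ℝ}
    (hf : ∀ j, AEStronglyMeasurable fun x => f x j) (h : ∫⁻ z, ∑ j, ‖f z j‖ₑ < ⊤) (j : Fin 2) :
    Integrable fun x => f x j :=
  ⟨hf j, lt_of_le_of_lt (lintegral_mono fun x =>
    Finset.single_le_sum (f := fun j => ‖f x j‖ₑ) (fun _ _ => zero_le) (Finset.mem_univ j)) h⟩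

theorem integrable_flux (hm : 3 / 2 < m) {a b : Plane → ℝ} (ha : MemLp a 2 (weightedMeasure m))
    (hb : MemLp b 2 (weightedMeasure m)) (j : Fin 2) : Integrable fun x => flux a b x j := by
  rw [memLp_weighted_iff] at ha hb
  obtain ⟨C, hC, h1⟩ := lintegral_size_le hm (κ := 1 / 4) (by norm_num) (by norm_num)
  obtain ⟨C', hC', h2⟩ := lnorm_weightedSize_flux_le (m := m) (κ := 1 / 4) (by norm_num)
    (by norm_num) hm
  have hf := fun j => aestronglyMeasurable_flux ha.1 hb.1 j
  refine integrable_of_lintegral_size hf ?_ j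
  refine (h1 0 le_rfl _ fun j => (hf j).aemeasurable).trans_lt
    (ENNReal.mul_lt_top hC.lt_top ((h2 0 le_rfl a b ha.1 hb.1).trans_lt ?_))
  exact ENNReal.mul_lt_top (ENNReal.mul_lt_top hC'.lt_top ha.2) hb.2

/-! ### Linearity of the flux -/

theorem flux_symm (a b : Plane → ℝ) : flux a b = flux b a := by
  funext x j
  exact add_comm _ _

theorem planeVelocity_add_mul {a b : Plane → ℝ} (ha : AEStronglyMeasurable a)
    (hb : AEStronglyMeasurable b) (c : ℝ) {x : Plane} (hxa : absVelocity a x < ⊤)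
    (hxb : absVelocity b x < ⊤) (j : Fin 2) :
    planeVelocity (fun y => a y + c * b y) x j = planeVelocity a x j + c * planeVelocity b x j := by
  unfold planeVelocity
  rw [← integral_const_mul, ← integral_add (integrable_planeKernel_mul ha hxa j)
    ((integrable_planeKernel_mul hb hxb j).const_mul c)]
  refine integral_congr_ae (.of_forall fun y => ?_)
  simp only
  ring

theorem flux_add_mul (hm : 3 / 2 < m) {a a' : Plane → ℝ} (b : Plane → ℝ)
    (ha : MemLp a 2 (weightedMeasure m)) (ha' : MemLp a' 2 (weightedMeasure m)) (c : ℝ) :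
    ∀ᵐ x, ∀ j, flux (fun y => a y + c * a' y) b x j = flux a b x j + c * flux a' b x j := by
  filter_upwards [ae_absVelocity_lt_top hm ha, ae_absVelocity_lt_top hm ha'] with x h1 h2 j
  unfold flux
  rw [planeVelocity_add_mul (memLp_weighted_iff.1 ha).1 (memLp_weighted_iff.1 ha').1 c h1 h2]
  ring

theorem planeVelocity_congr {a a' : Plane → ℝ} (h : a =ᵐ[volume] a') :
    planeVelocity a = planeVelocity a' := by
  funext x j
  exact integral_congr_ae (h.mono fun y hy => by simp only [hy])

theorem flux_congr {a a' b b' : Plane → ℝ} (ha : a =ᵐ[volume] a') (hb : b =ᵐ[volume] b') :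
    ∀ᵐ x, ∀ j, flux a b x j = flux a' b' x j := by
  filter_upwards [ha, hb] with x h1 h2 j
  unfold flux
  rw [planeVelocity_congr ha, planeVelocity_congr hb, h1, h2]

theorem selfFlux_eq (w : Plane → ℝ) : selfFlux w = fun x j => 1 / 2 * flux w w x j := by
  funext x j
  unfold selfFlux flux
  ring

theorem invDiv_congr {lam : ℝ} {f g : Plane → Fin 2 → ℝ} (h : ∀ᵐ x, ∀ j, f x j = g x j) :
    invDiv lam f = invDiv lam g := by
  funext x
  unfold invDiv
  congr 1
  refine integral_congr_ae ?_
  have : ∀ᵐ p : ℝ × Plane ∂((volume.restrict (Ioi (0 : ℝ))).prod volume), ∀ j, f p.2 j = g p.2 j :=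
    Measure.quasiMeasurePreserving_snd.ae h
  filter_upwards [this] with p hp
  simp only [hp]

theorem invDiv_const_mul (lam c : ℝ) (f : Plane → Fin 2 → ℝ) (x : Plane) :
    invDiv lam (fun y j => c * f y j) x = c * invDiv lam f x := by
  unfold invDiv
  rw [mul_neg, ← integral_const_mul]
  congr 1
  refine integral_congr_ae (.of_forall fun p => ?_)
  simp only [Finset.mul_sum]
  exact Finset.sum_congr rfl fun j _ => by ring

/-- Additivity holds at the points where both integrals converge absolutely, which is almost
everywhere. -/
theorem invDiv_add {lam δ : ℝ} (hδ : 0 < δ) (hr : ∀ j, rate lam j ∈ Icc δ 1)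
    {f g : Plane → Fin 2 → ℝ} (hf : ∀ j, Integrable fun x => f x j)
    (hg : ∀ j, Integrable fun x => g x j) :
    invDiv lam (fun x j => f x j + g x j) =ᵐ[volume] fun x => invDiv lam f x + invDiv lam g x := by
  filter_upwards [(integrable_mehler_mul hδ hr hf).prod_left_ae,
    (integrable_mehler_mul hδ hr hg).prod_left_ae] with x h1 h2
  unfold invDiv
  rw [← neg_add, ← integral_add h1 h2]
  congr 1
  refine integral_congr_ae (.of_forall fun p => ?_)
  simp only [← Finset.sum_add_distrib, mul_add]

/-! ### Bounds for the operators -/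

theorem expNorm_invDiv_le (hm : 0 ≤ m) {δ : ℝ} (hδ : 0 < δ) (hδ1 : δ ≤ 1 / 2) :
    ∃ C : ℝ≥0∞, C ≠ ⊤ ∧ ∀ ε ∈ Icc (0 : ℝ) 1, ∀ lam, (∀ j, rate lam j ∈ Icc δ 1) →
      ∀ f : Plane → Fin 2 → ℝ, (∀ j, AEMeasurable fun z => f z j) →
      expNorm m ε (invDiv lam f) ≤ C * lnorm (1 - δ / 2) volume (weightedSize m ε f) := by
  obtain ⟨C, hC, h⟩ := lnorm_absInvDiv_le hm hδ hδ1
  refine ⟨C, hC, fun ε hε lam hr f hf => (lnorm_mono (by norm_num) (.of_forall fun x => ?_)).trans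
    (h ε hε lam hr f hf)⟩
  exact mul_le_mul_right (enorm_invDiv_le lam f x) _

/-- The central bilinear estimate. Taking `κ = δ/2` matches the integrability of the flux with the
domain of `invDiv`; there is no loss in `ε`, and the constant depends on the asymmetry only through
`δ`. -/
theorem expNorm_invDiv_flux_le (hm : 3 / 2 < m) {δ : ℝ} (hδ : 0 < δ) (hδ1 : δ ≤ 1 / 2) :
    ∃ C : ℝ≥0∞, C ≠ ⊤ ∧ ∀ ε ∈ Icc (0 : ℝ) 1, ∀ lam, (∀ j, rate lam j ∈ Icc δ 1) →
      ∀ a b : Plane → ℝ, AEStronglyMeasurable a → AEStronglyMeasurable b →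
      expNorm m ε (invDiv lam (flux a b)) ≤ C * expNorm m ε a * expNorm m ε b := by
  obtain ⟨C, hC, h⟩ := expNorm_invDiv_le (m := m) (by linarith) hδ hδ1
  obtain ⟨C', hC', h'⟩ := lnorm_weightedSize_flux_le (m := m) (κ := δ / 2) (by linarith)
    (by linarith) hm
  refine ⟨C * C', by finiteness, fun ε hε lam hr a b ha hb => ?_⟩
  refine (h ε hε lam hr _ fun j => (aestronglyMeasurable_flux ha hb j).aemeasurable).trans ?_
  rw [mul_assoc, mul_assoc, ← mul_assoc C']
  exact mul_le_mul_right (h' ε hε.1 a b ha hb) _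

theorem expNorm_invDiv_shear_le (hm : 3 / 2 < m) {δ : ℝ} (hδ : 0 < δ) (hδ1 : δ ≤ 1 / 2)
    {ε ε' : ℝ} (hε' : ε' ∈ Icc (0 : ℝ) 1) (h : ε' < ε) :
    ∃ C : ℝ≥0∞, C ≠ ⊤ ∧ ∀ lam, (∀ j, rate lam j ∈ Icc δ 1) →
      ∀ f : Plane → ℝ, AEStronglyMeasurable f →
      expNorm m ε' (invDiv lam (shear f)) ≤ C * expNorm m ε f := by
  obtain ⟨C, hC, h1⟩ := expNorm_invDiv_le (m := m) (by linarith) hδ hδ1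
  obtain ⟨C', hC', h2⟩ := lnorm_weightedSize_shear_le (m := m) (κ := δ / 2) (by linarith)
    (by linarith) h
  refine ⟨C * C', by finiteness, fun lam hr f hf => ?_⟩
  refine (h1 ε' hε' lam hr _ fun j => (aestronglyMeasurable_shear hf j).aemeasurable).trans ?_
  rw [mul_assoc]
  exact mul_le_mul_right (h2 f hf) _

theorem continuous_gaussianVortex (lam : ℝ) : Continuous (gaussianVortex lam) := by
  unfold gaussianVortex
  fun_prop

/-- Rates of at least `δ` bound the vortex by `exp (-δ ‖x‖² / 2)`. Half of this Gaussian absorbs the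
strongest weight, the other half is square integrable. -/
theorem expNorm_gaussianVortex_le (hm : 0 ≤ m) {δ : ℝ} (hδ : 0 < δ) :
    ∃ C : ℝ≥0∞, C ≠ ⊤ ∧ ∀ lam, (∀ j, rate lam j ∈ Icc δ 1) →
      expNorm m 1 (gaussianVortex lam) ≤ C := by
  set g : Plane → ℝ≥0∞ := fun x =>
    ENNReal.ofReal (Real.exp ((2 * m + 1) ^ 2 / (4 * (δ / 4)))) *
      ENNReal.ofReal (Real.exp (-(δ / 4) * ‖x‖ ^ 2))
  refine ⟨lnorm (1 / 2) volume g, ?_, fun lam hr =>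
    lnorm_mono (by norm_num) (.of_forall fun x => ?_)⟩
  · rw [lnorm_const_mul (by norm_num) _ ENNReal.ofReal_ne_top]
    refine ENNReal.mul_ne_top ENNReal.ofReal_ne_top ?_
    unfold lnorm
    refine ENNReal.rpow_ne_top_of_nonneg (by norm_num) ?_
    have := lintegral_gaussian_plane (b := δ / 2) (by positivity) one_pos one_pos 0
    refine ne_of_eq_of_ne (Eq.trans (lintegral_congr fun x => ?_) this) ENNReal.ofReal_ne_top
    rw [ENNReal.ofReal_rpow_of_nonneg (Real.exp_pos _).le (by norm_num), ← Real.exp_mul,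
      norm_sq_plane]
    simp
    ring_nf
  · simp only [g]
    rw [Real.enorm_of_nonneg (by unfold gaussianVortex; positivity),
      ← ENNReal.ofReal_mul (expWeight_pos _ _ _).le, ← ENNReal.ofReal_mul (Real.exp_pos _).le]
    refine ENNReal.ofReal_le_ofReal ?_
    have h1 := expWeight_mul_exp_le hm (c := δ / 4) (by positivity) x
    have h0 := hr 0
    have h1' := hr 1
    simp only [rate, Matrix.cons_val_zero, Matrix.cons_val_one, mem_Icc] at h0 h1'
    have h2 : gaussianVortex lam x ≤ 1 * Real.exp (-(δ / 4) * ‖x‖ ^ 2 + -(δ / 4) * ‖x‖ ^ 2) := by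
      unfold gaussianVortex
      refine mul_le_mul ?_ (Real.exp_le_exp.2 ?_) (Real.exp_pos _).le zero_le_one
      · rw [div_le_one (by positivity)]
        refine (Real.sqrt_le_one.2 (by nlinarith [sq_nonneg lam])).trans ?_
        linarith [Real.pi_gt_three]
      · rw [norm_sq_plane]
        nlinarith [mul_nonneg (sub_nonneg.2 h0.1) (sq_nonneg (x 0)),
          mul_nonneg (sub_nonneg.2 h1'.1) (sq_nonneg (x 1))]
    calc expWeight m 1 x * gaussianVortex lam x
        ≤ expWeight m 1 x * (1 * Real.exp (-(δ / 4) * ‖x‖ ^ 2 + -(δ / 4) * ‖x‖ ^ 2)) :=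
          mul_le_mul_of_nonneg_left h2 (expWeight_pos _ _ _).le
      _ = expWeight m 1 x * Real.exp (-(δ / 4) * ‖x‖ ^ 2) * Real.exp (-(δ / 4) * ‖x‖ ^ 2) := by
          rw [Real.exp_add]
          ring
      _ ≤ _ := by gcongr

/-! ### Uniqueness and the dependence on the asymmetry -/

theorem memLp_invDiv_flux (hm : 3 / 2 < m) {lam δ : ℝ} (hδ : 0 < δ) (hδ1 : δ ≤ 1 / 2)
    (hr : ∀ j, rate lam j ∈ Icc δ 1) {a b : Plane → ℝ} (ha : MemLp a 2 (weightedMeasure m))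
    (hb : MemLp b 2 (weightedMeasure m)) :
    MemLp (invDiv lam (flux a b)) 2 (weightedMeasure m) := by
  have hi := integrable_invDiv hδ hr fun j => integrable_flux hm ha hb j
  rw [memLp_weighted_iff] at ha hb ⊢
  obtain ⟨C, hC, h⟩ := expNorm_invDiv_flux_le hm hδ hδ1
  refine ⟨hi.aestronglyMeasurable, (h 0 ⟨le_rfl, zero_le_one⟩ lam hr a b ha.1 hb.1).trans_lt ?_⟩
  exact ENNReal.mul_lt_top (ENNReal.mul_lt_top hC.lt_top ha.2) hb.2

theorem memLp_gaussianVortex (hm : 0 ≤ m) {lam δ : ℝ} (hδ : 0 < δ) (hr : ∀ j, rate lam j ∈ Icc δ 1) :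
    MemLp (gaussianVortex lam) 2 (weightedMeasure m) := by
  rw [memLp_weighted_iff]
  obtain ⟨C, hC, h⟩ := expNorm_gaussianVortex_le hm hδ
  exact ⟨(continuous_gaussianVortex lam).aestronglyMeasurable,
    (expNorm_mono zero_le_one _).trans_lt ((h lam hr).trans_lt hC.lt_top)⟩

/-- Solutions of the equation at one value of the asymmetry, expressed at another one. -/
theorem Solves.eq_sub {lam mu δ δ' : ℝ} (hδ : 0 < δ) (hδ' : 0 < δ') (hr : ∀ j, rate lam j ∈ Icc δ 1)
    (hr' : ∀ j, rate mu j ∈ Icc δ' 1) {h : Plane → ℝ} {f : Plane → Fin 2 → ℝ}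
    (hs : Solves lam h f) (hm : Integrable fun x => (1 + ‖x‖) * h x)
    (hf : ∀ j, Integrable fun x => f x j) :
    h =ᵐ[volume] fun x => (∫ y, h y) * gaussianVortex mu x + invDiv mu f x
      - (lam - mu) * invDiv mu (shear h) x := by
  have hsh := fun j => integrable_shear hm j
  have h1 := (hs.change_rate (mu := mu) (fun j => ⟨hδ.le.trans (hr j).1, (hr j).2⟩) hm hf).ae_eq hδ' hr'
    hm fun j => (hf j).add ((hsh j).const_mul _)
  have h2 := invDiv_add hδ' hr' hf fun j => (hsh j).const_mul (mu - lam)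
  filter_upwards [h1, h2] with x e1 e2
  rw [e1, e2, invDiv_const_mul]
  ring

end BurgersVortex

end


/-! ### The Banach space `L²(m)` and fixed points in two norms. -/

noncomputable section

namespace BurgersVortex

open Filter Topology

/-! ### The space `L²(m)` -/

section Space

variable {m : ℝ}

open Classical in
/-- The class of a function in `L²(m)`, zero if the norm is infinite. -/
def toWeightedL2 (m : ℝ) (h : Plane → ℝ) : WeightedL2 m :=
  if hh : MemLp h 2 (weightedMeasure m) then hh.toLp h else 0

theorem coe_toWeightedL2 {h : Plane → ℝ} (hh : MemLp h 2 (weightedMeasure m)) :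
    toWeightedL2 m h =ᵐ[volume] h := by
  have := hh.coeFn_toLp
  unfold toWeightedL2
  rw [dif_pos hh]
  rwa [EventuallyEq, ae_weightedMeasure] at this

theorem weightedL2_ext {a b : WeightedL2 m} (h : a =ᵐ[volume] b) : a = b := by
  refine Lp.ext ?_
  rwa [EventuallyEq, ae_weightedMeasure]

theorem coe_add_weightedL2 (a b : WeightedL2 m) : ⇑(a + b) =ᵐ[volume] fun x => a x + b x := by
  have := Lp.coeFn_add a b
  rwa [EventuallyEq, ae_weightedMeasure] at this

theorem coe_sub_weightedL2 (a b : WeightedL2 m) : ⇑(a - b) =ᵐ[volume] fun x => a x - b x := by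
  have := Lp.coeFn_sub a b
  rwa [EventuallyEq, ae_weightedMeasure] at this

theorem coe_smul_weightedL2 (c : ℝ) (a : WeightedL2 m) :
    ⇑(c • a) =ᵐ[volume] fun x => c * a x := by
  have := Lp.coeFn_smul c a
  rwa [EventuallyEq, ae_weightedMeasure] at this

theorem aestronglyMeasurable_coe (a : WeightedL2 m) : AEStronglyMeasurable a :=
  aestronglyMeasurable_weightedMeasure.1 (Lp.aestronglyMeasurable a)

theorem enorm_eq_expNorm (a : WeightedL2 m) : ‖a‖ₑ = expNorm m 0 a := by
  rw [Lp.enorm_def, ← weightedNorm_eq_expNorm, weightedNorm]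

theorem norm_eq_expNorm (a : WeightedL2 m) : ‖a‖ = (expNorm m 0 a).toReal := by
  rw [← enorm_eq_expNorm, toReal_enorm]

theorem expNorm_coe_add_le (ε : ℝ) (a b : WeightedL2 m) :
    expNorm m ε ⇑(a + b) ≤ expNorm m ε a + expNorm m ε b := by
  rw [expNorm_congr (coe_add_weightedL2 a b)]
  exact expNorm_add_le (aestronglyMeasurable_coe a) (aestronglyMeasurable_coe b)

theorem expNorm_coe_smul (ε c : ℝ) (a : WeightedL2 m) :
    expNorm m ε ⇑(c • a) = ENNReal.ofReal |c| * expNorm m ε a := by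
  rw [expNorm_congr (coe_smul_weightedL2 c a), expNorm_const_mul]

theorem expNorm_coe_zero {ε : ℝ} : expNorm m ε (0 : WeightedL2 m) = 0 := by
  rw [← zero_smul ℝ (0 : WeightedL2 m), expNorm_coe_smul, abs_zero, ENNReal.ofReal_zero, zero_mul]

theorem expNorm_coe_lt_top (a : WeightedL2 m) : expNorm m 0 a < ⊤ := by
  rw [← enorm_eq_expNorm]
  exact enorm_lt_top

/-- Fatou's lemma for the exponentially weighted norms. -/
theorem isClosed_expNorm_le (ε : ℝ) (r : ENNReal) :
    IsClosed {a : WeightedL2 m | expNorm m ε a ≤ r} := by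
  refine IsSeqClosed.isClosed fun u a hu ha => ?_
  obtain ⟨ns, hns, h⟩ := (tendstoInMeasure_of_tendsto_Lp ha).exists_seq_tendsto_ae
  rw [ae_weightedMeasure] at h
  have hw := (continuous_expWeight m ε).aestronglyMeasurable (μ := (volume : Measure Plane))
  have h1 := Lp.eLpNorm_lim_le_liminf_eLpNorm (p := 2) (μ := (volume : Measure Plane))
    (f := fun n x => expWeight m ε x * u (ns n) x)
    (fun n => hw.mul (aestronglyMeasurable_coe _)) (fun x => expWeight m ε x * a x)
    (h.mono fun x hx => hx.const_mul _)
  simp only [← expNorm_eq_eLpNorm] at h1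
  refine h1.trans ?_
  exact liminf_le_of_le (by isBoundedDefault) fun b hb => by
    obtain ⟨n, hn⟩ := hb.exists
    exact hn.trans (hu (ns n))

end Space

/-! ### Quadratic equations in `L²(m)` -/

theorem exists_fixedPoint_of_half {X : Type*} [NormedAddCommGroup X] [CompleteSpace X] {s : Set X}
    (hs : IsClosed s) (hne : s.Nonempty) {f : X → X} (hf : MapsTo f s s)
    (h : ∀ a ∈ s, ∀ b ∈ s, ‖f a - f b‖ ≤ 1 / 2 * ‖a - b‖) : ∃ a ∈ s, f a = a := by
  obtain ⟨x, hx⟩ := hne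
  have hc : ContractingWith (1 / 2) (hf.restrict f s s) := by
    refine ⟨by rw [← NNReal.coe_lt_coe]; norm_num, LipschitzWith.of_dist_le_mul fun a b => ?_⟩
    have := h a a.2 b b.2
    rw [← dist_eq_norm, ← dist_eq_norm] at this
    rw [NNReal.coe_div, NNReal.coe_one, NNReal.coe_ofNat]
    exact this
  obtain ⟨y, hy, h1, -⟩ := hc.exists_fixedPoint' hs.isComplete hf hx (edist_ne_top _ _)
  exact ⟨y, hy, h1⟩

section Quadratic

variable {m : ℝ} {B : WeightedL2 m →ₗ[ℝ] WeightedL2 m →ₗ[ℝ] WeightedL2 m} {C : ℝ}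

theorem norm_bilin_le (hC : 0 ≤ C)
    (hB : ∀ a b, expNorm m 0 (B a b) ≤ ENNReal.ofReal C * expNorm m 0 a * expNorm m 0 b)
    (a b : WeightedL2 m) : ‖B a b‖ ≤ C * ‖a‖ * ‖b‖ := by
  have := ENNReal.toReal_mono (by
    have := expNorm_coe_lt_top a
    have := expNorm_coe_lt_top b
    finiteness) (hB a b)
  rw [ENNReal.toReal_mul, ENNReal.toReal_mul, ENNReal.toReal_ofReal hC] at this
  simpa only [norm_eq_expNorm] using this

theorem bilin_self_sub (hsym : ∀ a b, B a b = B b a) (a b : WeightedL2 m) :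
    B a a - B b b = B (a - b) (a + b) := by
  simp only [map_sub, map_add, LinearMap.sub_apply, hsym a b]
  abel

/-- The iteration preserves the ball of radius `2 |ρ| g` in the norm with `ε = 1`, where the
quadratic term is at most `|ρ| g / 4`. It contracts in the norm of `L²(m)`, in which that ball is
closed by Fatou's lemma, so the fixed point decays exponentially. -/
theorem exists_quadratic_fixedPoint (hC : 0 ≤ C) (hsym : ∀ a b, B a b = B b a)
    (hB : ∀ ε ∈ Icc (0 : ℝ) 1, ∀ a b,
      expNorm m ε (B a b) ≤ ENNReal.ofReal C * expNorm m ε a * expNorm m ε b)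
    {G : WeightedL2 m} {g ρ : ℝ} (hg : 0 ≤ g) (hG : expNorm m 1 G = ENNReal.ofReal g)
    (h : 8 * C * |ρ| * g ≤ 1) :
    ∃ w : WeightedL2 m, expNorm m 1 w ≤ ENNReal.ofReal (2 * |ρ| * g) ∧
      w = ρ • G + (1 / 2 : ℝ) • B w w := by
  have hρ := abs_nonneg ρ
  have hρg := mul_nonneg hρ hg
  have h' : C * (|ρ| * g) ≤ 1 / 8 := by linarith
  have hs : ∀ a ∈ {a : WeightedL2 m | expNorm m 1 a ≤ ENNReal.ofReal (2 * |ρ| * g)},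
      ‖a‖ ≤ 2 * |ρ| * g := fun a ha => by
    rw [norm_eq_expNorm]
    exact ENNReal.toReal_le_of_le_ofReal (by positivity) ((expNorm_mono zero_le_one _).trans ha)
  refine (exists_fixedPoint_of_half
    (isClosed_expNorm_le (m := m) 1 (ENNReal.ofReal (2 * |ρ| * g)))
    ⟨0, expNorm_coe_zero.le.trans zero_le⟩ (f := fun w => ρ • G + (1 / 2 : ℝ) • B w w) ?_ ?_).imp
    fun w hw => ⟨hw.1, hw.2.symm⟩
  · intro a ha
    refine (expNorm_coe_add_le _ _ _).trans ?_
    rw [expNorm_coe_smul, expNorm_coe_smul, hG]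
    refine (add_le_add le_rfl (mul_le_mul_right ((hB 1 ⟨zero_le_one, le_rfl⟩ a a).trans
      (mul_le_mul' (mul_le_mul_right ha _) ha)) _)).trans ?_
    rw [← ENNReal.ofReal_mul hρ, ← ENNReal.ofReal_mul hC, ← ENNReal.ofReal_mul (by positivity),
      ← ENNReal.ofReal_mul (by positivity), ← ENNReal.ofReal_add hρg (by positivity)]
    refine ENNReal.ofReal_le_ofReal ?_
    rw [abs_of_pos (by norm_num : (0 : ℝ) < 1 / 2)]
    nlinarith [mul_le_mul_of_nonneg_right h' hρg]
  · intro a ha b hb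
    have e : ρ • G + (1 / 2 : ℝ) • B a a - (ρ • G + (1 / 2 : ℝ) • B b b)
        = (1 / 2 : ℝ) • B (a - b) (a + b) := by
      rw [← bilin_self_sub hsym, smul_sub]
      abel
    rw [e, norm_smul, Real.norm_of_nonneg (by norm_num)]
    refine mul_le_mul_of_nonneg_left ?_ (by norm_num)
    refine (norm_bilin_le hC (hB 0 ⟨le_rfl, zero_le_one⟩) _ _).trans ?_
    have h1 : ‖a + b‖ ≤ 4 * (|ρ| * g) := (norm_add_le _ _).trans (by linarith [hs a ha, hs b hb])
    have h2 : C * ‖a + b‖ ≤ 1 := (mul_le_mul_of_nonneg_left h1 hC).trans (by linarith)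
    nlinarith [norm_nonneg (a - b), mul_le_mul_of_nonneg_left h2 (norm_nonneg (a - b))]

/-- By symmetry `B a a - B b b = B (a - b) (a + b)`, so the difference is bounded by `C (‖a‖ + ‖b‖)
/ 2 < 1` times itself. -/
theorem quadratic_fixedPoint_unique (hC : 0 ≤ C) (hsym : ∀ a b, B a b = B b a)
    (hB : ∀ a b, expNorm m 0 (B a b) ≤ ENNReal.ofReal C * expNorm m 0 a * expNorm m 0 b)
    {k a b : WeightedL2 m} (ha : a = k + (1 / 2 : ℝ) • B a a) (hb : b = k + (1 / 2 : ℝ) • B b b)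
    (h : C * (‖a‖ + ‖b‖) < 2) : a = b := by
  have e : a - b = (1 / 2 : ℝ) • B (a - b) (a + b) := by
    rw [← bilin_self_sub hsym, smul_sub]
    nth_rewrite 1 [ha, hb]
    abel
  have h1 : ‖a - b‖ ≤ 1 / 2 * (C * ‖a - b‖ * (‖a‖ + ‖b‖)) := by
    nth_rewrite 1 [e]
    rw [norm_smul, Real.norm_of_nonneg (by norm_num)]
    refine mul_le_mul_of_nonneg_left ((norm_bilin_le hC hB _ _).trans ?_) (by norm_num)
    exact mul_le_mul_of_nonneg_left (norm_add_le _ _) (by positivity)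
  by_contra hne
  have h2 : 0 < ‖a - b‖ := norm_pos_iff.2 (sub_ne_zero.2 hne)
  nlinarith [mul_lt_mul_of_pos_left h h2]

/-- The invariant set imposes the bounds for all `ε` at once and is closed in `L²(m)`; the
contraction is used only there. The factor `2` is the sum of the geometric series of ratio `1/2`. -/
theorem exists_resolvent {A : WeightedL2 m →ₗ[ℝ] WeightedL2 m}
    (hA : ∀ ε ∈ Ico (0 : ℝ) 1, ∀ h, expNorm m ε (A h) ≤ 2⁻¹ * expNorm m ε h) (h : WeightedL2 m) :
    ∃ g : WeightedL2 m, (∀ ε ∈ Ico (0 : ℝ) 1, expNorm m ε g ≤ 2 * expNorm m ε h) ∧ g = h + A g := by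
  have hcl : IsClosed {g : WeightedL2 m | ∀ ε ∈ Ico (0 : ℝ) 1, expNorm m ε g ≤ 2 * expNorm m ε h} := by
    simp only [ofPred_forall]
    exact isClosed_iInter fun ε => isClosed_iInter fun _ => isClosed_expNorm_le ε _
  refine (exists_fixedPoint_of_half hcl
    ⟨0, fun ε _ => expNorm_coe_zero.le.trans zero_le⟩ (f := fun g => h + A g) ?_ ?_).imp
    fun g hg => ⟨hg.1, hg.2.symm⟩
  · intro a ha ε hε
    refine (expNorm_coe_add_le _ _ _).trans ?_
    rw [two_mul]
    refine add_le_add le_rfl ((hA ε hε a).trans ((mul_le_mul_right (ha ε hε) _).trans ?_))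
    rw [← mul_assoc, ENNReal.inv_mul_cancel (by norm_num) (by norm_num), one_mul]
  · intro a _ b _
    have e : h + A a - (h + A b) = A (a - b) := by
      rw [map_sub]
      abel
    rw [e, norm_eq_expNorm, norm_eq_expNorm]
    have := ENNReal.toReal_mono (by
      have := expNorm_coe_lt_top (a - b)
      finiteness) (hA 0 ⟨le_rfl, one_pos⟩ (a - b))
    simpa using this

theorem resolvent_unique {A : WeightedL2 m →ₗ[ℝ] WeightedL2 m}
    (hA : ∀ h, expNorm m 0 (A h) ≤ 2⁻¹ * expNorm m 0 h) {g h g' : WeightedL2 m}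
    (e : g = h + A g) (e' : g' = h + A g') : g = g' := by
  have h1 : g - g' = A (g - g') := by
    rw [map_sub]
    nth_rewrite 1 [e, e']
    abel
  have := ENNReal.toReal_mono (by
      have := expNorm_coe_lt_top (g - g')
      finiteness) (hA (g - g'))
  rw [← h1, ENNReal.toReal_mul, ← norm_eq_expNorm] at this
  have h2 : ‖g - g'‖ = 0 := by
    norm_num at this
    linarith [norm_nonneg (g - g')]
  exact sub_eq_zero.1 (norm_eq_zero.1 h2)

end Quadratic

end BurgersVortex

end


/-! ### The interaction as a bilinear map, locally uniform bounds, and vortices as fixed points. -/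

noncomputable section

namespace BurgersVortex

open Filter Topology

/-! ### The operators on `L²(m)` -/

theorem rate_mem_of_mem {lam : ℝ} (h : lam ∈ Ico (0 : ℝ) 1) (j : Fin 2) :
    rate lam j ∈ Icc ((1 - lam) / 2) 1 := by
  obtain ⟨h0, h1⟩ := h
  fin_cases j
  · exact ⟨by simp [rate]; linarith, by simp [rate]; linarith⟩
  · exact ⟨by simp [rate], by simp [rate]; linarith⟩

theorem exists_rate_mem {lam : ℝ} (h : lam ∈ Ico (0 : ℝ) 1) :
    ∃ δ : ℝ, 0 < δ ∧ δ ≤ 1 / 2 ∧ ∀ j, rate lam j ∈ Icc δ 1 :=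
  ⟨(1 - lam) / 2, by linarith [h.2], by linarith [h.1], rate_mem_of_mem h⟩

/-- The second rate tends to zero as the asymmetry tends to one, so a lower bound, and with it every
constant below, is uniform only locally. -/
theorem exists_rate_mem_nhds {mu : ℝ} (h : mu ∈ Ico (0 : ℝ) 1) :
    ∃ δ : ℝ, 0 < δ ∧ δ ≤ 1 / 2 ∧
      ∃ U ∈ 𝓝 mu, ∀ lam ∈ U, lam ∈ Ico (0 : ℝ) 1 → ∀ j, rate lam j ∈ Icc δ 1 := by
  refine ⟨(1 - mu) / 4, by linarith [h.2], by linarith [h.1], Iio ((1 + mu) / 2),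
    Iio_mem_nhds (by linarith [h.2]), fun lam hl hlam j => ?_⟩
  have hl' : lam < (1 + mu) / 2 := hl
  exact ⟨by linarith [(rate_mem_of_mem hlam j).1], (rate_mem_of_mem hlam j).2⟩

section Operators

variable {m : ℝ}

/-- The class of the Gaussian vortex. -/
def vortexClass (m lam : ℝ) : WeightedL2 m := toWeightedL2 m (gaussianVortex lam)

theorem coe_vortexClass (hm : 3 / 2 < m) {lam : ℝ} (h : lam ∈ Ico (0 : ℝ) 1) :
    vortexClass m lam =ᵐ[volume] gaussianVortex lam := by
  obtain ⟨δ, hδ, -, hr⟩ := exists_rate_mem h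
  exact coe_toWeightedL2 (memLp_gaussianVortex (by linarith) hδ hr)

theorem coe_toWeightedL2_flux (hm : 3 / 2 < m) {lam : ℝ} (h : lam ∈ Ico (0 : ℝ) 1)
    (a b : WeightedL2 m) :
    toWeightedL2 m (invDiv lam (flux a b)) =ᵐ[volume] invDiv lam (flux a b) := by
  obtain ⟨δ, hδ, hδ1, hr⟩ := exists_rate_mem h
  exact coe_toWeightedL2 (memLp_invDiv_flux hm hδ hδ1 hr (Lp.memLp a) (Lp.memLp b))

theorem toWeightedL2_flux_symm (lam : ℝ) (a b : WeightedL2 m) :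
    toWeightedL2 m (invDiv lam (flux a b)) = toWeightedL2 m (invDiv lam (flux b a)) := by
  rw [flux_symm]

theorem toWeightedL2_flux_add_smul (hm : 3 / 2 < m) {lam : ℝ} (h : lam ∈ Ico (0 : ℝ) 1) (c : ℝ)
    (a a' b : WeightedL2 m) :
    toWeightedL2 m (invDiv lam (flux ⇑(a + c • a') b)) =
      toWeightedL2 m (invDiv lam (flux a b)) + c • toWeightedL2 m (invDiv lam (flux a' b)) := by
  obtain ⟨δ, hδ, hδ1, hr⟩ := exists_rate_mem h
  have hab := fun j => integrable_flux hm (Lp.memLp a) (Lp.memLp b) j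
  have hab' := fun j => integrable_flux hm (Lp.memLp a') (Lp.memLp b) j
  have e : ⇑(a + c • a') =ᵐ[volume] fun x => a x + c * a' x := by
    filter_upwards [coe_add_weightedL2 a (c • a'), coe_smul_weightedL2 c a'] with x h1 h2
    rw [h1, h2]
  have e2 : invDiv lam (flux ⇑(a + c • a') b) =
      invDiv lam fun x j => flux a b x j + c * flux a' b x j := by
    refine invDiv_congr ?_
    filter_upwards [flux_congr e (EventuallyEq.refl _ (b : Plane → ℝ)),
      flux_add_mul hm b (Lp.memLp a) (Lp.memLp a') c] with x h1 h2 j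
    rw [h1, h2]
  refine weightedL2_ext ?_
  filter_upwards [coe_toWeightedL2_flux hm h (a + c • a') b, coe_toWeightedL2_flux hm h a b,
    coe_toWeightedL2_flux hm h a' b,
    coe_add_weightedL2 (toWeightedL2 m (invDiv lam (flux a b)))
      (c • toWeightedL2 m (invDiv lam (flux a' b))),
    coe_smul_weightedL2 c (toWeightedL2 m (invDiv lam (flux a' b))),
    invDiv_add hδ hr hab fun j => (hab' j).const_mul c] with x h1 h2 h3 h4 h5 h6
  rw [h1, e2, h6, h4, h5, h2, h3, invDiv_const_mul]

theorem toWeightedL2_flux_add (hm : 3 / 2 < m) {lam : ℝ} (h : lam ∈ Ico (0 : ℝ) 1)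
    (a a' b : WeightedL2 m) :
    toWeightedL2 m (invDiv lam (flux ⇑(a + a') b)) =
      toWeightedL2 m (invDiv lam (flux a b)) + toWeightedL2 m (invDiv lam (flux a' b)) := by
  have := toWeightedL2_flux_add_smul hm h 1 a a' b
  rwa [one_smul, one_smul] at this

theorem toWeightedL2_flux_smul (hm : 3 / 2 < m) {lam : ℝ} (h : lam ∈ Ico (0 : ℝ) 1) (c : ℝ)
    (a b : WeightedL2 m) :
    toWeightedL2 m (invDiv lam (flux ⇑(c • a) b)) =
      c • toWeightedL2 m (invDiv lam (flux a b)) := by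
  have h0 := toWeightedL2_flux_add hm h 0 0 b
  rw [add_zero, left_eq_add] at h0
  have := toWeightedL2_flux_add_smul hm h c 0 a b
  rwa [h0, zero_add, zero_add] at this

/-- `(a, b) ↦ invDiv (flux a b)` on `L²(m)`. -/
def interaction (hm : 3 / 2 < m) (lam : ℝ) :
    WeightedL2 m →ₗ[ℝ] WeightedL2 m →ₗ[ℝ] WeightedL2 m :=
  open Classical in
  if h : lam ∈ Ico (0 : ℝ) 1 then
    LinearMap.mk₂ ℝ (fun a b => toWeightedL2 m (invDiv lam (flux a b)))
      (toWeightedL2_flux_add hm h) (toWeightedL2_flux_smul hm h)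
      (fun a b b' => by
        simp only [toWeightedL2_flux_symm lam a]
        exact toWeightedL2_flux_add hm h b b' a)
      (fun c a b => by
        simp only [toWeightedL2_flux_symm lam a]
        exact toWeightedL2_flux_smul hm h c b a)
  else 0

theorem coe_interaction (hm : 3 / 2 < m) {lam : ℝ} (h : lam ∈ Ico (0 : ℝ) 1)
    (a b : WeightedL2 m) : interaction hm lam a b =ᵐ[volume] invDiv lam (flux a b) := by
  unfold interaction
  rw [dif_pos h]
  exact coe_toWeightedL2_flux hm h a b

theorem interaction_symm (hm : 3 / 2 < m) (lam : ℝ) (a b : WeightedL2 m) :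
    interaction hm lam a b = interaction hm lam b a := by
  unfold interaction
  split_ifs
  · exact toWeightedL2_flux_symm lam a b
  · rfl

theorem interaction_of_not_mem (hm : 3 / 2 < m) {lam : ℝ} (h : lam ∉ Ico (0 : ℝ) 1) :
    interaction hm lam = 0 := by
  unfold interaction
  rw [dif_neg h]

/-- Uniform bounds for the operators, for asymmetries in the set `U`. -/
structure UniformBound (hm : 3 / 2 < m) (U : Set ℝ) (C g : ℝ) : Prop where
  pos : 0 < C
  one_le : 1 ≤ g
  interaction_le : ∀ lam ∈ U, lam ∈ Ico (0 : ℝ) 1 → ∀ ε ∈ Icc (0 : ℝ) 1, ∀ a b : WeightedL2 m,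
    expNorm m ε (interaction hm lam a b) ≤ ENNReal.ofReal C * expNorm m ε a * expNorm m ε b
  vortex_le : ∀ lam ∈ U, lam ∈ Ico (0 : ℝ) 1 →
    expNorm m 1 (vortexClass m lam) ≤ ENNReal.ofReal g

theorem exists_uniformBound (hm : 3 / 2 < m) {mu : ℝ} (h : mu ∈ Ico (0 : ℝ) 1) :
    ∃ U ∈ 𝓝 mu, ∃ C g : ℝ, UniformBound hm U C g := by
  obtain ⟨δ, hδ, hδ1, U, hU, hr⟩ := exists_rate_mem_nhds h
  obtain ⟨C, hC, h1⟩ := expNorm_invDiv_flux_le hm hδ hδ1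
  obtain ⟨g, hg, h2⟩ := expNorm_gaussianVortex_le (m := m) (by linarith) hδ
  -- The added ones make `C` positive and `g` at least one; the latter is needed for the radius in
  -- the uniqueness statement.
  refine ⟨U, hU, C.toReal + 1, g.toReal + 1, by positivity, by simp, ?_, ?_⟩
  · intro lam hl hlam ε hε a b
    rw [expNorm_congr (coe_interaction hm hlam a b)]
    refine (h1 ε hε lam (hr lam hl hlam) a b (aestronglyMeasurable_coe a)
      (aestronglyMeasurable_coe b)).trans ?_
    gcongr
    exact ENNReal.le_ofReal_iff_toReal_le hC (by positivity) |>.2 (by linarith)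
  · intro lam hl hlam
    rw [expNorm_congr (coe_vortexClass hm hlam)]
    exact (h2 lam (hr lam hl hlam)).trans
      (ENNReal.le_ofReal_iff_toReal_le hg (by positivity) |>.2 (by linarith))

/-! ### Vortices as fixed points -/

theorem integrable_selfFlux (hm : 3 / 2 < m) {w : Plane → ℝ} (hw : MemLp w 2 (weightedMeasure m))
    (j : Fin 2) : Integrable fun x => selfFlux w x j := by
  rw [selfFlux_eq]
  exact (integrable_flux hm hw hw j).const_mul _

/-- Forwards, this is the representation by mass and flux. Backwards, both terms solve their linear
equations, and the `invDiv` term has zero mass, so the circulation is `ρ`. -/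
theorem isVortex_iff_ae_eq (hm : 3 / 2 < m) {ρ lam : ℝ} (h : lam ∈ Ico (0 : ℝ) 1) {w : Plane → ℝ}
    (hw : MemLp w 2 (weightedMeasure m)) :
    IsVortex ρ lam w ↔
      w =ᵐ[volume] fun x => ρ * gaussianVortex lam x + invDiv lam (selfFlux w) x := by
  obtain ⟨δ, hδ, hδ1, hr⟩ := exists_rate_mem h
  have hmo := integrable_moment hm hw
  have hf := fun j => integrable_selfFlux hm hw j
  have hi := integrable_of_moment hmo
  have hG := memLp_gaussianVortex (m := m) (by linarith) hδ hr
  have hT : MemLp (invDiv lam (selfFlux w)) 2 (weightedMeasure m) := by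
    rw [selfFlux_eq]
    refine (memLp_congr_ae (.of_forall fun x => invDiv_const_mul lam (1 / 2) _ x)).2 ?_
    exact (memLp_invDiv_flux hm hδ hδ1 hr hw hw).const_mul _
  have hst := isStationarySolution_iff (lam := lam) hmo (ae_absVelocity_lt_top hm hw) hf
  constructor
  · intro hv
    have := (hst.1 hv.stationary).ae_eq hδ hr hmo hf
    rwa [hv.circulation] at this
  · intro e
    have hs : Solves lam w (selfFlux w) := by
      have h1 := (solves_invDiv hδ hr hf (integrable_moment hm hT)).lin
        (fun j => ⟨hδ.le.trans (hr j).1, (hr j).2⟩)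
        (solves_gaussianVortex (rate_bounds hδ hr) (integrable_moment hm hG)) ρ
        (integrable_moment hm hT) (integrable_moment hm hG) hf (fun j => integrable_zero _ _ _)
      have h2 := h1.congr (h' := w) (by
        filter_upwards [e] with x hx
        rw [hx, add_comm])
      simpa using h2
    refine ⟨hst.2 hs, hi, ?_⟩
    rw [integral_congr_ae e, integral_add ((integrable_of_moment (integrable_moment hm hG)).const_mul _)
      (integrable_of_moment (integrable_moment hm hT)), integral_const_mul,
      integral_gaussianVortex fun j => (rate_bounds hδ hr j).1, integral_invDiv hδ hr hf]
    simp

theorem isVortex_coe_iff (hm : 3 / 2 < m) {ρ lam : ℝ} (h : lam ∈ Ico (0 : ℝ) 1)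
    (w : WeightedL2 m) :
    IsVortex ρ lam w ↔ w = ρ • vortexClass m lam + (1 / 2 : ℝ) • interaction hm lam w w := by
  rw [isVortex_iff_ae_eq hm h (Lp.memLp w), selfFlux_eq]
  have e : ⇑(ρ • vortexClass m lam + (1 / 2 : ℝ) • interaction hm lam w w) =ᵐ[volume]
      fun x => ρ * gaussianVortex lam x + invDiv lam (fun x j => 1 / 2 * flux w w x j) x := by
    filter_upwards [coe_add_weightedL2 (ρ • vortexClass m lam) ((1 / 2 : ℝ) • interaction hm lam w w),
      coe_smul_weightedL2 ρ (vortexClass m lam),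
      coe_smul_weightedL2 (1 / 2) (interaction hm lam w w), coe_vortexClass hm h,
      coe_interaction hm h w w] with x h1 h2 h3 h4 h5
    rw [h1, h2, h3, h4, h5, invDiv_const_mul]
  exact ⟨fun H => weightedL2_ext (H.trans e.symm), fun H => (EventuallyEq.of_eq (congrArg (fun v : WeightedL2 m => (v : Plane → ℝ)) H)).trans e⟩

end Operators

end BurgersVortex

end


/-! ### The scale of exponentially decaying functions, the shear operator, and resolvents. -/

noncomputable section

namespace BurgersVortex

open Filter Topology

section Scale

variable {m : ℝ}

/-! ### Exponentially decaying elements of `L²(m)` -/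

/-- The elements of `L²(m)` that decay exponentially, at every rate below `1`. -/
def decaySpace (m : ℝ) : Submodule ℝ (WeightedL2 m) where
  carrier := {h | ∀ ε ∈ Ico (0 : ℝ) 1, expNorm m ε h < ⊤}
  add_mem' ha hb ε hε := (expNorm_coe_add_le ε _ _).trans_lt (ENNReal.add_lt_top.2 ⟨ha ε hε, hb ε hε⟩)
  zero_mem' ε _ := expNorm_coe_zero.trans_lt ENNReal.zero_lt_top
  smul_mem' c a ha ε hε := by
    rw [expNorm_coe_smul]
    exact ENNReal.mul_lt_top ENNReal.ofReal_lt_top (ha ε hε)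

theorem mem_decaySpace_of_expNorm_one {a : WeightedL2 m} (h : expNorm m 1 a < ⊤) :
    a ∈ decaySpace m := fun _ hε => (expNorm_mono hε.2.le _).trans_lt h

open Classical in
/-- The norms of the scale. -/
def decayNorm (m ε : ℝ) : Seminorm ℝ (decaySpace m) :=
  if hε : ε ∈ Ico (0 : ℝ) 1 then
    Seminorm.of (fun h => (expNorm m ε (h : WeightedL2 m)).toReal)
      (fun a b => by
        rw [← ENNReal.toReal_add (a.2 ε hε).ne (b.2 ε hε).ne]
        exact ENNReal.toReal_mono (ENNReal.add_lt_top.2 ⟨a.2 ε hε, b.2 ε hε⟩).ne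
          (expNorm_coe_add_le ε _ _))
      (fun c a => by
        rw [Submodule.coe_smul, expNorm_coe_smul, ENNReal.toReal_mul,
          ENNReal.toReal_ofReal (abs_nonneg _), Real.norm_eq_abs])
  else 0

theorem decayNorm_apply {ε : ℝ} (hε : ε ∈ Ico (0 : ℝ) 1) (h : decaySpace m) :
    decayNorm m ε h = (expNorm m ε (h : WeightedL2 m)).toReal := by
  unfold decayNorm
  rw [dif_pos hε]
  rfl

theorem ofReal_decayNorm {ε : ℝ} (hε : ε ∈ Ico (0 : ℝ) 1) (h : decaySpace m) :
    ENNReal.ofReal (decayNorm m ε h) = expNorm m ε (h : WeightedL2 m) := by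
  rw [decayNorm_apply hε, ENNReal.ofReal_toReal (h.2 ε hε).ne]

theorem decayNorm_le_iff {ε c : ℝ} (hε : ε ∈ Ico (0 : ℝ) 1) (h : decaySpace m) (hc : 0 ≤ c) :
    decayNorm m ε h ≤ c ↔ expNorm m ε (h : WeightedL2 m) ≤ ENNReal.ofReal c := by
  rw [← ofReal_decayNorm hε, ENNReal.ofReal_le_ofReal_iff hc]

open Classical in
/-- An element of `L²(m)` in the scale, zero if it does not decay. -/
def toDecaySpace (a : WeightedL2 m) : decaySpace m :=
  if h : a ∈ decaySpace m then ⟨a, h⟩ else 0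

theorem coe_toDecaySpace {a : WeightedL2 m} (h : a ∈ decaySpace m) :
    (toDecaySpace a : WeightedL2 m) = a := by
  unfold toDecaySpace
  rw [dif_pos h]

theorem vortexClass_mem (hm : 3 / 2 < m) {lam : ℝ} (h : lam ∈ Ico (0 : ℝ) 1) :
    expNorm m 1 (vortexClass m lam) < ⊤ := by
  obtain ⟨U, hU, C, g, hb⟩ := exists_uniformBound hm h
  exact (hb.vortex_le lam (mem_of_mem_nhds hU) h).trans_lt ENNReal.ofReal_lt_top

theorem interaction_mem (hm : 3 / 2 < m) (lam : ℝ) (a b : decaySpace m) :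
    interaction hm lam a b ∈ decaySpace m := by
  by_cases h : lam ∈ Ico (0 : ℝ) 1
  · intro ε hε
    obtain ⟨U, hU, C, g, hb⟩ := exists_uniformBound hm h
    refine (hb.interaction_le lam (mem_of_mem_nhds hU) h ε ⟨hε.1, hε.2.le⟩ a b).trans_lt ?_
    exact ENNReal.mul_lt_top (ENNReal.mul_lt_top ENNReal.ofReal_lt_top (a.2 ε hε)) (b.2 ε hε)
  · rw [interaction_of_not_mem hm h]
    exact zero_mem _

/-- The bilinear map `interaction` in the scale. -/
def decayInteraction (hm : 3 / 2 < m) (lam : ℝ) :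
    decaySpace m →ₗ[ℝ] decaySpace m →ₗ[ℝ] decaySpace m :=
  LinearMap.mk₂ ℝ (fun a b => ⟨interaction hm lam a b, interaction_mem hm lam a b⟩)
    (fun a a' b => Subtype.ext (by simp)) (fun c a b => Subtype.ext (by simp))
    (fun a b b' => Subtype.ext (by simp)) (fun c a b => Subtype.ext (by simp))

/-! ### The dependence on the asymmetry -/

/-- The class of `invDiv (shear a)`. -/
def shearClass (mu : ℝ) (a : WeightedL2 m) : WeightedL2 m := toWeightedL2 m (invDiv mu (shear a))

/-- `ε'` is the midpoint of `ε` and `1`. Since `1` is excluded from the scale there is always room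
for it, and the loss can be repeated any number of times. -/
theorem exists_expNorm_shear_le (hm : 3 / 2 < m) {mu : ℝ} (h : mu ∈ Ico (0 : ℝ) 1) {ε : ℝ}
    (hε : ε ∈ Ico (0 : ℝ) 1) :
    ∃ ε' ∈ Ico (0 : ℝ) 1, ∃ C : ℝ, 0 ≤ C ∧ ∃ U ∈ 𝓝 mu, ∀ lam ∈ U, lam ∈ Ico (0 : ℝ) 1 →
      ∀ a : WeightedL2 m,
        expNorm m ε (invDiv lam (shear a)) ≤ ENNReal.ofReal C * expNorm m ε' a := by
  obtain ⟨δ, hδ, hδ1, U, hU, hr⟩ := exists_rate_mem_nhds h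
  obtain ⟨C, hC, h1⟩ := expNorm_invDiv_shear_le (ε := (1 + ε) / 2) (ε' := ε) hm hδ hδ1
    ⟨hε.1, hε.2.le⟩ (by linarith [hε.2])
  refine ⟨(1 + ε) / 2, ⟨by linarith [hε.1], by linarith [hε.2]⟩, C.toReal, ENNReal.toReal_nonneg,
    U, hU, fun lam hl hlam a => ?_⟩
  rw [ENNReal.ofReal_toReal hC]
  exact h1 lam (hr lam hl hlam) a (aestronglyMeasurable_coe a)

theorem coe_shearClass (hm : 3 / 2 < m) {mu : ℝ} (h : mu ∈ Ico (0 : ℝ) 1) (a : decaySpace m) :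
    shearClass mu (a : WeightedL2 m) =ᵐ[volume] invDiv mu (shear (a : WeightedL2 m)) := by
  obtain ⟨ε', hε', C, -, U, hU, h1⟩ := exists_expNorm_shear_le hm h ⟨le_rfl, one_pos⟩
  obtain ⟨δ, hδ, -, hr⟩ := exists_rate_mem h
  refine coe_toWeightedL2 (memLp_weighted_iff.2 ⟨(integrable_invDiv hδ hr
    (integrable_shear (integrable_moment hm (Lp.memLp _)))).aestronglyMeasurable, ?_⟩)
  exact (h1 mu (mem_of_mem_nhds hU) h _).trans_lt
    (ENNReal.mul_lt_top ENNReal.ofReal_lt_top (a.2 ε' hε'))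

theorem shearClass_mem (hm : 3 / 2 < m) {mu : ℝ} (h : mu ∈ Ico (0 : ℝ) 1) (a : decaySpace m) :
    shearClass mu (a : WeightedL2 m) ∈ decaySpace m := by
  intro ε hε
  obtain ⟨ε', hε', C, -, U, hU, h1⟩ := exists_expNorm_shear_le hm h hε
  rw [expNorm_congr (coe_shearClass hm h a)]
  exact (h1 mu (mem_of_mem_nhds hU) h _).trans_lt
    (ENNReal.mul_lt_top ENNReal.ofReal_lt_top (a.2 ε' hε'))

theorem shearClass_add_smul (hm : 3 / 2 < m) {mu : ℝ} (h : mu ∈ Ico (0 : ℝ) 1) (c : ℝ)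
    (a a' : decaySpace m) :
    shearClass mu (a + c • a' : WeightedL2 m) = shearClass mu (a : WeightedL2 m) +
      c • shearClass mu (a' : WeightedL2 m) := by
  obtain ⟨δ, hδ, -, hr⟩ := exists_rate_mem h
  have hs := fun b : WeightedL2 m => integrable_shear (integrable_moment hm (Lp.memLp b))
  have e : invDiv mu (shear ⇑((a : WeightedL2 m) + c • (a' : WeightedL2 m))) =
      invDiv mu fun x j => shear (a : WeightedL2 m) x j + c * shear (a' : WeightedL2 m) x j := by
    refine invDiv_congr ?_
    filter_upwards [coe_add_weightedL2 (a : WeightedL2 m) (c • (a' : WeightedL2 m)),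
      coe_smul_weightedL2 c (a' : WeightedL2 m)] with x h1 h2 j
    unfold shear
    rw [h1, h2]
    ring
  refine weightedL2_ext ?_
  filter_upwards [coe_shearClass hm h (a + c • a'), coe_shearClass hm h a, coe_shearClass hm h a',
    coe_add_weightedL2 (shearClass mu (a : WeightedL2 m)) (c • shearClass mu (a' : WeightedL2 m)),
    coe_smul_weightedL2 c (shearClass mu (a' : WeightedL2 m)),
    invDiv_add hδ hr (hs a) fun j => (hs a' j).const_mul c] with x h1 h2 h3 h4 h5 h6
  rw [Submodule.coe_add, Submodule.coe_smul] at h1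
  rw [h1, e, h6, h4, h5, h2, h3, invDiv_const_mul]

open Classical in
/-- The map `shearClass` in the scale. -/
def decayShear (hm : 3 / 2 < m) (mu : ℝ) : decaySpace m →ₗ[ℝ] decaySpace m :=
  if h : mu ∈ Ico (0 : ℝ) 1 then
    { toFun := fun a => ⟨shearClass mu (a : WeightedL2 m), shearClass_mem hm h a⟩
      map_add' := fun a b => Subtype.ext (by
        have := shearClass_add_smul hm h 1 a b
        rwa [one_smul, one_smul] at this)
      map_smul' := fun c a => Subtype.ext (by
        have h0 := shearClass_add_smul hm h 1 0 0
        have := shearClass_add_smul hm h c 0 a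
        rw [one_smul, one_smul, Submodule.coe_zero, add_zero, left_eq_add] at h0
        rwa [Submodule.coe_zero, h0, zero_add, zero_add] at this) }
  else 0

theorem coe_decayShear (hm : 3 / 2 < m) {mu : ℝ} (h : mu ∈ Ico (0 : ℝ) 1) (a : decaySpace m) :
    (decayShear hm mu a : WeightedL2 m) = shearClass mu (a : WeightedL2 m) := by
  unfold decayShear
  rw [dif_pos h]
  rfl

/-- Common source of the three identities below: a solution at `lam` solves the equation at `mu`
with the additional flux `(mu - lam) shear`. The Gaussian has mass one and zero flux; the
interaction and the shear have mass zero. -/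
theorem eq_sub_shearClass (hm : 3 / 2 < m) {lam mu : ℝ} (hlam : lam ∈ Ico (0 : ℝ) 1)
    (hmu : mu ∈ Ico (0 : ℝ) 1) {a : decaySpace m} {b : WeightedL2 m} {h : Plane → ℝ}
    {f : Plane → Fin 2 → ℝ} (hs : Solves lam h f) (e : (a : WeightedL2 m) =ᵐ[volume] h)
    (hf : ∀ j, Integrable fun x => f x j)
    (hb : b =ᵐ[volume] fun x => (∫ y, h y) * gaussianVortex mu x + invDiv mu f x) :
    (a : WeightedL2 m) = b - (lam - mu) • shearClass mu (a : WeightedL2 m) := by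
  obtain ⟨δ, hδ, -, hr⟩ := exists_rate_mem hlam
  obtain ⟨δ', hδ', -, hr'⟩ := exists_rate_mem hmu
  have h1 := (hs.congr e.symm).eq_sub hδ hδ' hr hr' (integrable_moment hm (Lp.memLp _)) hf
  rw [integral_congr_ae e] at h1
  refine weightedL2_ext ?_
  filter_upwards [h1, hb, coe_shearClass hm hmu a,
    coe_sub_weightedL2 b ((lam - mu) • shearClass mu (a : WeightedL2 m)),
    coe_smul_weightedL2 (lam - mu) (shearClass mu (a : WeightedL2 m))] with x h2 h3 h4 h5 h6
  rw [h2, h5, h3, h6, h4]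

theorem vortexClass_eq_sub (hm : 3 / 2 < m) {lam mu : ℝ} (hlam : lam ∈ Ico (0 : ℝ) 1)
    (hmu : mu ∈ Ico (0 : ℝ) 1) :
    vortexClass m lam = vortexClass m mu - (lam - mu) • shearClass mu (vortexClass m lam) := by
  obtain ⟨δ, hδ, -, hr⟩ := exists_rate_mem hlam
  refine eq_sub_shearClass hm hlam hmu
    (a := ⟨_, mem_decaySpace_of_expNorm_one (vortexClass_mem hm hlam)⟩)
    (solves_gaussianVortex (rate_bounds hδ hr) (integrable_moment hm
      (memLp_gaussianVortex (by linarith) hδ hr))) (coe_vortexClass hm hlam)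
    (fun j => integrable_zero _ _ _) ?_
  filter_upwards [coe_vortexClass hm hmu] with x hx
  have := invDiv_const_mul mu 0 0 x
  simp only [Pi.zero_apply, mul_zero, zero_mul] at this
  have h0 : invDiv mu 0 x = 0 := this
  rw [hx, integral_gaussianVortex fun j => (rate_bounds hδ hr j).1, h0, one_mul, add_zero]

theorem interaction_eq_sub (hm : 3 / 2 < m) {lam mu : ℝ} (hlam : lam ∈ Ico (0 : ℝ) 1)
    (hmu : mu ∈ Ico (0 : ℝ) 1) (a b : decaySpace m) :
    interaction hm lam a b = interaction hm mu a b -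
      (lam - mu) • shearClass mu (interaction hm lam a b) := by
  obtain ⟨δ, hδ, hδ1, hr⟩ := exists_rate_mem hlam
  have hf := fun j => integrable_flux hm (Lp.memLp (a : WeightedL2 m)) (Lp.memLp (b : WeightedL2 m)) j
  refine eq_sub_shearClass hm hlam hmu (a := ⟨_, interaction_mem hm lam a b⟩)
    (solves_invDiv hδ hr hf (integrable_moment hm (memLp_invDiv_flux hm hδ hδ1 hr (Lp.memLp _)
      (Lp.memLp _)))) (coe_interaction hm hlam _ _) hf ?_
  filter_upwards [coe_interaction hm hmu (a : WeightedL2 m) b] with x hx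
  rw [hx, integral_invDiv hδ hr hf, zero_mul, zero_add]

theorem shearClass_eq_sub (hm : 3 / 2 < m) {lam mu : ℝ} (hlam : lam ∈ Ico (0 : ℝ) 1)
    (hmu : mu ∈ Ico (0 : ℝ) 1) (a : decaySpace m) :
    shearClass lam (a : WeightedL2 m) = shearClass mu (a : WeightedL2 m) -
      (lam - mu) • shearClass mu (shearClass lam (a : WeightedL2 m)) := by
  obtain ⟨δ, hδ, hδ1, hr⟩ := exists_rate_mem hlam
  have hf := integrable_shear (integrable_moment hm (Lp.memLp (a : WeightedL2 m)))
  have e := coe_shearClass hm hlam a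
  refine eq_sub_shearClass hm hlam hmu (a := ⟨_, shearClass_mem hm hlam a⟩)
    (solves_invDiv hδ hr hf ((integrable_moment hm (Lp.memLp (shearClass lam (a : WeightedL2 m)))).congr
      (e.mono fun x hx => by simp only [hx]))) e hf ?_
  filter_upwards [coe_shearClass hm hmu a] with x hx
  rw [hx, integral_invDiv hδ hr hf, zero_mul, zero_add]

/-! ### Resolvents in the scale -/

/-- `A` is a contraction with constant `1/2` in every norm of the scale. -/
def IsHalfContraction (A : WeightedL2 m →ₗ[ℝ] WeightedL2 m) : Prop :=
  ∀ ε ∈ Ico (0 : ℝ) 1, ∀ h, expNorm m ε (A h) ≤ 2⁻¹ * expNorm m ε h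

theorem IsHalfContraction.exists_decay {A : WeightedL2 m →ₗ[ℝ] WeightedL2 m}
    (hA : IsHalfContraction A) (h : decaySpace m) :
    ∃ g : decaySpace m, (∀ ε ∈ Ico (0 : ℝ) 1, decayNorm m ε g ≤ 2 * decayNorm m ε h) ∧
      (g : WeightedL2 m) = h + A g := by
  obtain ⟨g, h1, h2⟩ := exists_resolvent hA h
  refine ⟨⟨g, fun ε hε => (h1 ε hε).trans_lt (ENNReal.mul_lt_top (by norm_num) (h.2 ε hε))⟩,
    fun ε hε => ?_, h2⟩
  rw [decayNorm_le_iff hε _ (by positivity), ENNReal.ofReal_mul (by norm_num), ofReal_decayNorm hε]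
  simpa using h1 ε hε

theorem IsHalfContraction.unique {A : WeightedL2 m →ₗ[ℝ] WeightedL2 m}
    (hA : IsHalfContraction A) {g h g' : WeightedL2 m} (e : g = h + A g) (e' : g' = h + A g') :
    g = g' := resolvent_unique (hA 0 ⟨le_rfl, one_pos⟩) e e'

open Classical in
/-- The inverse of `1 - A`. -/
def decayResolvent (A : WeightedL2 m →ₗ[ℝ] WeightedL2 m) : decaySpace m →ₗ[ℝ] decaySpace m :=
  if hA : IsHalfContraction A then
    { toFun := fun h => (hA.exists_decay h).choose
      map_add' := fun a b => Subtype.ext (hA.unique (hA.exists_decay (a + b)).choose_spec.2 (by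
        rw [Submodule.coe_add, map_add]
        nth_rewrite 1 [(hA.exists_decay a).choose_spec.2, (hA.exists_decay b).choose_spec.2]
        rw [Submodule.coe_add]
        abel))
      map_smul' := fun c a => Subtype.ext (hA.unique (hA.exists_decay (c • a)).choose_spec.2 (by
        rw [RingHom.id_apply, Submodule.coe_smul, map_smul]
        nth_rewrite 1 [(hA.exists_decay a).choose_spec.2]
        rw [Submodule.coe_smul, smul_add])) }
  else 0

theorem IsHalfContraction.resolvent_le {A : WeightedL2 m →ₗ[ℝ] WeightedL2 m}
    (hA : IsHalfContraction A) {ε : ℝ} (hε : ε ∈ Ico (0 : ℝ) 1) (h : decaySpace m) :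
    decayNorm m ε (decayResolvent A h) ≤ 2 * decayNorm m ε h := by
  unfold decayResolvent
  rw [dif_pos hA]
  exact (hA.exists_decay h).choose_spec.1 ε hε

theorem IsHalfContraction.resolvent_eq {A : WeightedL2 m →ₗ[ℝ] WeightedL2 m}
    (hA : IsHalfContraction A) (h : decaySpace m) :
    (decayResolvent A h : WeightedL2 m) = h + A (decayResolvent A h) := by
  unfold decayResolvent
  rw [dif_pos hA]
  exact (hA.exists_decay h).choose_spec.2

end Scale

end BurgersVortex

end


/-! ### The branch of vortices: radius, smoothness, quadratic estimate, uniqueness. -/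

noncomputable section

namespace BurgersVortex

open Filter Topology Asymptotics

section Branch

variable {m : ℝ}

/-! ### The branch of vortices -/

/-- The properties that define the vortex of circulation `p.1` and asymmetry `p.2`. -/
structure IsBranch (hm : 3 / 2 < m) (p : ℝ × ℝ) (w : WeightedL2 m) : Prop where
  lt_top : expNorm m 1 w < ⊤
  le : expNorm m 1 w ≤ ENNReal.ofReal (2 * |p.1|) * expNorm m 1 (vortexClass m p.2)
  eq : w = p.1 • vortexClass m p.2 + (1 / 2 : ℝ) • interaction hm p.2 w w

open Classical in
/-- The vortex of circulation `p.1` and asymmetry `p.2`. -/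
def branch (hm : 3 / 2 < m) (p : ℝ × ℝ) : WeightedL2 m :=
  if h : ∃ w, IsBranch hm p w then h.choose else 0

theorem branch_mem (hm : 3 / 2 < m) (p : ℝ × ℝ) : branch hm p ∈ decaySpace m := by
  unfold branch
  split_ifs with h
  · exact mem_decaySpace_of_expNorm_one h.choose_spec.lt_top
  · exact zero_mem _

/-- `R` is a radius of existence of the branch. -/
structure IsRadius (hm : 3 / 2 < m) (R : ℝ → ℝ) : Prop where
  pos : ∀ lam ∈ Ico (0 : ℝ) 1, 0 < R lam
  bound : ∀ lam ∈ Ico (0 : ℝ) 1, ∃ U ∈ 𝓝 lam, ∃ C g, UniformBound hm U C g ∧ 8 * C * R lam * g ≤ 1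

/-- The admissible radii at each asymmetry form an interval, and one constant serves a whole
neighbourhood. A partition of unity averages these local constants into a continuous selection. -/
theorem exists_isRadius (hm : 3 / 2 < m) : ∃ R, IsRadius hm R ∧ ContinuousOn R (Ico 0 1) := by
  set t : Ico (0 : ℝ) 1 → Set ℝ := fun lam =>
    {r | 0 < r ∧ ∃ U ∈ 𝓝 (lam : ℝ), ∃ C g, UniformBound hm U C g ∧ 8 * C * r * g ≤ 1}
  have hconv : ∀ lam, Convex ℝ (t lam) := by
    intro lam
    refine OrdConnected.convex ⟨?_⟩
    rintro a ⟨ha, -⟩ b ⟨hb, U, hU, C, g, hB, h⟩ c ⟨hac, hcb⟩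
    refine ⟨ha.trans_le hac, U, hU, C, g, hB, le_trans ?_ h⟩
    have := hB.pos
    have := hB.one_le
    gcongr
  have hloc : ∀ lam, ∃ r, ∀ᶠ mu in 𝓝 lam, r ∈ t mu := by
    intro lam
    obtain ⟨U, hU, C, g, hB⟩ := exists_uniformBound hm lam.2
    have h1 := hB.pos
    have h2 : 0 < g := one_pos.trans_le hB.one_le
    refine ⟨1 / (8 * C * g), ?_⟩
    have hev : ∀ᶠ mu : Ico (0 : ℝ) 1 in 𝓝 lam, ∀ᶠ x in 𝓝 (mu : ℝ), x ∈ U :=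
      continuous_subtype_val.continuousAt.eventually (eventually_eventually_nhds.2 hU)
    filter_upwards [hev] with mu hmu
    refine ⟨by positivity, U, hmu, C, g, hB, le_of_eq ?_⟩
    field_simp
  obtain ⟨R, hR⟩ := exists_continuous_forall_mem_convex_of_local_const hconv hloc
  classical
  refine ⟨fun lam => if h : lam ∈ Ico (0 : ℝ) 1 then R ⟨lam, h⟩ else 1,
    ⟨fun lam h => ?_, fun lam h => ?_⟩, ?_⟩
  · rw [dif_pos h]
    exact (hR ⟨lam, h⟩).1
  · rw [dif_pos h]
    exact (hR ⟨lam, h⟩).2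
  · rw [continuousOn_iff_continuous_domRestrict]
    refine R.continuous.congr fun lam => ?_
    rw [Set.domRestrict_apply, dif_pos lam.2]

variable {hm : 3 / 2 < m} {R : ℝ → ℝ} {U : Set ℝ} {C g : ℝ} {p : ℝ × ℝ}

/-- The domain of the branch. -/
def branchDomain (R : ℝ → ℝ) : Set (ℝ × ℝ) := {p | p.2 ∈ Ico (0 : ℝ) 1 ∧ |p.1| ≤ R p.2}

theorem IsRadius.exists_bound (hR : IsRadius hm R) (hp : p ∈ branchDomain R) :
    ∃ U ∈ 𝓝 p.2, ∃ C g, UniformBound hm U C g ∧ 8 * C * |p.1| * g ≤ 1 := by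
  obtain ⟨U, hU, C, g, hB, h⟩ := hR.bound p.2 hp.1
  refine ⟨U, hU, C, g, hB, le_trans ?_ h⟩
  have := hB.pos
  have := hB.one_le
  have := hp.2
  gcongr

theorem UniformBound.exists_isBranch (hB : UniformBound hm U C g) (hU : p.2 ∈ U)
    (hp : p.2 ∈ Ico (0 : ℝ) 1) (h : 8 * C * |p.1| * g ≤ 1) : ∃ w, IsBranch hm p w := by
  have hG := vortexClass_mem hm hp
  have hC := hB.pos.le
  obtain ⟨w, h1, h2⟩ := exists_quadratic_fixedPoint (ρ := p.1) hC (interaction_symm hm p.2)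
    (hB.interaction_le p.2 hU hp) (ENNReal.toReal_nonneg) (ENNReal.ofReal_toReal hG.ne).symm
    (le_trans (by
      gcongr
      exact ENNReal.toReal_le_of_le_ofReal (zero_le_one.trans hB.one_le) (hB.vortex_le p.2 hU hp)) h)
  rw [ENNReal.ofReal_mul (by positivity), ENNReal.ofReal_toReal hG.ne] at h1
  exact ⟨w, h1.trans_lt (ENNReal.mul_lt_top ENNReal.ofReal_lt_top hG), h1, h2⟩

theorem IsRadius.isBranch (hR : IsRadius hm R) (hp : p ∈ branchDomain R) :
    IsBranch hm p (branch hm p) := by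
  obtain ⟨U, hU, C, g, hB, h⟩ := hR.exists_bound hp
  have := hB.exists_isBranch (mem_of_mem_nhds hU) hp.1 h
  unfold branch
  rw [dif_pos this]
  exact this.choose_spec

theorem IsBranch.expNorm_le {w : WeightedL2 m} (hw : IsBranch hm p w)
    (hB : UniformBound hm U C g) (hU : p.2 ∈ U) (hp : p.2 ∈ Ico (0 : ℝ) 1) {ε : ℝ} (hε : ε ≤ 1) :
    expNorm m ε w ≤ ENNReal.ofReal (2 * |p.1| * g) := by
  rw [ENNReal.ofReal_mul (by positivity)]
  exact (expNorm_mono hε _).trans (hw.le.trans (mul_le_mul_right (hB.vortex_le p.2 hU hp) _))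

theorem IsBranch.norm_le {w : WeightedL2 m} (hw : IsBranch hm p w)
    (hB : UniformBound hm U C g) (hU : p.2 ∈ U) (hp : p.2 ∈ Ico (0 : ℝ) 1) :
    ‖w‖ ≤ 2 * |p.1| * g := by
  have := hB.one_le
  rw [norm_eq_expNorm]
  exact ENNReal.toReal_le_of_le_ofReal (by positivity) (hw.expNorm_le hB hU hp zero_le_one)

/-- The bound `2 |ρ| g` for `w` gives the operator norm `2 C |ρ| g`, so the condition `8 C |ρ| g ≤
2` suffices, twice what `IsRadius` guarantees. The slack lets `w` and the operator be taken at
different nearby parameters. -/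
theorem IsBranch.isHalfContraction {w : WeightedL2 m} (hw : IsBranch hm p w)
    (hB : UniformBound hm U C g) (hU : p.2 ∈ U) (hp : p.2 ∈ Ico (0 : ℝ) 1)
    (h : 8 * C * |p.1| * g ≤ 2) {mu : ℝ} (hmu : mu ∈ U) (hmu' : mu ∈ Ico (0 : ℝ) 1) :
    IsHalfContraction (interaction hm mu w) := by
  intro ε hε a
  refine (hB.interaction_le mu hmu hmu' ε ⟨hε.1, hε.2.le⟩ w a).trans (mul_le_mul_left ?_ _)
  refine (mul_le_mul_right (hw.expNorm_le hB hU hp hε.2.le) _).trans ?_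
  rw [← ENNReal.ofReal_mul hB.pos.le, ← ENNReal.ofReal_ofNat 2,
    ← ENNReal.ofReal_inv_of_pos (by norm_num)]
  exact ENNReal.ofReal_le_ofReal (by linarith)

/-- The branch, as a solution of a quadratic equation in the scale. -/
def branchProblem (hR : IsRadius hm R) : ScaleProblem (decaySpace m) where
  N := decayNorm m
  D := branchDomain R
  G lam := toDecaySpace (vortexClass m lam)
  T := decayInteraction hm
  Q := decayShear hm
  res p := decayResolvent (interaction hm p.2 (branch hm p))
  sol p := ⟨branch hm p, branch_mem hm p⟩
  T_bdd q hq ε hε := by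
    obtain ⟨U, hU, C, g, hB⟩ := exists_uniformBound hm hq.1
    refine ⟨C, ?_⟩
    filter_upwards [self_mem_nhdsWithin, nhdsWithin_le_nhds (continuous_snd.continuousAt hU)]
      with p hp hpU a b
    have := hB.pos
    rw [decayNorm_le_iff hε _ (by positivity), ENNReal.ofReal_mul (by positivity),
      ENNReal.ofReal_mul this.le, ofReal_decayNorm hε, ofReal_decayNorm hε]
    exact hB.interaction_le p.2 hpU hp.1 ε ⟨hε.1, hε.2.le⟩ a b
  Q_bdd q hq ε hε := by
    obtain ⟨ε', hε', C, hC, U, hU, h⟩ := exists_expNorm_shear_le hm hq.1 hε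
    refine ⟨ε', hε', C, ?_⟩
    filter_upwards [self_mem_nhdsWithin, nhdsWithin_le_nhds (continuous_snd.continuousAt hU)]
      with p hp hpU a
    rw [decayNorm_le_iff hε _ (by positivity), ENNReal.ofReal_mul hC, ofReal_decayNorm hε',
      coe_decayShear hm hp.1, expNorm_congr (coe_shearClass hm hp.1 a)]
    exact h p.2 hpU hp.1 a
  res_bdd p hp ε hε h := by
    obtain ⟨U, hU, C, g, hB, hb⟩ := hR.exists_bound hp
    have hU' := mem_of_mem_nhds hU
    exact ((hR.isBranch hp).isHalfContraction hB hU' hp.1 (by linarith) hU' hp.1).resolvent_le hε h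
  sol_bdd q hq ε hε := by
    obtain ⟨U, hU, C, g, hB⟩ := exists_uniformBound hm hq.1
    have h1 : ∀ᶠ p : ℝ × ℝ in 𝓝 q, |p.1| < |q.1| + 1 :=
      (continuous_fst.abs.continuousAt).eventually_lt_const (by simp)
    refine IsBigO.of_bound (2 * (|q.1| + 1) * g) ?_
    filter_upwards [self_mem_nhdsWithin, nhdsWithin_le_nhds (continuous_snd.continuousAt hU),
      nhdsWithin_le_nhds h1] with p hp hpU hpq
    have := hB.one_le
    rw [Real.norm_of_nonneg (apply_nonneg _ _), norm_one, mul_one,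
      decayNorm_le_iff hε _ (by positivity)]
    refine ((hR.isBranch hp).expNorm_le hB hpU hp.1 hε.2.le).trans (ENNReal.ofReal_le_ofReal ?_)
    gcongr
  T_sol q hq := by
    obtain ⟨U, hU, C, g, hB, hb⟩ := hR.bound q.2 hq.1
    -- A nearby point may exceed the radius at `q.2`, but not twice that radius, which is what
    -- `isHalfContraction` tolerates.
    have h1 : ∀ᶠ p : ℝ × ℝ in 𝓝 q, |p.1| < 2 * R q.2 :=
      (continuous_fst.abs.continuousAt).eventually_lt_const (by
        linarith [hq.2, hR.pos q.2 hq.1])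
    filter_upwards [self_mem_nhdsWithin, nhdsWithin_le_nhds (continuous_snd.continuousAt hU),
      nhdsWithin_le_nhds h1] with p hp hpU hpq ε hε h
    have hC := hB.pos
    have hg := hB.one_le
    have h2 : 8 * C * |p.1| * g ≤ 8 * C * (2 * R q.2) * g := by gcongr
    have h3 := (hR.isBranch hp).isHalfContraction hB hpU hp.1 (by linarith)
      (mem_of_mem_nhds hU) hq.1 ε hε h
    rw [decayNorm_le_iff hε _ (by positivity), ENNReal.ofReal_mul (by norm_num),
      ofReal_decayNorm hε, one_div, ENNReal.ofReal_inv_of_pos (by norm_num), ENNReal.ofReal_ofNat]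
    exact h3
  T_symm p _ a b := Subtype.ext (interaction_symm hm p.2 a b)
  G_sub p hp q hq := Subtype.ext (by
    have hG := fun {lam} h => coe_toDecaySpace
      (mem_decaySpace_of_expNorm_one (vortexClass_mem hm (lam := lam) h))
    rw [Submodule.coe_sub, Submodule.coe_smul, coe_decayShear hm hq.1, hG hp.1, hG hq.1]
    exact vortexClass_eq_sub hm hp.1 hq.1)
  T_sub p hp q hq a b := Subtype.ext (by
    rw [Submodule.coe_sub, Submodule.coe_smul, coe_decayShear hm hq.1]
    exact interaction_eq_sub hm hp.1 hq.1 a b)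
  Q_sub p hp q hq a := Subtype.ext (by
    rw [Submodule.coe_sub, Submodule.coe_smul, coe_decayShear hm hq.1, coe_decayShear hm hq.1,
      coe_decayShear hm hp.1]
    exact shearClass_eq_sub hm hp.1 hq.1 a)
  res_eq p hp h := Subtype.ext (by
    obtain ⟨U, hU, C, g, hB, hb⟩ := hR.exists_bound hp
    have hU' := mem_of_mem_nhds hU
    exact ((hR.isBranch hp).isHalfContraction hB hU' hp.1 (by linarith) hU' hp.1).resolvent_eq h)
  res_unique p hp h k hk := Subtype.ext (by
    obtain ⟨U, hU, C, g, hB, hb⟩ := hR.exists_bound hp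
    have hU' := mem_of_mem_nhds hU
    have hA := (hR.isBranch hp).isHalfContraction hB hU' hp.1 (by linarith) hU' hp.1
    exact hA.unique (congrArg Subtype.val hk) (hA.resolvent_eq h))
  sol_eq p hp := Subtype.ext (by
    rw [Submodule.coe_add, Submodule.coe_smul, Submodule.coe_smul, coe_toDecaySpace
      (mem_decaySpace_of_expNorm_one (vortexClass_mem hm hp.1))]
    exact (hR.isBranch hp).eq)

theorem IsRadius.contDiffOn_branch (hR : IsRadius hm R) :
    ContDiffOn ℝ ∞ (branch hm) (branchDomain R) :=
  (branchProblem hR).contDiffOn_sol (decaySpace m).subtype fun h => by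
    rw [Submodule.subtype_apply, norm_eq_expNorm]
    exact (decayNorm_apply ⟨le_rfl, one_pos⟩ h).ge

theorem expNorm_sub_vortex (hm : 3 / 2 < m) (ρ : ℝ) {lam : ℝ} (h : lam ∈ Ico (0 : ℝ) 1)
    {w : WeightedL2 m} {v : Plane → ℝ} (hv : w =ᵐ[volume] v) :
    weightedNorm m (fun x => v x - ρ * gaussianVortex lam x) =
      ENNReal.ofReal ‖w - ρ • vortexClass m lam‖ := by
  rw [norm_eq_expNorm, ENNReal.ofReal_toReal (expNorm_coe_lt_top _).ne, weightedNorm_eq_expNorm]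
  refine expNorm_congr ?_
  filter_upwards [coe_sub_weightedL2 w (ρ • vortexClass m lam), hv,
    coe_smul_weightedL2 ρ (vortexClass m lam), coe_vortexClass hm h] with x h1 h2 h3 h4
  rw [h1, h2, h3, h4]

/-- The difference is half of the interaction of `w` with itself, and `‖w‖ ≤ 2 |ρ| g`; the constant
is `C (2 g)² / 2`. -/
theorem IsBranch.norm_sub_le {w : WeightedL2 m} (hw : IsBranch hm p w)
    (hB : UniformBound hm U C g) (hU : p.2 ∈ U) (hp : p.2 ∈ Ico (0 : ℝ) 1) :
    ‖w - p.1 • vortexClass m p.2‖ ≤ 2 * C * g ^ 2 * p.1 ^ 2 := by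
  have hC := hB.pos.le
  have hg := zero_le_one.trans hB.one_le
  have h1 := norm_bilin_le hC (hB.interaction_le p.2 hU hp 0 ⟨le_rfl, zero_le_one⟩) w w
  have h2 := hw.norm_le hB hU hp
  have e : w - p.1 • vortexClass m p.2 = (1 / 2 : ℝ) • interaction hm p.2 w w := by
    nth_rewrite 1 [hw.eq]
    abel
  rw [e, norm_smul, Real.norm_of_nonneg (by norm_num)]
  have h3 : C * ‖w‖ * ‖w‖ ≤ C * (2 * |p.1| * g) * (2 * |p.1| * g) := by gcongr
  rw [← sq_abs p.1]
  linarith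

/-- A competitor has norm at most `2 R + R g` and the branch at most `2 R g`. As `g ≥ 1` the sum is
at most `5 R g`, and `5 C R g ≤ 5/8` is below the threshold `2` of `quadratic_fixedPoint_unique`. -/
theorem IsRadius.unique (hR : IsRadius hm R) (hp : p ∈ branchDomain R) {w : WeightedL2 m}
    (hw : w = p.1 • vortexClass m p.2 + (1 / 2 : ℝ) • interaction hm p.2 w w)
    (h : ‖w - p.1 • vortexClass m p.2‖ ≤ 2 * R p.2) : w = branch hm p := by
  obtain ⟨U, hU, C, g, hB, hb⟩ := hR.bound p.2 hp.1
  have hU' := mem_of_mem_nhds hU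
  have hC := hB.pos
  have hg := hB.one_le
  have hr := hR.pos p.2 hp.1
  have hbr := hR.isBranch hp
  refine quadratic_fixedPoint_unique hC.le (interaction_symm hm p.2)
    (hB.interaction_le p.2 hU' hp.1 0 ⟨le_rfl, zero_le_one⟩) hw hbr.eq ?_
  have h1 : ‖branch hm p‖ ≤ 2 * R p.2 * g := (hbr.norm_le hB hU' hp.1).trans (by
    have := hp.2
    gcongr)
  have h2 : ‖p.1 • vortexClass m p.2‖ ≤ R p.2 * g := by
    rw [norm_smul]
    refine mul_le_mul hp.2 ?_ (norm_nonneg _) hr.le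
    rw [norm_eq_expNorm]
    exact ENNReal.toReal_le_of_le_ofReal (by positivity)
      ((expNorm_mono zero_le_one _).trans (hB.vortex_le p.2 hU' hp.1))
  have h3 : ‖w‖ ≤ 2 * R p.2 + R p.2 * g := by
    have := norm_add_le (w - p.1 • vortexClass m p.2) (p.1 • vortexClass m p.2)
    rw [sub_add_cancel] at this
    linarith
  have h4 : R p.2 ≤ R p.2 * g := le_mul_of_one_le_right hr.le hg
  have h5 : C * (‖w‖ + ‖branch hm p‖) ≤ C * (5 * (R p.2 * g)) :=
    mul_le_mul_of_nonneg_left (by linarith) hC.le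
  linarith

end Branch

end BurgersVortex

end

/-! ### Assembly of the theorem. -/

theorem theorem2 (m : ℝ) (hm : 3 / 2 < m) :
    ∃ (R₁ K₁ : ℝ → ℝ) (ΩB : ℝ → ℝ → BurgersVortex.WeightedL2 m),
      ContinuousOn R₁ (Ico 0 1) ∧
      (∀ lam ∈ Ico (0 : ℝ) 1,
        0 < R₁ lam ∧ 0 < K₁ lam ∧
        ∀ ρ : ℝ, |ρ| ≤ R₁ lam →
          BurgersVortex.IsVortex ρ lam (ΩB ρ lam) ∧
          BurgersVortex.weightedNorm m
              (fun x => ΩB ρ lam x - ρ * BurgersVortex.gaussianVortex lam x)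
            ≤ ENNReal.ofReal (K₁ lam * ρ ^ 2) ∧
          ∀ w : BurgersVortex.Plane → ℝ,
            MemLp w 2 (BurgersVortex.weightedMeasure m) →
            BurgersVortex.IsVortex ρ lam w →
            BurgersVortex.weightedNorm m
                (fun x => w x - ρ * BurgersVortex.gaussianVortex lam x)
              ≤ ENNReal.ofReal (2 * R₁ lam) →
            w =ᵐ[volume] ΩB ρ lam) ∧
      ContDiffOn ℝ ∞ (fun p : ℝ × ℝ => ΩB p.1 p.2)
        {p : ℝ × ℝ | p.2 ∈ Ico (0 : ℝ) 1 ∧ |p.1| ≤ R₁ p.2} := by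
  obtain ⟨R, hR, hc⟩ := BurgersVortex.exists_isRadius hm
  -- The constants are chosen pointwise in the asymmetry; only the radius has to be continuous.
  choose! U hU C g hB _ using hR.bound
  refine ⟨R, fun lam => 2 * C lam * g lam ^ 2, fun ρ lam => BurgersVortex.branch hm (ρ, lam), hc,
    fun lam h => ⟨hR.pos lam h, ?_, fun ρ hρ => ?_⟩, hR.contDiffOn_branch⟩
  · have := (hB lam h).pos
    have := (hB lam h).one_le
    positivity
  have hp : (ρ, lam) ∈ BurgersVortex.branchDomain R := ⟨h, hρ⟩
  have hb := hR.isBranch hp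
  refine ⟨(BurgersVortex.isVortex_coe_iff hm h _).2 hb.eq, ?_, fun w hw hv hn => ?_⟩
  · rw [BurgersVortex.expNorm_sub_vortex hm ρ h (ae_eq_refl _)]
    exact ENNReal.ofReal_le_ofReal (hb.norm_sub_le (hB lam h) (mem_of_mem_nhds (hU lam h)) h)
  · have e := BurgersVortex.coe_toWeightedL2 hw
    have hv' := (BurgersVortex.isVortex_iff_ae_eq hm h hw).1 hv
    have hr := hR.pos lam h
    rw [BurgersVortex.expNorm_sub_vortex hm ρ h e,
      ENNReal.ofReal_le_ofReal_iff (by positivity)] at hn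
    -- The integral equation does not depend on the representative, so being a vortex passes from
    -- `w` to its class in `L²(m)`.
    have h1 : BurgersVortex.IsVortex ρ lam (BurgersVortex.toWeightedL2 m w) := by
      rw [BurgersVortex.isVortex_iff_ae_eq hm h (Lp.memLp _), BurgersVortex.selfFlux_eq,
        BurgersVortex.invDiv_congr (g := BurgersVortex.selfFlux w)]
      · exact e.trans hv'
      · rw [BurgersVortex.selfFlux_eq]
        filter_upwards [BurgersVortex.flux_congr e e] with x hx j
        rw [hx]
    have h2 := hR.unique hp ((BurgersVortex.isVortex_coe_iff hm h _).1 h1) hn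
    exact (h2 ▸ e).symm
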